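/- Let $W$ be a random variable with $W>0$ almost surely and $x_0:=\sup\{x>0:\mathbb P(W\le x)<1\}=1$, and let $\theta:=1+\mathbb E[W]$. Let $(W_i)_{i\ge1}$ be i.i.d. copies of $W$. The weighted recursive tree (WRT) starts with the single vertex $1$; for each $n\ge1$, conditionally on the vertex-weights $(W_i)_{i\ge 1}$ and on the tree on the vertices $1,\dots,n$, the new vertex $n+1$ connects to vertex $i\in\{1,\dots,n\}$ with probability $W_i/\sum_{j=1}^nW_j$, by an edge directed from $n+1$ to $i$. Let $\mathcal Z_n(i)$ be the in-degree of vertex $i$ in the tree with $n$ vertices. Fix $k\in\{1,2,\dots\}$, $c\in(0,\theta/(\theta-1))$ and $\eta\in(0,1)$. For $n\ge k$ let $v_1,\dots,v_k$ be chosen uniformly at random without replacement from $\{1,\dots,n\}$, independently of the tree and the weights. For $\xi>0$ call $(d_i,\ell_i)_{i\le k}$, with $d_i$ positive integers and $\ell_i\in\mathbb R$, $(n,\xi)$-admissible if for all $i\le k$ $$d_i\le c\log n,\qquad n^\eta\le \ell_i\le n\,e^{-(1-\xi)(1-\theta^{-1})(d_i+1)}.$$ For $r>0$ let $G_r(x):=\mathbb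 P(X<x)$ with $X\sim\Gamma(r,1)$, and set $\lambda_i(W):=\big(1+\tfrac{W}{\theta-1}\big)\log(n/\ell_i)$. (a) For every $\varepsilon>0$ there are $\xi>0$ and $N$ such that for all $n\ge N$ and all $(n,\xi)$-admissible $(d_i,\ell_i)_{i\le k}$, $$\Big|\mathbb P\big(\mathcal Z_n(v_i)=d_i,\ v_i>\ell_i,\ i\le k\big)-\Pi\Big|\le\varepsilon\,\Pi,\qquad \Pi:=\prod_{i=1}^k\mathbb E\Big[\frac{\theta-1}{\theta-1+W}\Big(\frac{W}{\theta-1+W}\Big)^{d_i}G_{d_i+1}(\lambda_i(W))\Big].$$ (b) For every $\varepsilon>0$ there are $\xi>0$, $N$ and $D$ such that for all $n\ge N$ and all $(n,\xi)$-admissible $(d_i,\ell_i)_{i\le k}$ with $d_i\ge D$ for all $i\le k$, $$\mathbb P\big(\mathcal Z_n(v_i)\ge d_i,\ v_i>\ell_i,\ i\le k\big)\le(1+\varepsilon)\prod_{i=1}^k\mathbb E\Big[\Big(\frac{W}{\theta-1+W}\Big)^{d_i}G_{d_i+1}(\lambda_i(W))\Big],$$ $$\mathbb P\big(\mathcal Z_n(v_i)\ge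 d_i,\ v_i>\ell_i,\ i\le k\big)\ge(1-\varepsilon)\prod_{i=1}^k\mathbb E\Big[\Big(\frac{W}{\theta-1+W}\Big)^{d_i}G_{d_i+\lfloor d_i^{1/4}\rfloor+1}(\lambda_i(W))\Big].$$ In particular, if $d_i=d_i(n)$ and $\ell_i=\ell_i(n)$ are, for every $\xi>0$, $(n,\xi)$-admissible for all large $n$, then the probability in (a) is $(1+o(1))\Pi$; and if moreover every $d_i(n)\to\infty$, then the two bounds in (b) hold with $1\pm\varepsilon$ replaced by $1+o(1)$. -/

import Mathlib

open MeasureTheory ProbabilityTheory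

noncomputable section

namespace WRT

variable {Ω : Type*} [mΩ : MeasurableSpace Ω]

/-- The information available when vertex `n + 1` chooses its parent: all the vertex-weights
`W 1, W 2, …` and the parents of the vertices `2, …, n`. -/
abbrev history (W : ℕ → Ω → ℝ) (parent : ℕ → Ω → ℕ) (n : ℕ) : MeasurableSpace Ω :=
  (⨆ i : ℕ, MeasurableSpace.comap (W (i + 1)) inferInstance) ⊔
    ⨆ j ∈ Finset.Icc 2 n, MeasurableSpace.comap (parent j) inferInstance

/-- Weighted recursive tree on the vertices `1, 2, …` with i.i.d. vertex-weights of law `ν`.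
`W i` is the weight of vertex `i`, for `i ≥ 1`, and `parent j` is the vertex to which vertex `j`
connects, for `j ≥ 2`. The values `W 0`, `parent 0` and `parent 1` play no role. -/
structure IsWRT (P : Measure Ω) (ν : Measure ℝ) (W : ℕ → Ω → ℝ) (parent : ℕ → Ω → ℕ) :
    Prop where
  measurable_weight : ∀ i, 1 ≤ i → Measurable (W i)
  law_weight : ∀ i, 1 ≤ i → P.map (W i) = ν
  indep_weight : iIndepFun (fun i : ℕ => W (i + 1)) P
  measurable_parent : ∀ j, 2 ≤ j → Measurable (parent j)
  /-- Given the past, vertex `n + 1` connects to `i ∈ [n]` with probability `W i / S n`. -/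
  parent_law : ∀ n, 1 ≤ n → ∀ i ∈ Finset.Icc 1 n,
    P⟦{ω | parent (n + 1) ω = i} | history W parent n⟧ =ᵐ[P]
      fun ω => W i ω / ∑ j ∈ Finset.Icc 1 n, W j ω

/-- In-degree of vertex `i` in the tree on the vertices `1, …, n`. -/
def inDegree (parent : ℕ → Ω → ℕ) (n i : ℕ) (ω : Ω) : ℕ :=
  ((Finset.Icc 2 n).filter fun j => parent j ω = i).card

/-- `v` is a `k`-tuple of vertices sampled uniformly without replacement from `[n]`,
independently of the weights and of the tree on the vertices `1, …, n`. -/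
structure IsUniformSample (P : Measure Ω) (W : ℕ → Ω → ℝ) (parent : ℕ → Ω → ℕ) {k : ℕ}
    (n : ℕ) (v : Ω → Fin k → ℕ) : Prop where
  measurable : Measurable v
  law : ∀ j : Fin k → ℕ, Function.Injective j → (∀ i, j i ∈ Finset.Icc 1 n) →
    P.real {ω | v ω = j} = 1 / (n.descFactorial k : ℝ)
  indep : Indep (MeasurableSpace.comap v inferInstance) (history W parent n) P

/-- `θ = 1 + 𝔼 W`. -/
def theta (ν : Measure ℝ) : ℝ := 1 + ∫ w, w ∂ν

/-- `ℙ(X < (1 + w / (θ - 1)) log (n / ℓ))` for `X` Gamma distributed with shape `r` and rate 1. -/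
def gammaProb (ν : Measure ℝ) (n : ℕ) (ℓ r w : ℝ) : ℝ :=
  (gammaMeasure r 1).real (Set.Iio ((1 + w / (theta ν - 1)) * Real.log (n / ℓ)))

/-- The factor for the event that the degree equals `d`. -/
def exactFactor (ν : Measure ℝ) (n d : ℕ) (ℓ : ℝ) : ℝ :=
  ∫ w, (theta ν - 1) / (theta ν - 1 + w) * (w / (theta ν - 1 + w)) ^ d
    * gammaProb ν n ℓ (d + 1) w ∂ν

/-- The factor for the event that the degree is at least `d`, with Gamma shape `r`. -/
def tailFactor (ν : Measure ℝ) (n d : ℕ) (ℓ r : ℝ) : ℝ :=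
  ∫ w, (w / (theta ν - 1 + w)) ^ d * gammaProb ν n ℓ r w ∂ν

/-- The condition relating `n`, a degree `d` and a label bound `ℓ`. -/
def Admissible (ν : Measure ℝ) (c η ξ : ℝ) (n d : ℕ) (ℓ : ℝ) : Prop :=
  1 ≤ d ∧ (d : ℝ) ≤ c * Real.log n ∧ (n : ℝ) ^ η ≤ ℓ ∧
    ℓ ≤ n * Real.exp (-(1 - ξ) * (1 - (theta ν)⁻¹) * (d + 1))

end WRT

end

/-! Write m = θ - 1. Given the weights, the parents are chosen independently, so the in-degrees of k
distinct vertices count the outcomes of independent steps with small probabilities (`degreeLaw`,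
`IsWRT.integral_mul_degreeEvent`). Such counts are a product of Poisson laws up to controlled
relative errors (`degreeLaw_le`, `le_degreeLaw`). By Hoeffding, the total weight of the first a
vertices is close to a * m for all a between n^η and n at once, outside an event whose probability
is of order n * exp(-2 n^(η/2)). On the good event the Poisson parameter of vertex j is (W_j / m)
log(n / j), up to an error τ inside the logarithmic position. Since the weights of distinct vertices
are independent, the expectation factorises over the k vertices.

It remains to average over labels. With s = log(n / j), a uniform label above ℓ becomes the measure
e^(-s) ds on [0, log(n / ℓ)], and the Poisson mass integrates to (w / m)^d / d! times an incomplete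
Gamma integral of rate 1 + w / m (`sum_label_le`, `le_sum_label`). Rescaling s to rate 1 produces
exactly the integrand of `exactFactor` (`exact_integrand_eq`).

All errors must be relative, since the factors may tend to 0 with n. The approximations cost exp(O(τ
(d + 1))) with τ = n^(-η/8), which tends to 1 for d = O(log n). The bad event is the only additive
error; it is negligible because each factor is at least exp(-O(log² n)) (`le_exactFactor`). The
label condition enters only through a positive lower bound on log(n / ℓ). Distinctness of the
sampled vertices costs little, as no single label carries a notable share of the mass
(`label_term_le`, `le_sum_injective`).

For the tails, the exact factors are summed over the degree. For fixed w they are geometric weights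
with ratio w / (m + w) ≤ θ⁻¹, times a Gamma probability that decreases with the shape. Taking the
Gamma probability at the first degree gives the upper bound (`sum_exactFactor_le`). Summing over f +
1 degrees with f = ⌊d^(1/4)⌋ and taking it at the last one gives the lower bound
(`le_sum_exactFactor`); the geometric mass missed is at most a fraction θ^(-(f + 1)). -/

noncomputable section

namespace WRT

/-! ### Poisson bounds for counts in independent steps. -/

section DegreeLaw

/-- First-order lower bound for a product of increments. -/
theorem prod_add_sum_le_prod {ι : Type*} [DecidableEq ι] (s : Finset ι) (a b : ι → ℝ)
    (ha : ∀ i, 0 ≤ a i) (hab : ∀ i, a i ≤ b i) :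
    ∏ i ∈ s, a i + ∑ i ∈ s, (b i - a i) * ∏ l ∈ s.erase i, a l ≤ ∏ i ∈ s, b i := by
  induction s using Finset.induction_on with
  | empty => simp
  | insert x s hx ih =>
    rw [Finset.prod_insert hx, Finset.prod_insert hx, Finset.sum_insert hx,
      Finset.erase_insert hx]
    have h1 : ∑ i ∈ s, (b i - a i) * ∏ l ∈ (insert x s).erase i, a l
        = a x * ∑ i ∈ s, (b i - a i) * ∏ l ∈ s.erase i, a l := by
      rw [Finset.mul_sum]
      refine Finset.sum_congr rfl fun i hi => ?_
      have hne : x ≠ i := fun h => hx (h ▸ hi)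
      rw [Finset.erase_insert_of_ne hne, Finset.prod_insert (fun h => hx (Finset.mem_of_mem_erase h))]
      ring
    rw [h1]
    have h2 : ∏ i ∈ s, a i ≤ ∏ i ∈ s, b i := Finset.prod_le_prod (fun i _ => ha i) fun i _ => hab i
    nlinarith [mul_le_mul_of_nonneg_left ih (ha x),
      mul_le_mul_of_nonneg_left h2 (sub_nonneg.2 (hab x))]

/-- First-order upper bound for a product of increments. -/
theorem prod_le_prod_add_sum {ι : Type*} [DecidableEq ι] (s : Finset ι) (a b : ι → ℝ)
    (ha : ∀ i, 0 ≤ a i) (hab : ∀ i, a i ≤ b i) :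
    ∏ i ∈ s, b i ≤ ∏ i ∈ s, a i + ∑ i ∈ s, (b i - a i) * ∏ l ∈ s.erase i, b l := by
  induction s using Finset.induction_on with
  | empty => simp
  | insert x s hx ih =>
    rw [Finset.prod_insert hx, Finset.prod_insert hx, Finset.sum_insert hx,
      Finset.erase_insert hx]
    have h1 : ∑ i ∈ s, (b i - a i) * ∏ l ∈ (insert x s).erase i, b l
        = b x * ∑ i ∈ s, (b i - a i) * ∏ l ∈ s.erase i, b l := by
      rw [Finset.mul_sum]
      refine Finset.sum_congr rfl fun i hi => ?_
      have hne : x ≠ i := fun h => hx (h ▸ hi)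
      rw [Finset.erase_insert_of_ne hne, Finset.prod_insert (fun h => hx (Finset.mem_of_mem_erase h))]
      ring
    rw [h1]
    have h2 : 0 ≤ ∑ i ∈ s, (b i - a i) * ∏ l ∈ s.erase i, b l :=
      Finset.sum_nonneg fun i _ => mul_nonneg (sub_nonneg.2 (hab i))
        (Finset.prod_nonneg fun l _ => (ha l).trans (hab l))
    nlinarith [mul_le_mul_of_nonneg_left ih (ha x),
      mul_le_mul_of_nonneg_left h2 (sub_nonneg.2 (hab x))]

/-- The monomial `x ^ d / d!`. -/
def powFact (d : ℕ) (x : ℝ) : ℝ := x ^ d / d.factorial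

theorem powFact_nonneg (d : ℕ) {x : ℝ} (hx : 0 ≤ x) : 0 ≤ powFact d x := by
  unfold powFact; positivity

theorem powFact_mono (d : ℕ) {x y : ℝ} (hx : 0 ≤ x) (hxy : x ≤ y) : powFact d x ≤ powFact d y := by
  unfold powFact; gcongr

theorem powFact_le_exp (d : ℕ) {x : ℝ} (hx : 0 ≤ x) : powFact d x ≤ Real.exp x :=
  Real.pow_div_factorial_le_exp x hx d

/-- Convexity: the derivative of `powFact d` is `powFact (d - 1)`, taken at the left end point. This
is the increment of a Poisson mass when its parameter grows by q. -/
theorem mul_powFact_le_sub (d : ℕ) (hd : d ≠ 0) {x q : ℝ} (hx : 0 ≤ x) (hq : 0 ≤ q) :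
    q * powFact (d - 1) x ≤ powFact d (x + q) - powFact d x := by
  obtain ⟨d, rfl⟩ := Nat.exists_eq_succ_of_ne_zero hd
  have h : ∀ d : ℕ, x ^ (d + 1) + (d + 1) * q * x ^ d ≤ (x + q) ^ (d + 1) := by
    intro d
    induction d with
    | zero => simp
    | succ d ih =>
      have := mul_le_mul_of_nonneg_left ih (add_nonneg hx hq)
      have h3 : 0 ≤ (d + 1) * q ^ 2 * x ^ d := by positivity
      have h4 : x ^ (d + 1 + 1) + ((d + 1 : ℕ) + 1) * q * x ^ (d + 1)
          = (x + q) * (x ^ (d + 1) + (d + 1) * q * x ^ d) - (d + 1) * q ^ 2 * x ^ d := by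
        push_cast; ring
      rw [h4, pow_succ' (x + q) (d + 1)]
      linarith
  have hf : (0 : ℝ) < d.factorial := by positivity
  simp only [powFact, Nat.succ_eq_add_one, Nat.add_sub_cancel, Nat.factorial_succ, Nat.cast_mul]
  rw [← sub_div, mul_div_assoc', div_le_div_iff₀ hf (by positivity)]
  push_cast
  nlinarith [h d]

/-- The mean value bound at the right end point. It survives truncation at 0 because the positive
part is monotone and 1-Lipschitz. -/
theorem powFact_posPart_sub_le (d : ℕ) (hd : d ≠ 0) (x : ℝ) {q : ℝ} (hq : 0 ≤ q) :
    powFact d (max (x + q) 0) - powFact d (max x 0) ≤ q * powFact (d - 1) (max (x + q) 0) := by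
  obtain ⟨d, rfl⟩ := Nat.exists_eq_succ_of_ne_zero hd
  set y := max x 0 with hy
  set z := max (x + q) 0 with hz
  have hy0 : 0 ≤ y := le_max_right _ _
  have hyz : y ≤ z := max_le_max_right _ (by linarith)
  have hzq : z ≤ y + q := max_le (by linarith [le_max_left x 0]) (by linarith)
  have h : ∀ d : ℕ, z ^ (d + 1) ≤ y ^ (d + 1) + (d + 1) * q * z ^ d := by
    intro d
    induction d with
    | zero => simpa using hzq
    | succ d ih =>
      have h1 := mul_le_mul_of_nonneg_right ih (hy0.trans hyz)
      have h2 : y ^ (d + 1) * z ≤ y ^ (d + 1) * (y + q) := by gcongr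
      have h3 : q * y ^ (d + 1) ≤ q * z ^ (d + 1) := by gcongr
      have h4 : y ^ (d + 1 + 1) + ((d + 1 : ℕ) + 1) * q * z ^ (d + 1)
          = y ^ (d + 1) * (y + q) + (d + 1) * q * z ^ d * z
            + (q * z ^ (d + 1) - q * y ^ (d + 1)) := by
        push_cast; ring
      rw [h4, pow_succ z (d + 1)]
      linarith
  have hf : (0 : ℝ) < d.factorial := by positivity
  simp only [powFact, Nat.succ_eq_add_one, Nat.add_sub_cancel, Nat.factorial_succ, Nat.cast_mul]
  rw [← sub_div, mul_div_assoc', div_le_div_iff₀ (by positivity) hf]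
  push_cast
  nlinarith [h d]

variable {k : ℕ}

/-- The law of the vector counting how often each of `k` outcomes occurs in independent steps, when
outcome `i` has probability `q a i` in step `a`. -/
def degreeLaw (q : ℕ → Fin k → ℝ) : ℕ → (Fin k → ℕ) → ℝ
  | 0, d => if d = 0 then 1 else 0
  | a + 1, d => (1 - ∑ i, q a i) * degreeLaw q a d +
      ∑ i, if d i = 0 then 0 else q a i * degreeLaw q a (Function.update d i (d i - 1))

theorem sum_update_pred (d : Fin k → ℕ) (i : Fin k) (hi : d i ≠ 0) :
    (∑ l, (Function.update d i (d i - 1) l : ℝ)) = ∑ l, (d l : ℝ) - 1 := by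
  rw [← Finset.add_sum_erase _ _ (Finset.mem_univ i),
    ← Finset.add_sum_erase (a := i) _ (fun l => (d l : ℝ)) (Finset.mem_univ i),
    Function.update_self, Finset.sum_congr rfl (g := fun l => (d l : ℝ))]
  · rw [Nat.cast_sub (Nat.one_le_iff_ne_zero.2 hi)]; push_cast; ring
  · intro l hl
    rw [Function.update_of_ne (Finset.ne_of_mem_erase hl)]

theorem prod_update_pred (d : Fin k → ℕ) (i : Fin k) (x : Fin k → ℝ) :
    ∏ l, powFact (Function.update d i (d i - 1) l) (x l)
      = powFact (d i - 1) (x i) * ∏ l ∈ Finset.univ.erase i, powFact (d l) (x l) := by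
  rw [← Finset.mul_prod_erase _ _ (Finset.mem_univ i), Function.update_self]
  congr 1
  refine Finset.prod_congr rfl fun l hl => ?_
  rw [Function.update_of_ne (Finset.ne_of_mem_erase hl)]

theorem degreeLaw_nonneg (q : ℕ → Fin k → ℝ) (hq : ∀ a i, 0 ≤ q a i) (hQ : ∀ a, ∑ i, q a i ≤ 1)
    (a : ℕ) (d : Fin k → ℕ) : 0 ≤ degreeLaw q a d := by
  induction a generalizing d with
  | zero => unfold degreeLaw; split_ifs <;> simp
  | succ a ih =>
    unfold degreeLaw
    refine add_nonneg (mul_nonneg (by linarith [hQ a]) (ih d)) (Finset.sum_nonneg fun i _ => ?_)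
    split_ifs
    · exact le_rfl
    · exact mul_nonneg (hq a i) (ih _)

/-- Poisson upper bound for `degreeLaw`. -/
theorem degreeLaw_le (q : ℕ → Fin k → ℝ) (Q : ℝ) (hq : ∀ a i, 0 ≤ q a i)
    (hQ : ∀ a, ∑ i, q a i ≤ Q) (hQ1 : Q ≤ 1) (a : ℕ) (d : Fin k → ℕ) :
    degreeLaw q a d ≤ Real.exp (Q * ∑ i, (d i : ℝ)) *
      ∏ i, (Real.exp (-∑ b ∈ Finset.range a, q b i) *
        powFact (d i) (∑ b ∈ Finset.range a, q b i)) := by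
  induction a generalizing d with
  | zero =>
    unfold degreeLaw
    split_ifs with h
    · simp [h, powFact]
    · simp only [Finset.range_zero, Finset.sum_empty, neg_zero, Real.exp_zero, one_mul]
      exact mul_nonneg (Real.exp_pos _).le (Finset.prod_nonneg fun i _ => powFact_nonneg _ le_rfl)
  | succ a ih =>
    set p : Fin k → ℝ := fun i => ∑ b ∈ Finset.range a, q b i with hp
    have hp0 : ∀ i, 0 ≤ p i := fun i => Finset.sum_nonneg fun b _ => hq b i
    have hps : ∀ i, ∑ b ∈ Finset.range (a + 1), q b i = p i + q a i := fun i =>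
      Finset.sum_range_succ _ _
    simp only [hps, Finset.prod_mul_distrib, ← Real.exp_sum] at ih ⊢
    set E := Real.exp (Q * ∑ i, (d i : ℝ)) with hE
    set R := Real.exp (∑ i, -p i) with hR
    set A := ∑ i, q a i with hA
    have hA0 : 0 ≤ A := Finset.sum_nonneg fun i _ => hq a i
    have hexp : Real.exp (∑ i, -(p i + q a i)) = R * Real.exp (-A) := by
      rw [hR, ← Real.exp_add, hA]; congr 1
      rw [← Finset.sum_neg_distrib, ← Finset.sum_add_distrib]
      exact Finset.sum_congr rfl fun i _ => by ring
    rw [hexp]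
    have key := prod_add_sum_le_prod Finset.univ (fun i => powFact (d i) (p i))
      (fun i => powFact (d i) (p i + q a i)) (fun i => powFact_nonneg _ (hp0 i))
      (fun i => powFact_mono _ (hp0 i) (by linarith [hq a i]))
    have h1 : (1 - A) * degreeLaw q a d
        ≤ E * (R * Real.exp (-A) * ∏ i, powFact (d i) (p i)) := by
      have h11 : 1 - A ≤ Real.exp (-A) := by linarith [Real.add_one_le_exp (-A)]
      calc (1 - A) * degreeLaw q a d
          ≤ (1 - A) * (E * (R * ∏ i, powFact (d i) (p i))) :=
            mul_le_mul_of_nonneg_left (ih d) (by linarith [hQ a])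
        _ ≤ Real.exp (-A) * (E * (R * ∏ i, powFact (d i) (p i))) := by
            refine mul_le_mul_of_nonneg_right h11 ?_
            have := Finset.prod_nonneg fun i (_ : i ∈ Finset.univ) => powFact_nonneg (d i) (hp0 i)
            positivity
        _ = _ := by ring
    have h2 : ∀ i, (if d i = 0 then 0 else
          q a i * degreeLaw q a (Function.update d i (d i - 1)))
        ≤ E * (R * Real.exp (-A) * ((powFact (d i) (p i + q a i) - powFact (d i) (p i)) *
          ∏ l ∈ Finset.univ.erase i, powFact (d l) (p l))) := by
      intro i
      have hprod : 0 ≤ ∏ l ∈ Finset.univ.erase i, powFact (d l) (p l) :=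
        Finset.prod_nonneg fun l _ => powFact_nonneg (d l) (hp0 l)
      split_ifs with hi
      · simp [hi, powFact]
      · have h := ih (Function.update d i (d i - 1))
        rw [prod_update_pred, sum_update_pred d i hi] at h
        -- The target carries exp(-A) even when an outcome occurs, where the recursion has no such
        -- factor. The loss e^A ≤ e^Q is paid for by the drop of the total count by one.
        have hEE : Real.exp (Q * (∑ l, (d l : ℝ) - 1)) ≤ E * Real.exp (-A) := by
          rw [hE, ← Real.exp_add]
          exact Real.exp_le_exp.2 (by nlinarith [hQ a])
        calc q a i * degreeLaw q a (Function.update d i (d i - 1))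
            ≤ q a i * (E * Real.exp (-A) * (R * (powFact (d i - 1) (p i) *
                ∏ l ∈ Finset.univ.erase i, powFact (d l) (p l)))) := by
              refine mul_le_mul_of_nonneg_left (h.trans ?_) (hq a i)
              refine mul_le_mul_of_nonneg_right hEE ?_
              have := powFact_nonneg (d i - 1) (hp0 i)
              positivity
          _ = E * (R * Real.exp (-A) * (q a i * powFact (d i - 1) (p i) *
                ∏ l ∈ Finset.univ.erase i, powFact (d l) (p l))) := by ring
          _ ≤ _ := by
              gcongr
              exact mul_powFact_le_sub _ hi (hp0 i) (hq a i)
    unfold degreeLaw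
    refine (add_le_add h1 (Finset.sum_le_sum fun i _ => h2 i)).trans ?_
    rw [← Finset.mul_sum, ← Finset.mul_sum, ← mul_add, ← mul_add]
    gcongr

/-- Poisson lower bound for `degreeLaw`. -/
theorem le_degreeLaw (q : ℕ → Fin k → ℝ) (qm : Fin k → ℝ) (hq : ∀ a i, 0 ≤ q a i)
    (hqm : ∀ a i, q a i ≤ qm i) (hQ1 : ∑ i, qm i ≤ 1 / 2) (a : ℕ) (d : Fin k → ℕ) :
    ∏ i, (Real.exp (-((1 + ∑ i, qm i) * ∑ b ∈ Finset.range a, q b i)) *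
        powFact (d i) (max (∑ b ∈ Finset.range a, q b i - (∑ l, (d l : ℝ)) * qm i) 0))
      ≤ degreeLaw q a d := by
  have hqm0 : ∀ i, 0 ≤ qm i := fun i => (hq 0 i).trans (hqm 0 i)
  set Q := ∑ i, qm i with hQ
  have hQ0 : 0 ≤ Q := Finset.sum_nonneg fun i _ => hqm0 i
  induction a generalizing d with
  | zero =>
    unfold degreeLaw
    split_ifs with h
    · simp [h, powFact]
    -- Before any step the shifted parameter is nonpositive, so a nonzero count makes the truncated
    -- power vanish.
    · obtain ⟨i, hi⟩ := Function.ne_iff.1 h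
      refine (Finset.prod_eq_zero (Finset.mem_univ i) ?_).le
      have : ∑ b ∈ Finset.range 0, q b i - (∑ l, (d l : ℝ)) * qm i ≤ 0 := by
        simp only [Finset.range_zero, Finset.sum_empty, zero_sub, Left.neg_nonpos_iff]
        exact mul_nonneg (Finset.sum_nonneg fun l _ => Nat.cast_nonneg _) (hqm0 i)
      rw [max_eq_right this]
      simp only [powFact, mul_eq_zero, div_eq_zero_iff]
      right; left
      exact zero_pow hi
  | succ a ih =>
    set p : Fin k → ℝ := fun i => ∑ b ∈ Finset.range a, q b i with hp
    have hps : ∀ i, ∑ b ∈ Finset.range (a + 1), q b i = p i + q a i := fun i =>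
      Finset.sum_range_succ _ _
    simp only [hps, Finset.prod_mul_distrib, ← Real.exp_sum] at ih ⊢
    set R := Real.exp (∑ i, -((1 + Q) * p i)) with hR
    set A := ∑ i, q a i with hA
    set D := ∑ l, (d l : ℝ) with hD
    have hA0 : 0 ≤ A := Finset.sum_nonneg fun i _ => hq a i
    have hAQ : A ≤ Q := Finset.sum_le_sum fun i _ => hqm a i
    have hexp : Real.exp (∑ i, -((1 + Q) * (p i + q a i))) = R * Real.exp (-((1 + Q) * A)) := by
      rw [hR, ← Real.exp_add, hA]; congr 1
      rw [Finset.mul_sum, ← Finset.sum_neg_distrib, ← Finset.sum_add_distrib]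
      exact Finset.sum_congr rfl fun i _ => by ring
    rw [hexp]
    -- The parameter is lowered by one maximal step for each occurrence still to come; this slack
    -- absorbs the right end points below.
    set x : Fin k → ℝ := fun i => p i - D * qm i with hx
    have hxq : ∀ i, p i + q a i - D * qm i = x i + q a i := fun i => by simp only [hx]; ring
    simp only [hxq]
    have key := prod_le_prod_add_sum Finset.univ (fun i => powFact (d i) (max (x i) 0))
      (fun i => powFact (d i) (max (x i + q a i) 0)) (fun i => powFact_nonneg _ (le_max_right _ _))
      (fun i => powFact_mono _ (le_max_right _ _)
        (max_le_max_right _ (by linarith [hq a i])))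
    -- Since A ≤ Q, it suffices that exp(-A - A²) ≤ 1 - A, which holds for A ≤ 1/2. This is why the
    -- exponent carries the factor 1 + Q.
    have hE1 : Real.exp (-((1 + Q) * A)) ≤ 1 - A := by
      have h1 : Real.exp (-((1 + Q) * A)) ≤ Real.exp (-A - A ^ 2) :=
        Real.exp_le_exp.2 (by nlinarith)
      refine h1.trans ?_
      have hA1 : A ≤ 1 / 2 := hAQ.trans hQ1
      have h3 : 1 ≤ (1 - A) * Real.exp (A + A ^ 2) := by
        have h4 := Real.quadratic_le_exp_of_nonneg (x := A + A ^ 2) (by positivity)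
        have h5 : 1 ≤ (1 - A) * (1 + (A + A ^ 2) + (A + A ^ 2) ^ 2 / 2) := by
          have : (1 - A) * (1 + (A + A ^ 2) + (A + A ^ 2) ^ 2 / 2) - 1
            = A ^ 2 / 2 * (1 - A - A ^ 2 - A ^ 3) := by ring
          have h6 : 0 ≤ 1 - A - A ^ 2 - A ^ 3 := by nlinarith [sq_nonneg A, mul_nonneg hA0 (sq_nonneg A)]
          nlinarith [mul_nonneg (sq_nonneg A) h6]
        exact h5.trans (mul_le_mul_of_nonneg_left h4 (by linarith))
      have h7 : -A - A ^ 2 = -(A + A ^ 2) := by ring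
      rw [h7, Real.exp_neg, inv_le_iff_one_le_mul₀ (Real.exp_pos _)]
      exact h3
    have hE2 : Real.exp (-((1 + Q) * A)) ≤ 1 := by linarith
    have hR0 : 0 < R := Real.exp_pos _
    have hpr : 0 ≤ ∏ i, powFact (d i) (max (x i) 0) :=
      Finset.prod_nonneg fun i _ => powFact_nonneg _ (le_max_right _ _)
    have h1 : R * Real.exp (-((1 + Q) * A)) * ∏ i, powFact (d i) (max (x i) 0)
        ≤ (1 - A) * degreeLaw q a d := by
      calc R * Real.exp (-((1 + Q) * A)) * ∏ i, powFact (d i) (max (x i) 0)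
          = Real.exp (-((1 + Q) * A)) * (R * ∏ i, powFact (d i) (max (x i) 0)) := by ring
        _ ≤ (1 - A) * (R * ∏ i, powFact (d i) (max (x i) 0)) :=
            mul_le_mul_of_nonneg_right hE1 (by positivity)
        _ ≤ _ := mul_le_mul_of_nonneg_left (ih d) (by linarith)
    have h2 : ∀ i, R * Real.exp (-((1 + Q) * A)) *
          ((powFact (d i) (max (x i + q a i) 0) - powFact (d i) (max (x i) 0)) *
          ∏ l ∈ Finset.univ.erase i, powFact (d l) (max (x l + q a l) 0))
        ≤ (if d i = 0 then 0 else q a i * degreeLaw q a (Function.update d i (d i - 1))) := by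
      intro i
      have hprod : 0 ≤ ∏ l ∈ Finset.univ.erase i, powFact (d l) (max (x l + q a l) 0) :=
        Finset.prod_nonneg fun l _ => powFact_nonneg (d l) (le_max_right _ _)
      split_ifs with hi
      · simp [hi, powFact]
      · have h := ih (Function.update d i (d i - 1))
        rw [prod_update_pred, sum_update_pred d i hi] at h
        -- Removing one occurrence lessens the shift by `qm l ≥ q a l`, so the induction hypothesis
        -- already covers the right end points.
        have hle : ∀ l, max (x l + q a l) 0 ≤ max (p l - (D - 1) * qm l) 0 := fun l =>
          max_le_max_right _ (by simp only [hx]; nlinarith [hqm a l])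
        have hp1 : 0 ≤ powFact (d i - 1) (max (x i + q a i) 0) :=
          powFact_nonneg _ (le_max_right _ _)
        calc R * Real.exp (-((1 + Q) * A)) *
          ((powFact (d i) (max (x i + q a i) 0) - powFact (d i) (max (x i) 0)) *
          ∏ l ∈ Finset.univ.erase i, powFact (d l) (max (x l + q a l) 0))
            ≤ R * Real.exp (-((1 + Q) * A)) *
          ((q a i * powFact (d i - 1) (max (x i + q a i) 0)) *
          ∏ l ∈ Finset.univ.erase i, powFact (d l) (max (x l + q a l) 0)) := by
              gcongr
              exact powFact_posPart_sub_le _ hi _ (hq a i)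
          _ ≤ R * 1 *
          ((q a i * powFact (d i - 1) (max (x i + q a i) 0)) *
          ∏ l ∈ Finset.univ.erase i, powFact (d l) (max (x l + q a l) 0)) := by
              have := hq a i
              gcongr
          _ = q a i * (R * (powFact (d i - 1) (max (x i + q a i) 0) *
          ∏ l ∈ Finset.univ.erase i, powFact (d l) (max (x l + q a l) 0))) := by ring
          _ ≤ q a i * (R * (powFact (d i - 1) (max (p i - (D - 1) * qm i) 0) *
          ∏ l ∈ Finset.univ.erase i, powFact (d l) (max (p l - (D - 1) * qm l) 0))) := by
              refine mul_le_mul_of_nonneg_left (mul_le_mul_of_nonneg_left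
                (mul_le_mul (powFact_mono _ (le_max_right _ _) (hle i)) ?_ hprod
                  (powFact_nonneg _ (le_max_right _ _))) hR0.le) (hq a i)
              exact Finset.prod_le_prod (fun l _ => powFact_nonneg (d l) (le_max_right _ _))
                fun l _ => powFact_mono _ (le_max_right _ _) (hle l)
          _ ≤ _ := mul_le_mul_of_nonneg_left h (hq a i)
    unfold degreeLaw
    refine le_trans ?_ (add_le_add h1 (Finset.sum_le_sum fun i _ => h2 i))
    rw [← Finset.mul_sum, ← mul_add]
    exact mul_le_mul_of_nonneg_left key (by positivity)

end DegreeLaw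

/-! ### Incomplete Gamma integrals and Gamma probabilities. -/

section IncompleteGamma

/-- The lower incomplete Gamma integral with integer exponent `d` and rate `u`. -/
def incGamma (u : ℝ) (d : ℕ) (L : ℝ) : ℝ := ∫ s in (0 : ℝ)..L, Real.exp (-(u * s)) * s ^ d

theorem incGamma_integrable (u : ℝ) (d : ℕ) (a b : ℝ) :
    IntervalIntegrable (fun s => Real.exp (-(u * s)) * s ^ d) volume a b :=
  (by fun_prop : Continuous fun s : ℝ => Real.exp (-(u * s)) * s ^ d).intervalIntegrable _ _

theorem incGamma_nonneg (u : ℝ) (d : ℕ) {L : ℝ} (hL : 0 ≤ L) : 0 ≤ incGamma u d L :=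
  intervalIntegral.integral_nonneg hL fun _ hs => mul_nonneg (Real.exp_pos _).le (pow_nonneg hs.1 d)

theorem incGamma_mono (u : ℝ) (d : ℕ) {L L' : ℝ} (hL : 0 ≤ L) (hLL' : L ≤ L') :
    incGamma u d L ≤ incGamma u d L' := by
  have h := intervalIntegral.integral_add_adjacent_intervals (incGamma_integrable u d 0 L)
    (incGamma_integrable u d L L')
  have h2 : 0 ≤ ∫ s in L..L', Real.exp (-(u * s)) * s ^ d :=
    intervalIntegral.integral_nonneg hLL' fun s hs =>
      mul_nonneg (Real.exp_pos _).le (pow_nonneg (hL.trans hs.1) d)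
  unfold incGamma
  linarith

theorem incGamma_scale_eq (u : ℝ) (d : ℕ) (L : ℝ) {r : ℝ} :
    incGamma u d (r * L) = r ^ (d + 1) * incGamma (u * r) d L := by
  unfold incGamma
  have h := intervalIntegral.mul_integral_comp_mul_left (a := 0) (b := L)
    (f := fun s => Real.exp (-(u * s)) * s ^ d) r
  rw [mul_zero] at h
  have h2 : ∀ s : ℝ, Real.exp (-(u * (r * s))) * (r * s) ^ d
      = r ^ d * (Real.exp (-(u * r * s)) * s ^ d) := fun s => by
    rw [mul_pow, show u * (r * s) = u * r * s by ring]; ring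
  simp only [h2, intervalIntegral.integral_const_mul] at h
  rw [← h, pow_succ']
  ring

/-- Stretching the variable by L' / L ≥ 1 only decreases the exponential. A small change of the
upper limit thus costs a relative error, however small the integral is. -/
theorem incGamma_le_scale {u : ℝ} (hu : 0 ≤ u) (d : ℕ) {L L' : ℝ} (hL : 0 < L) (hLL' : L ≤ L') :
    incGamma u d L' ≤ (L' / L) ^ (d + 1) * incGamma u d L := by
  have hr : 1 ≤ L' / L := (one_le_div hL).2 hLL'
  have h := incGamma_scale_eq u d L (r := L' / L)
  rw [div_mul_cancel₀ _ hL.ne'] at h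
  rw [h]
  refine mul_le_mul_of_nonneg_left ?_ (by positivity)
  refine intervalIntegral.integral_mono_on hL.le (incGamma_integrable _ _ _ _)
    (incGamma_integrable _ _ _ _) fun s hs => ?_
  refine mul_le_mul_of_nonneg_right (Real.exp_le_exp.2 ?_) (pow_nonneg hs.1 d)
  nlinarith [mul_nonneg (mul_nonneg hu hs.1) (sub_nonneg.2 hr)]

/-- Restrict to [0, s] and freeze the exponential at its smallest value. -/
theorem le_incGamma {u : ℝ} (hu : 0 ≤ u) (d : ℕ) {s L : ℝ} (hs : 0 ≤ s) (hsL : s ≤ L) :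
    Real.exp (-(u * s)) * (s ^ (d + 1) / (d + 1)) ≤ incGamma u d L := by
  refine le_trans ?_ (incGamma_mono u d hs hsL)
  have : Real.exp (-(u * s)) * (s ^ (d + 1) / (d + 1))
      = ∫ x in (0 : ℝ)..s, Real.exp (-(u * s)) * x ^ d := by
    rw [intervalIntegral.integral_const_mul, integral_pow]; simp
  rw [this]
  refine intervalIntegral.integral_mono_on hs (by apply Continuous.intervalIntegrable; fun_prop)
    (incGamma_integrable _ _ _ _) fun x hx => ?_
  refine mul_le_mul_of_nonneg_right (Real.exp_le_exp.2 ?_) (pow_nonneg hx.1 d)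
  nlinarith [mul_le_mul_of_nonneg_left hx.2 hu]

theorem gammaMeasure_real_Iio (d : ℕ) {x : ℝ} (hx : 0 ≤ x) :
    (gammaMeasure (d + 1) 1).real (Set.Iio x) = incGamma 1 d x / d.factorial := by
  have hd : (0 : ℝ) < d + 1 := by positivity
  have h0 : (gammaMeasure (d + 1) 1).real (Set.Iio x)
      = ∫ t in Set.Iio x, gammaPDFReal (d + 1) 1 t := by
    rw [gammaMeasure, measureReal_def, withDensity_apply _ measurableSet_Iio]
    rw [integral_eq_lintegral_of_nonneg_ae]
    · rfl
    · exact ae_of_all _ fun b => gammaPDFReal_nonneg hd one_pos b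
    · exact (measurable_gammaPDFReal _ _).aestronglyMeasurable
  -- The density vanishes on the negative half-line, and the end points are null sets.
  have h1 : ∫ t in Set.Iio x, gammaPDFReal (d + 1) 1 t
      = ∫ t in Set.Ioc 0 x, gammaPDFReal (d + 1) 1 t := by
    rw [← integral_Iic_eq_integral_Iio]
    refine setIntegral_eq_of_subset_of_ae_sdiff_eq_zero (μ := volume)
      (f := gammaPDFReal (d + 1) 1) (s := Set.Ioc 0 x) (t := Set.Iic x)
      measurableSet_Iic.nullMeasurableSet Set.Ioc_subset_Iic_self ?_
    have hne : ∀ᵐ t : ℝ ∂volume, t ≠ 0 := by simp [ae_iff]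
    filter_upwards [hne] with t ht0 ht
    have : ¬ 0 ≤ t := fun h => ht.2 ⟨lt_of_le_of_ne h (Ne.symm ht0), ht.1⟩
    simp [gammaPDFReal, this]
  rw [h0, h1, incGamma, intervalIntegral.integral_of_le hx, ← integral_div]
  refine setIntegral_congr_fun measurableSet_Ioc fun t ht => ?_
  have ht0 : 0 ≤ t := ht.1.le
  simp only [gammaPDFReal, if_pos ht0, Real.one_rpow, Real.Gamma_nat_eq_factorial,
    add_sub_cancel_right, Real.rpow_natCast]
  ring

/-- Integrate the derivative of e^(-s) s^(d+1) over [0, x]; the boundary term is nonnegative. -/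
theorem gammaMeasure_real_Iio_succ_le (d : ℕ) {x : ℝ} (hx : 0 ≤ x) :
    (gammaMeasure ((d + 1 : ℕ) + 1) 1).real (Set.Iio x)
      ≤ (gammaMeasure (d + 1) 1).real (Set.Iio x) := by
  rw [gammaMeasure_real_Iio _ hx, gammaMeasure_real_Iio _ hx]
  have h : ∫ s in (0 : ℝ)..x, (Real.exp (-(1 * s)) * ((d + 1) * s ^ d)
      - Real.exp (-(1 * s)) * s ^ (d + 1)) = Real.exp (-x) * x ^ (d + 1) - 0 := by
    have h2 : Real.exp (-x) * x ^ (d + 1) - 0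
      = Real.exp (-x) * x ^ (d + 1) - Real.exp (-0) * 0 ^ (d + 1) := by simp
    rw [h2]
    refine intervalIntegral.integral_eq_sub_of_hasDerivAt
      (f := fun s => Real.exp (-s) * s ^ (d + 1)) (fun s _ => ?_) ?_
    · have h3 : HasDerivAt (fun s => Real.exp (-s) * s ^ (d + 1)) _ s :=
        ((hasDerivAt_id s).fun_neg.exp).fun_mul (hasDerivAt_pow (d + 1) s)
      refine h3.congr_deriv ?_
      simp only [id_eq, one_mul, Nat.add_sub_cancel]; push_cast; ring
    · apply Continuous.intervalIntegrable; fun_prop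
  rw [intervalIntegral.integral_sub (by apply Continuous.intervalIntegrable; fun_prop)
    (incGamma_integrable _ _ _ _)] at h
  have h4 : ∫ s in (0 : ℝ)..x, Real.exp (-(1 * s)) * ((d + 1) * s ^ d)
      = (d + 1) * incGamma 1 d x := by
    rw [incGamma, ← intervalIntegral.integral_const_mul]
    congr 1; ext s; ring
  rw [h4, sub_zero] at h
  have h5 : 0 ≤ Real.exp (-x) * x ^ (d + 1) := by positivity
  have h6 : incGamma 1 (d + 1) x ≤ (d + 1) * incGamma 1 d x := by
    unfold incGamma at h ⊢; linarith
  rw [Nat.factorial_succ, div_le_div_iff₀ (by positivity) (by positivity)]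
  push_cast
  have : (0 : ℝ) < d.factorial := by positivity
  nlinarith [mul_le_mul_of_nonneg_right h6 this.le]

theorem gammaMeasure_real_Iio_antitone {x : ℝ} (hx : 0 ≤ x) :
    Antitone fun d : ℕ => (gammaMeasure (d + 1) 1).real (Set.Iio x) :=
  antitone_nat_of_succ_le fun d => gammaMeasure_real_Iio_succ_le d hx

/-- The right side is the Poisson mass at d with parameter s * w / m, integrated against e^(-s) ds
up to log(n / ℓ). Passing from rate 1 + w / m to rate 1 turns it into the geometric weight times the
Gamma probability. -/
theorem exact_integrand_eq (ν : Measure ℝ) (hm : 0 < theta ν - 1) (n d : ℕ) {ℓ w : ℝ} (hw : 0 ≤ w)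
    (hL : 0 ≤ Real.log (n / ℓ)) :
    (theta ν - 1) / (theta ν - 1 + w) * (w / (theta ν - 1 + w)) ^ d * gammaProb ν n ℓ (d + 1) w
      = powFact d (w / (theta ν - 1)) *
        incGamma (1 + w / (theta ν - 1)) d (Real.log (n / ℓ)) := by
  set m := theta ν - 1 with hmdef
  have hmw : 0 < m + w := by linarith
  rw [gammaProb, gammaMeasure_real_Iio d (by rw [← hmdef]; positivity), incGamma_scale_eq, one_mul,
    ← hmdef, powFact]
  have h1 : 1 + w / m = (m + w) / m := by field_simp
  have h2 : m / (m + w) * (w / (m + w)) ^ d * ((m + w) / m) ^ (d + 1) = (w / m) ^ d := by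
    rw [pow_succ, div_pow, div_pow, div_pow]; field_simp
  rw [h1, ← h2]
  ring

end IncompleteGamma

/-! ### Sums over labels compared with integrals on the logarithmic scale. -/

section LabelSums

theorem sum_Ioc_le_of_le_sub {a b : ℕ} (hab : a ≤ b) (t Ψ : ℕ → ℝ)
    (h : ∀ j, a ≤ j → j < b → t (j + 1) ≤ Ψ j - Ψ (j + 1)) :
    ∑ j ∈ Finset.Ioc a b, t j ≤ Ψ a - Ψ b := by
  induction b, hab using Nat.le_induction with
  | base => simp
  | succ b hab ih =>
    rw [Finset.sum_Ioc_succ_top hab]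
    have := ih fun j h1 h2 => h j h1 (h2.trans (Nat.lt_succ_self b))
    linarith [h b hab (Nat.lt_succ_self b)]

/-- The position of the label `j` on the logarithmic scale. -/
def logLabel (n : ℕ) (j : ℕ) : ℝ := Real.log (n / j)

theorem logLabel_sub_succ {n j : ℕ} (hn : 0 < n) (hj : 0 < j) :
    logLabel n j - logLabel n (j + 1) = Real.log ((j + 1) / j) := by
  have hn' : (n : ℝ) ≠ 0 := by positivity
  have hj' : (j : ℝ) ≠ 0 := by positivity
  have hj1 : ((j : ℝ) + 1) ≠ 0 := by positivity
  unfold logLabel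
  push_cast
  rw [Real.log_div hn' hj', Real.log_div hn' hj1, Real.log_div hj1 hj']
  ring

theorem logLabel_sub_succ_le {n j : ℕ} (hn : 0 < n) (hj : 0 < j) :
    logLabel n j - logLabel n (j + 1) ≤ 1 / j := by
  rw [logLabel_sub_succ hn hj]
  have hj' : (0 : ℝ) < j := by positivity
  have := Real.log_le_sub_one_of_pos (x := ((j : ℝ) + 1) / j) (by positivity)
  have h2 : ((j : ℝ) + 1) / j - 1 = 1 / j := by field_simp; ring
  linarith

theorem le_logLabel_sub_succ {n j : ℕ} (hn : 0 < n) (hj : 0 < j) :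
    1 / ((j : ℝ) + 1) ≤ logLabel n j - logLabel n (j + 1) := by
  rw [logLabel_sub_succ hn hj]
  have hj' : (0 : ℝ) < j := by positivity
  have := Real.one_sub_inv_le_log_of_pos (x := ((j : ℝ) + 1) / j) (by positivity)
  have h2 : 1 - (((j : ℝ) + 1) / j)⁻¹ = 1 / (j + 1) := by field_simp; ring
  linarith

theorem logLabel_nonneg {n j : ℕ} (hj : 0 < j) (hjn : j ≤ n) : 0 ≤ logLabel n j := by
  have hj' : (0 : ℝ) < j := by positivity
  exact Real.log_nonneg ((one_le_div hj').2 (by exact_mod_cast hjn))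

theorem exp_neg_logLabel {n j : ℕ} (hn : 0 < n) (hj : 0 < j) :
    Real.exp (-logLabel n j) = j / n := by
  have hn' : (0 : ℝ) < n := by positivity
  have hj' : (0 : ℝ) < j := by positivity
  rw [logLabel, ← Real.log_inv, inv_div, Real.exp_log (by positivity)]

theorem logLabel_self {n : ℕ} (hn : 0 < n) : logLabel n n = 0 := by
  unfold logLabel
  rw [div_self (by positivity), Real.log_one]

variable {n : ℕ} {ℓ α A τ κ : ℝ}

/-- A single τ ≥ 2 / ℓ dominates all discretisation errors: rounding ℓ down, rounding it up, and one
step between consecutive labels above it. -/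
theorem logLabel_floor_le (hn : 0 < n) (hℓ : 2 ≤ ℓ) (hτ : 2 / ℓ ≤ τ) :
    logLabel n ⌊ℓ⌋₊ ≤ Real.log (n / ℓ) + τ := by
  have hf1 : 1 ≤ ⌊ℓ⌋₊ := Nat.one_le_floor_iff _ |>.2 (by linarith)
  have hf : (1 : ℝ) ≤ ⌊ℓ⌋₊ := by exact_mod_cast hf1
  have hlt := Nat.lt_floor_add_one ℓ
  have hn' : (0 : ℝ) < n := by positivity
  have hℓ0 : 0 < ℓ := by linarith
  unfold logLabel
  rw [Real.log_div hn'.ne' (by positivity), Real.log_div hn'.ne' hℓ0.ne']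
  have h1 := Real.log_le_sub_one_of_pos (x := ℓ / ⌊ℓ⌋₊) (by positivity)
  rw [Real.log_div hℓ0.ne' (by positivity)] at h1
  have h2 : ℓ / ⌊ℓ⌋₊ - 1 ≤ 2 / ℓ := by
    rw [div_sub_one (by positivity), div_le_div_iff₀ (by positivity) hℓ0]
    nlinarith
  linarith

theorem le_logLabel_floor_succ (hn : 0 < n) (hℓ : 2 ≤ ℓ) (hτ : 2 / ℓ ≤ τ) :
    Real.log (n / ℓ) - τ ≤ logLabel n (⌊ℓ⌋₊ + 1) := by
  have hle := Nat.floor_le (by linarith : 0 ≤ ℓ)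
  have hn' : (0 : ℝ) < n := by positivity
  have hℓ0 : 0 < ℓ := by linarith
  unfold logLabel
  push_cast
  rw [Real.log_div hn'.ne' hℓ0.ne', Real.log_div hn'.ne' (by positivity)]
  have h1 := Real.log_le_sub_one_of_pos (x := ((⌊ℓ⌋₊ : ℝ) + 1) / ℓ) (by positivity)
  rw [Real.log_div (by positivity) hℓ0.ne'] at h1
  have h2 : ((⌊ℓ⌋₊ : ℝ) + 1) / ℓ - 1 ≤ 2 / ℓ := by
    rw [div_sub_one (by positivity)]
    gcongr
    linarith
  linarith

theorem step_le_tau {j : ℕ} (hn : 0 < n) (hℓ : 2 ≤ ℓ) (hτ : 2 / ℓ ≤ τ) (hj : ⌊ℓ⌋₊ ≤ j) :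
    logLabel n j - logLabel n (j + 1) ≤ τ := by
  have hf1 : 1 ≤ ⌊ℓ⌋₊ := Nat.one_le_floor_iff _ |>.2 (by linarith)
  have hj0 : 0 < j := by omega
  refine (logLabel_sub_succ_le hn hj0).trans (le_trans ?_ hτ)
  have hlt := Nat.lt_floor_add_one ℓ
  have : (⌊ℓ⌋₊ : ℝ) ≤ j := by exact_mod_cast hj
  rw [div_le_div_iff₀ (by positivity) (by linarith)]
  have : (1 : ℝ) ≤ ⌊ℓ⌋₊ := by exact_mod_cast hf1
  linarith

/-- With s the position of label j, 1 / n equals e^(-s) / j, and 1 / j is at most the gap to the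
previous position, so the sum is a Riemann sum for the incomplete Gamma integral. The rate of the
error depends on α only through A, which later makes it uniform in the weight. -/
theorem sum_label_le (d : ℕ) (hn : 0 < n) (hℓ : 2 ≤ ℓ) (hτ : 2 / ℓ ≤ τ) (hα : 0 ≤ α) (hαA : α ≤ A)
    (hκ : 0 < κ) (hL : κ ≤ Real.log (n / ℓ)) :
    ∑ j ∈ Finset.Ioc ⌊ℓ⌋₊ n, 1 / (n : ℝ) *
        (Real.exp (-(α * (logLabel n j - τ))) * (logLabel n j + τ) ^ d)
      ≤ Real.exp ((2 + 3 * A + 4 / κ) * τ * (d + 1)) * incGamma (1 + α) d (Real.log (n / ℓ)) := by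
  have hn' : (0 : ℝ) < n := by positivity
  have hℓ0 : 0 < ℓ := by linarith
  have hτ0 : 0 < τ := lt_of_lt_of_le (by positivity) hτ
  set L := Real.log (n / ℓ) with hLdef
  have hf1 : 1 ≤ ⌊ℓ⌋₊ := Nat.one_le_floor_iff _ |>.2 (by linarith)
  have hℓn : ℓ ≤ n := by
    by_contra h
    push Not at h
    have : Real.log (n / ℓ) ≤ 0 := Real.log_nonpos (by positivity) ((div_le_one hℓ0).2 h.le)
    linarith
  have hfn : ⌊ℓ⌋₊ ≤ n := by
    have := Nat.floor_le_floor hℓn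
    simpa using this
  set h : ℝ → ℝ := fun s => Real.exp ((1 + 2 * α) * τ) * (Real.exp (-((1 + α) * s)) * (s + τ) ^ d)
    with hh
  have hcont : Continuous h := by simp only [hh]; fun_prop
  have hint : ∀ a b, IntervalIntegrable h volume a b := fun a b => hcont.intervalIntegrable _ _
  have hpos : ∀ s, 0 ≤ s → 0 ≤ h s := fun s hs => by
    have : 0 ≤ s + τ := by linarith
    simp only [hh]; positivity
  have hstep : ∀ j, ⌊ℓ⌋₊ ≤ j → j < n → 1 / (n : ℝ) *
        (Real.exp (-(α * (logLabel n (j + 1) - τ))) * (logLabel n (j + 1) + τ) ^ d)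
      ≤ (∫ s in (0 : ℝ)..logLabel n j, h s) - ∫ s in (0 : ℝ)..logLabel n (j + 1), h s := by
    intro j hj hjn
    have hj0 : 0 < j := by omega
    rw [intervalIntegral.integral_interval_sub_left (hint _ _) (hint _ _)]
    have hlow := le_logLabel_sub_succ hn hj0
    have hup := step_le_tau hn hℓ hτ hj
    have hs0 : 0 ≤ logLabel n (j + 1) := logLabel_nonneg (Nat.succ_pos j) hjn
    have hle : logLabel n (j + 1) ≤ logLabel n j := by
      have : 0 ≤ 1 / ((j : ℝ) + 1) := by positivity
      linarith
    set c := Real.exp (-logLabel n (j + 1)) *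
      (Real.exp (-(α * (logLabel n (j + 1) - τ))) * (logLabel n (j + 1) + τ) ^ d) with hc
    have hc0 : 0 ≤ c := by
      have : 0 ≤ logLabel n (j + 1) + τ := by linarith
      positivity
    have h1 : 1 / (n : ℝ) *
        (Real.exp (-(α * (logLabel n (j + 1) - τ))) * (logLabel n (j + 1) + τ) ^ d)
        = 1 / ((j : ℝ) + 1) * c := by
      rw [hc, exp_neg_logLabel hn (Nat.succ_pos j)]
      push_cast
      field_simp
    rw [h1]
    calc 1 / ((j : ℝ) + 1) * c ≤ (logLabel n j - logLabel n (j + 1)) * c :=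
          mul_le_mul_of_nonneg_right hlow hc0
      _ = ∫ _ in logLabel n (j + 1)..logLabel n j, c := by simp
      _ ≤ _ := by
        refine intervalIntegral.integral_mono_on hle (by simp) (hint _ _) fun s hs => ?_
        simp only [hh, hc]
        rw [← mul_assoc, ← mul_assoc, ← Real.exp_add, ← Real.exp_add]
        refine mul_le_mul (Real.exp_le_exp.2 ?_) ?_ (by have := hs.1; positivity) (by positivity)
        · nlinarith [mul_le_mul_of_nonneg_left (by linarith [hs.2] : s - logLabel n (j+1) ≤ τ) hα, hs.2]
        · exact pow_le_pow_left₀ (by linarith) (by linarith [hs.1]) d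
  refine (sum_Ioc_le_of_le_sub hfn _ (fun j => ∫ s in (0 : ℝ)..logLabel n j, h s) hstep).trans ?_
  simp only [logLabel_self hn, intervalIntegral.integral_same, sub_zero]
  have hfl := logLabel_floor_le hn hℓ hτ
  have hfl0 := logLabel_nonneg hf1 hfn
  have h2 : ∫ s in (0 : ℝ)..logLabel n ⌊ℓ⌋₊, h s ≤ ∫ s in (0 : ℝ)..(L + τ), h s := by
    have := intervalIntegral.integral_add_adjacent_intervals (hint 0 (logLabel n ⌊ℓ⌋₊))
      (hint (logLabel n ⌊ℓ⌋₊) (L + τ))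
    have h3 : 0 ≤ ∫ s in logLabel n ⌊ℓ⌋₊..(L + τ), h s :=
      intervalIntegral.integral_nonneg hfl fun s hs => hpos s (hfl0.trans hs.1)
    linarith
  -- Translating by τ turns (s + τ)^d into s^d; the exponents (1 + 2α)τ and (1 + α)τ add up to (2 +
  -- 3α)τ.
  have h3 : ∫ s in (0 : ℝ)..(L + τ), h s
      = Real.exp ((2 + 3 * α) * τ) * ∫ s in τ..(L + τ + τ), Real.exp (-((1 + α) * s)) * s ^ d := by
    have := intervalIntegral.integral_comp_add_right (a := 0) (b := L + τ)
      (fun s => Real.exp (-((1 + α) * s)) * s ^ d) τ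
    rw [zero_add] at this
    rw [← this, ← intervalIntegral.integral_const_mul]
    congr 1; ext s
    simp only [hh]
    rw [← mul_assoc, ← mul_assoc, ← Real.exp_add, ← Real.exp_add]
    congr 2; ring
  have h4 : ∫ s in τ..(L + τ + τ), Real.exp (-((1 + α) * s)) * s ^ d
      ≤ incGamma (1 + α) d (L + τ + τ) := by
    have := intervalIntegral.integral_add_adjacent_intervals (incGamma_integrable (1 + α) d 0 τ)
      (incGamma_integrable (1 + α) d τ (L + τ + τ))
    have h5 := incGamma_nonneg (1 + α) d hτ0.le
    unfold incGamma at *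
    linarith
  have hL0 : 0 < L := by linarith
  have h5 := incGamma_le_scale (u := 1 + α) (by linarith) d hL0 (by linarith : L ≤ L + τ + τ)
  have h6 : ((L + τ + τ) / L) ^ (d + 1) ≤ Real.exp (4 / κ * τ * (d + 1)) := by
    have : (L + τ + τ) / L ≤ Real.exp (4 / κ * τ) := by
      refine le_trans ?_ (Real.add_one_le_exp _)
      rw [div_le_iff₀ hL0]
      have : 4 ≤ 4 / κ * L := by
        rw [div_mul_eq_mul_div, le_div_iff₀ hκ]; linarith
      nlinarith
    refine (pow_le_pow_left₀ (by positivity) this _).trans ?_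
    rw [← Real.exp_nat_mul]
    push_cast
    exact (Real.exp_le_exp.2 (by nlinarith)).trans le_rfl
  have hF0 := incGamma_nonneg (1 + α) d hL0.le
  calc ∫ s in (0 : ℝ)..logLabel n ⌊ℓ⌋₊, h s
      ≤ Real.exp ((2 + 3 * α) * τ) * (Real.exp (4 / κ * τ * (d + 1)) * incGamma (1 + α) d L) := by
        refine h2.trans ?_
        rw [h3]
        refine mul_le_mul_of_nonneg_left (h4.trans (h5.trans ?_)) (Real.exp_pos _).le
        exact mul_le_mul_of_nonneg_right h6 hF0
    _ = Real.exp ((2 + 3 * α) * τ + 4 / κ * τ * (d + 1)) * incGamma (1 + α) d L := by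
        rw [Real.exp_add]; ring
    _ ≤ _ := by
        refine mul_le_mul_of_nonneg_right (Real.exp_le_exp.2 ?_) hF0
        have hd : (0 : ℝ) ≤ d := by positivity
        have : (2 + 3 * α) * τ ≤ (2 + 3 * A) * τ * (d + 1) := by
          have h1 : (2 + 3 * α) * τ ≤ (2 + 3 * A) * τ := by gcongr
          have h2 : 0 ≤ (2 + 3 * A) * τ := by have := hα.trans hαA; positivity
          nlinarith [mul_nonneg h2 hd]
        linarith

/-- The mirror image of `sum_label_le`, with the gap to the next position, at most 1 / j, in place
of the gap to the previous one. -/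
theorem le_sum_label (d : ℕ) (hn : 0 < n) (hℓ : 2 ≤ ℓ) (hτ : 2 / ℓ ≤ τ) (hα : 0 ≤ α) (hαA : α ≤ A)
    (hκ : 0 < κ) (hL : κ ≤ Real.log (n / ℓ)) (hτκ : 4 * τ ≤ κ) :
    Real.exp (-((2 + 3 * A + 4 / κ) * τ * (d + 1))) * incGamma (1 + α) d (Real.log (n / ℓ)) ≤
    ∑ j ∈ Finset.Ioc ⌊ℓ⌋₊ n, 1 / (n : ℝ) *
        (Real.exp (-(α * (logLabel n j + τ))) * (max (logLabel n j - τ) 0) ^ d) := by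
  have hn' : (0 : ℝ) < n := by positivity
  have hℓ0 : 0 < ℓ := by linarith
  have hτ0 : 0 < τ := lt_of_lt_of_le (by positivity) hτ
  set L := Real.log (n / ℓ) with hLdef
  have hf1 : 1 ≤ ⌊ℓ⌋₊ := Nat.one_le_floor_iff _ |>.2 (by linarith)
  have hℓn : ℓ < n := by
    by_contra h
    push Not at h
    have : Real.log (n / ℓ) ≤ 0 := Real.log_nonpos (by positivity) ((div_le_one hℓ0).2 h)
    linarith
  have hfn : ⌊ℓ⌋₊ < n := (Nat.floor_lt hℓ0.le).2 hℓn
  obtain ⟨N, rfl⟩ : ∃ N, n = N + 1 := ⟨n - 1, by omega⟩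
  set h : ℝ → ℝ := fun s => Real.exp (-((1 + 2 * α) * τ)) *
    (Real.exp (-((1 + α) * s)) * (max (s - τ) 0) ^ d) with hh
  have hcont : Continuous h := by simp only [hh]; fun_prop
  have hint : ∀ a b, IntervalIntegrable h volume a b := fun a b => hcont.intervalIntegrable _ _
  have hpos : ∀ s, 0 ≤ h s := fun s => by
    have : 0 ≤ max (s - τ) 0 := le_max_right _ _
    simp only [hh]; positivity
  set t : ℕ → ℝ := fun j => 1 / ((N + 1 : ℕ) : ℝ) *
        (Real.exp (-(α * (logLabel (N + 1) j + τ))) * (max (logLabel (N + 1) j - τ) 0) ^ d) with ht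
  have ht0 : ∀ j, 0 ≤ t j := fun j => by
    have : 0 ≤ max (logLabel (N + 1) j - τ) 0 := le_max_right _ _
    simp only [ht]; positivity
  -- Signs are reversed because the telescoping lemma gives upper bounds. Each label is compared
  -- with the interval down to the next position, so the last label n has none and is dropped.
  have hstep : ∀ j, ⌊ℓ⌋₊ ≤ j → j < N → - t (j + 1) ≤
      (-∫ s in (0 : ℝ)..logLabel (N + 1) (j + 1), h s)
        - (-∫ s in (0 : ℝ)..logLabel (N + 1) (j + 1 + 1), h s) := by
    intro j hj hjn
    have hj0 : 0 < j + 1 := by omega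
    have h0 := intervalIntegral.integral_interval_sub_left (hint 0 (logLabel (N + 1) (j + 1)))
      (hint 0 (logLabel (N + 1) (j + 1 + 1)))
    have hlow := logLabel_sub_succ_le hn hj0
    have hup := step_le_tau hn hℓ hτ (by omega : ⌊ℓ⌋₊ ≤ j + 1)
    have hle : logLabel (N + 1) (j + 1 + 1) ≤ logLabel (N + 1) (j + 1) := by
      have := le_logLabel_sub_succ hn hj0
      have : 0 ≤ 1 / (((j + 1 : ℕ) : ℝ) + 1) := by positivity
      linarith
    set c := Real.exp (-logLabel (N + 1) (j + 1)) *
      (Real.exp (-(α * (logLabel (N + 1) (j + 1) + τ))) *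
        (max (logLabel (N + 1) (j + 1) - τ) 0) ^ d) with hc
    have hc0 : 0 ≤ c := by
      have : 0 ≤ max (logLabel (N + 1) (j + 1) - τ) 0 := le_max_right _ _
      positivity
    have h1 : t (j + 1) = 1 / ((j + 1 : ℕ) : ℝ) * c := by
      rw [hc, exp_neg_logLabel hn (Nat.succ_pos j)]
      simp only [ht]
      field_simp
    rw [h1]
    have : ∫ s in logLabel (N + 1) (j + 1 + 1)..logLabel (N + 1) (j + 1), h s
        ≤ 1 / ((j + 1 : ℕ) : ℝ) * c := by
      calc _ ≤ ∫ _ in logLabel (N + 1) (j + 1 + 1)..logLabel (N + 1) (j + 1), c := by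
            refine intervalIntegral.integral_mono_on hle (hint _ _) (by simp) fun s hs => ?_
            simp only [hh, hc]
            rw [← mul_assoc, ← mul_assoc, ← Real.exp_add, ← Real.exp_add]
            refine mul_le_mul (Real.exp_le_exp.2 ?_) ?_ (by positivity) (by positivity)
            · nlinarith [mul_le_mul_of_nonneg_left
                (by linarith [hs.1] : logLabel (N + 1) (j + 1) - s ≤ τ) hα, hs.1]
            · exact pow_le_pow_left₀ (le_max_right _ _)
                (max_le_max_right _ (by linarith [hs.2])) d
        _ = (logLabel (N + 1) (j + 1) - logLabel (N + 1) (j + 1 + 1)) * c := by simp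
        _ ≤ _ := mul_le_mul_of_nonneg_right hlow hc0
    linarith
  have hsum := sum_Ioc_le_of_le_sub (by omega : ⌊ℓ⌋₊ ≤ N) (fun j => - t j)
    (fun j => -∫ s in (0 : ℝ)..logLabel (N + 1) (j + 1), h s) hstep
  simp only [logLabel_self hn, intervalIntegral.integral_same, Finset.sum_neg_distrib, neg_zero,
    sub_zero, neg_le_neg_iff] at hsum
  have hsum2 : ∑ j ∈ Finset.Ioc ⌊ℓ⌋₊ N, t j ≤ ∑ j ∈ Finset.Ioc ⌊ℓ⌋₊ (N + 1), t j :=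
    Finset.sum_le_sum_of_subset_of_nonneg (Finset.Ioc_subset_Ioc_right (by omega))
      fun j _ _ => ht0 j
  refine le_trans ?_ (hsum.trans hsum2)
  have hfl := le_logLabel_floor_succ hn hℓ hτ
  have h2 : ∫ s in τ..(L - τ - τ + τ), h s
      ≤ ∫ s in (0 : ℝ)..logLabel (N + 1) (⌊ℓ⌋₊ + 1), h s :=
    intervalIntegral.integral_mono_interval hτ0.le (by linarith) (by linarith)
      (ae_of_all _ hpos) (hint _ _)
  have h3 : ∫ s in τ..(L - τ - τ + τ), h s
      = Real.exp (-((2 + 3 * α) * τ)) * incGamma (1 + α) d (L - τ - τ) := by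
    have := intervalIntegral.integral_comp_add_right (a := 0) (b := L - τ - τ) h τ
    rw [zero_add] at this
    rw [← this, incGamma, ← intervalIntegral.integral_const_mul]
    refine intervalIntegral.integral_congr fun s hs => ?_
    rw [Set.uIcc_of_le (by linarith)] at hs
    simp only [hh, add_sub_cancel_right, max_eq_left hs.1]
    rw [← mul_assoc, ← mul_assoc, ← Real.exp_add, ← Real.exp_add]
    congr 2; ring
  refine le_trans ?_ h2
  rw [h3]
  have hL0 : 0 < L := by linarith
  have hL2 : 0 < L - τ - τ := by linarith
  have h5 := incGamma_le_scale (u := 1 + α) (by linarith) d hL2 (by linarith : L - τ - τ ≤ L)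
  -- From 4τ ≤ κ ≤ L one gets L - 2τ ≥ κ / 2, so the ratio is at most 1 + 4τ / κ.
  have h6 : (L / (L - τ - τ)) ^ (d + 1) ≤ Real.exp (4 / κ * τ * (d + 1)) := by
    have : L / (L - τ - τ) ≤ Real.exp (4 / κ * τ) := by
      refine le_trans ?_ (Real.add_one_le_exp _)
      rw [div_le_iff₀ hL2]
      have : 2 ≤ 4 / κ * (L - τ - τ) := by
        rw [div_mul_eq_mul_div, le_div_iff₀ hκ]; linarith
      nlinarith
    refine (pow_le_pow_left₀ (by positivity) this _).trans ?_
    rw [← Real.exp_nat_mul]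
    push_cast
    exact (Real.exp_le_exp.2 (by nlinarith)).trans le_rfl
  have hF0 := incGamma_nonneg (1 + α) d hL2.le
  calc Real.exp (-((2 + 3 * A + 4 / κ) * τ * (d + 1))) * incGamma (1 + α) d L
      ≤ Real.exp (-((2 + 3 * A + 4 / κ) * τ * (d + 1))) *
          (Real.exp (4 / κ * τ * (d + 1)) * incGamma (1 + α) d (L - τ - τ)) :=
        mul_le_mul_of_nonneg_left (h5.trans (mul_le_mul_of_nonneg_right h6 hF0)) (Real.exp_pos _).le
    _ = Real.exp (-((2 + 3 * A) * τ * (d + 1))) * incGamma (1 + α) d (L - τ - τ) := by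
        rw [← mul_assoc, ← Real.exp_add]; congr 2; ring
    _ ≤ _ := by
        refine mul_le_mul_of_nonneg_right (Real.exp_le_exp.2 ?_) hF0
        have hd : (0 : ℝ) ≤ d := by positivity
        have : (2 + 3 * α) * τ ≤ (2 + 3 * A) * τ * (d + 1) := by
          have h1 : (2 + 3 * α) * τ ≤ (2 + 3 * A) * τ := by gcongr
          have h2 : 0 ≤ (2 + 3 * A) * τ := by have := hα.trans hαA; positivity
          nlinarith [mul_nonneg h2 hd]
        linarith

/-- A single label carries a negligible part of the total mass. -/
theorem label_term_le (d : ℕ) {j : ℕ} (hj0 : 0 < j) (hjn : j ≤ n) (hℓ : 0 < ℓ) (hj : ℓ < j)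
    (hα : 0 ≤ α) (hαA : α ≤ A) (hτ : 0 ≤ τ) (hκ : 0 < κ) (hL : κ ≤ Real.log (n / ℓ)) :
    1 / (n : ℝ) * (Real.exp (-(α * (logLabel n j + τ))) * (max (logLabel n j - τ) 0) ^ d)
      ≤ Real.exp ((1 + A) * κ) * (d + 1) / (κ * j) * incGamma (1 + α) d (Real.log (n / ℓ)) := by
  have hn : 0 < n := by omega
  have hn' : (0 : ℝ) < n := by positivity
  have hj' : (0 : ℝ) < j := by positivity
  set s := logLabel n j with hs
  have hs0 : 0 ≤ s := logLabel_nonneg hj0 hjn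
  -- For labels near n the position is close to 0 and the lower bound of `le_incGamma` degenerates.
  -- Raising the position to at least κ costs exp((1 + A)κ), and s' / κ ≥ 1 supplies the missing
  -- power.
  set s' := max s κ with hs'
  have hs'L : s' ≤ Real.log (n / ℓ) := max_le (Real.log_le_log (by positivity) (by gcongr)) hL
  have hs'0 : 0 < s' := lt_of_lt_of_le hκ (le_max_right _ _)
  have hs's : s' ≤ s + κ := max_le (by linarith) (by linarith)
  have h1 := le_incGamma (u := 1 + α) (by linarith) d hs'0.le hs'L
  refine le_trans ?_ (mul_le_mul_of_nonneg_left h1 (by positivity))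
  have h2 : Real.exp (-(α * (s + τ))) * (max (s - τ) 0) ^ d ≤ Real.exp (-(α * s)) * s' ^ d := by
    refine mul_le_mul (Real.exp_le_exp.2 (by nlinarith)) ?_ (by positivity) (by positivity)
    exact pow_le_pow_left₀ (le_max_right _ _)
      (max_le (by linarith [le_max_left s κ]) hs'0.le) d
  have h3 : 1 / (n : ℝ) = Real.exp (-s) * (1 / j) := by
    rw [hs, exp_neg_logLabel hn hj0]; field_simp
  have h4 : Real.exp (-s) * Real.exp (-(α * s))
      ≤ Real.exp ((1 + A) * κ) * Real.exp (-((1 + α) * s')) := by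
    rw [← Real.exp_add, ← Real.exp_add]
    refine Real.exp_le_exp.2 ?_
    nlinarith [mul_le_mul_of_nonneg_left hs's hα, mul_le_mul_of_nonneg_right hαA hκ.le]
  have h5 : 1 ≤ s' / κ := (one_le_div hκ).2 (le_max_right _ _)
  calc 1 / (n : ℝ) * (Real.exp (-(α * (s + τ))) * (max (s - τ) 0) ^ d)
      ≤ 1 / (n : ℝ) * (Real.exp (-(α * s)) * s' ^ d) := by gcongr
    _ = (Real.exp (-s) * Real.exp (-(α * s))) * (1 / j * s' ^ d) := by rw [h3]; ring
    _ ≤ (Real.exp ((1 + A) * κ) * Real.exp (-((1 + α) * s'))) * (1 / j * s' ^ d) := by gcongr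
    _ ≤ (Real.exp ((1 + A) * κ) * Real.exp (-((1 + α) * s'))) * (1 / j * s' ^ d) * (s' / κ) :=
        le_mul_of_one_le_right (by positivity) h5
    _ = _ := by
        field_simp
        ring

end LabelSums

/-! ### Consequences of the assumptions on the weight law. -/

section WeightLaw

variable {ν : Measure ℝ} [IsProbabilityMeasure ν]

theorem ae_le_one_of_sSup (hsup : sSup {x : ℝ | 0 < x ∧ ν (Set.Iic x) < 1} = 1) :
    ∀ᵐ w ∂ν, w ≤ 1 := by
  -- The real supremum of an unbounded set is 0 by convention, so the value 1 forces boundedness.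
  have hbdd : BddAbove {x : ℝ | 0 < x ∧ ν (Set.Iic x) < 1} := by
    by_contra h
    rw [Real.sSup_of_not_bddAbove h] at hsup
    norm_num at hsup
  have h1 : ∀ n : ℕ, ∀ᵐ w ∂ν, w ≤ 1 + 1 / ((n : ℝ) + 1) := by
    intro n
    have hn : (0 : ℝ) < 1 / ((n : ℝ) + 1) := by positivity
    have h2 : ¬ ν (Set.Iic (1 + 1 / ((n : ℝ) + 1))) < 1 := fun h => by
      have := le_csSup hbdd (show 1 + 1 / ((n : ℝ) + 1) ∈ _ from ⟨by linarith, h⟩)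
      linarith
    have h3 : ν (Set.Iic (1 + 1 / ((n : ℝ) + 1))) = 1 := le_antisymm prob_le_one (not_lt.1 h2)
    exact (prob_compl_eq_zero_iff measurableSet_Iic).2 h3
  filter_upwards [ae_all_iff.2 h1] with w hw
  refine le_of_forall_pos_le_add fun ε hε => ?_
  obtain ⟨n, hn⟩ := exists_nat_one_div_lt hε
  linarith [hw n]

theorem integrable_weight (hpos : ∀ᵐ w ∂ν, 0 < w) (hle : ∀ᵐ w ∂ν, w ≤ 1) :
    Integrable (fun w : ℝ => w) ν := by
  refine Integrable.of_mem_Icc 0 1 aemeasurable_id ?_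
  filter_upwards [hpos, hle] with w h1 h2 using ⟨h1.le, h2⟩

theorem theta_sub_one_pos (hpos : ∀ᵐ w ∂ν, 0 < w) (hle : ∀ᵐ w ∂ν, w ≤ 1) : 0 < theta ν - 1 := by
  unfold theta
  rw [add_sub_cancel_left]
  refine (integral_pos_iff_support_of_nonneg_ae (hpos.mono fun w h => h.le)
    (integrable_weight hpos hle)).2 ?_
  have : ν (Function.support fun w : ℝ => w) = 1 := by
    have h : (Function.support fun w : ℝ => w) ∈ ae ν := hpos.mono fun w h => h.ne'
    rw [measure_congr (Filter.eventuallyEq_univ.2 h), measure_univ]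
  rw [this]; exact one_pos

theorem theta_sub_one_le (hpos : ∀ᵐ w ∂ν, 0 < w) (hle : ∀ᵐ w ∂ν, w ≤ 1) : theta ν - 1 ≤ 1 := by
  unfold theta
  rw [add_sub_cancel_left]
  have := integral_mono_ae (integrable_weight hpos hle) (integrable_const (1 : ℝ)) hle
  simpa using this

end WeightLaw

/-! ### The conditional law of the degrees given the weights. -/

section Tree

set_option linter.unusedSectionVars false

variable {Ω : Type*} [mΩ : MeasurableSpace Ω] {P : Measure Ω} [IsProbabilityMeasure P]
  {ν : Measure ℝ} {W : ℕ → Ω → ℝ} {parent : ℕ → Ω → ℕ}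

/-- The information contained in the vertex-weights. -/
abbrev weightAlg (W : ℕ → Ω → ℝ) : MeasurableSpace Ω :=
  ⨆ i : ℕ, MeasurableSpace.comap (W (i + 1)) inferInstance

theorem weightAlg_le_history (n : ℕ) : weightAlg W ≤ history W parent n := le_sup_left

theorem IsWRT.history_le (h : IsWRT P ν W parent) (n : ℕ) : history W parent n ≤ mΩ := by
  refine sup_le (iSup_le fun i => (h.measurable_weight _ (by omega)).comap_le)
    (iSup₂_le fun j hj => (h.measurable_parent _ ?_).comap_le)
  exact (Finset.mem_Icc.1 hj).1

theorem IsWRT.weightAlg_le (h : IsWRT P ν W parent) : weightAlg W ≤ mΩ :=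
  (weightAlg_le_history (parent := parent) 0).trans (h.history_le 0)

theorem measurable_weight_weightAlg {i : ℕ} (hi : 1 ≤ i) : Measurable[weightAlg W] (W i) := by
  obtain ⟨i, rfl⟩ : ∃ a, i = a + 1 := ⟨i - 1, by omega⟩
  exact (comap_measurable (W (i + 1))).mono
    (le_iSup (fun i => MeasurableSpace.comap (W (i + 1)) inferInstance) i) le_rfl

theorem measurable_parent_history {n j : ℕ} (hj : j ∈ Finset.Icc 2 n) :
    Measurable[history W parent n] (parent j) :=
  (comap_measurable (parent j)).mono
    ((le_iSup₂ (f := fun j (_ : j ∈ Finset.Icc 2 n) =>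
      MeasurableSpace.comap (parent j) inferInstance) j hj).trans le_sup_right) le_rfl

theorem measurable_inDegree_history (n i : ℕ) :
    Measurable[history W parent n] (inDegree parent n i) := by
  have : inDegree parent n i = fun ω => ∑ j ∈ Finset.Icc 2 n, if parent j ω = i then 1 else 0 := by
    ext ω; simp only [inDegree, Finset.card_filter]
  rw [this]
  refine Finset.measurable_fun_sum _ fun j hj => ?_
  refine Measurable.ite ?_ measurable_const measurable_const
  exact measurable_parent_history hj (MeasurableSet.singleton i)

theorem measurableSet_degrees {k : ℕ} (n : ℕ) (j d : Fin k → ℕ) :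
    MeasurableSet[history W parent n] {ω | ∀ i, inDegree parent n (j i) ω = d i} := by
  rw [Set.ofPred_forall]
  exact MeasurableSet.iInter fun i =>
    measurable_inDegree_history n (j i) (MeasurableSet.singleton (d i))

theorem IsWRT.ae_weight (h : IsWRT P ν W parent) {p : ℝ → Prop} (hp : ∀ᵐ w ∂ν, p w) :
    ∀ᵐ ω ∂P, ∀ i, 1 ≤ i → p (W i ω) := by
  rw [ae_all_iff]
  intro i
  by_cases hi : 1 ≤ i
  · rw [← h.law_weight i hi] at hp
    filter_upwards [ae_of_ae_map (h.measurable_weight i hi).aemeasurable hp] with ω hω _ using hω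
  · exact ae_of_all _ fun ω h' => absurd h' hi

/-- The attachment rule tested against bounded functions of the past: pull X out of the conditional
expectation. -/
theorem IsWRT.integral_mul_parent (h : IsWRT P ν W parent) {n i : ℕ} (hn : 1 ≤ n)
    (hi : i ∈ Finset.Icc 1 n) {X : Ω → ℝ} (hX : StronglyMeasurable[history W parent n] X) {C : ℝ}
    (hC : ∀ᵐ ω ∂P, |X ω| ≤ C) :
    ∫ ω, X ω * Set.indicator {ω | parent (n + 1) ω = i} (fun _ => (1 : ℝ)) ω ∂P
      = ∫ ω, X ω * (W i ω / ∑ j ∈ Finset.Icc 1 n, W j ω) ∂P := by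
  have hA : MeasurableSet {ω | parent (n + 1) ω = i} :=
    h.measurable_parent (n + 1) (by omega) (MeasurableSet.singleton i)
  set g : Ω → ℝ := Set.indicator {ω | parent (n + 1) ω = i} (fun _ => (1 : ℝ)) with hg
  have hgi : Integrable g P := (integrable_const (1 : ℝ)).indicator hA
  have hXi : Integrable (X * g) P := by
    refine hgi.bdd_mul (c := C) (hX.mono (h.history_le n)).aestronglyMeasurable ?_
    simpa only [Real.norm_eq_abs] using hC
  have h1 := condExp_mul_of_stronglyMeasurable_left hX hXi hgi
  have h2 := integral_condExp (h.history_le n) (f := X * g) (μ := P)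
  have h3 : ∫ ω, X ω * g ω ∂P = ∫ ω, (X * g) ω ∂P := rfl
  rw [h3, ← h2]
  refine integral_congr_ae ?_
  filter_upwards [h1, h.parent_law n hn i hi] with ω h4 h5
  rw [h4, Pi.mul_apply]
  exact congrArg (X ω * ·) h5

/-- The prescribed probabilities over [n] already add up to 1, which leaves no mass for other
values. -/
theorem IsWRT.ae_parent_mem (h : IsWRT P ν W parent) (hpos : ∀ᵐ w ∂ν, 0 < w) {n : ℕ} (hn : 1 ≤ n) :
    ∀ᵐ ω ∂P, parent (n + 1) ω ∈ Finset.Icc 1 n := by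
  have hmeas : ∀ i, MeasurableSet {ω | parent (n + 1) ω = i} := fun i =>
    h.measurable_parent (n + 1) (by omega) (MeasurableSet.singleton i)
  have hint : ∀ i ∈ Finset.Icc 1 n, P.real {ω | parent (n + 1) ω = i}
      = ∫ ω, W i ω / ∑ j ∈ Finset.Icc 1 n, W j ω ∂P := by
    intro i hi
    have := h.integral_mul_parent hn hi (X := fun _ => 1) stronglyMeasurable_const (C := 1)
      (by simp)
    simp only [one_mul] at this
    rw [← this]
    exact (integral_indicator_one (hmeas i)).symm
  have hq : ∀ i ∈ Finset.Icc 1 n, Integrable (fun ω => W i ω / ∑ j ∈ Finset.Icc 1 n, W j ω) P := by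
    intro i hi
    have := (integrable_condExp (μ := P) (m := history W parent n)
      (f := Set.indicator {ω | parent (n + 1) ω = i} (fun _ => (1 : ℝ))))
    exact this.congr (h.parent_law n hn i hi)
  have hset : {ω | parent (n + 1) ω ∈ Finset.Icc 1 n}
      = ⋃ i ∈ Finset.Icc 1 n, {ω | parent (n + 1) ω = i} := by
    ext ω; simp
  have htot : P.real {ω | parent (n + 1) ω ∈ Finset.Icc 1 n} = 1 := by
    rw [hset, measureReal_biUnion_finset]
    · rw [Finset.sum_congr rfl hint, ← integral_finsetSum _ hq]
      have : ∀ᵐ ω ∂P, ∑ i ∈ Finset.Icc 1 n, W i ω / ∑ j ∈ Finset.Icc 1 n, W j ω = 1 := by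
        filter_upwards [h.ae_weight hpos] with ω hω
        rw [← Finset.sum_div, div_self]
        refine (Finset.sum_pos (fun i hi => hω i (Finset.mem_Icc.1 hi).1) ⟨1, ?_⟩).ne'
        exact Finset.mem_Icc.2 ⟨le_rfl, hn⟩
      rw [integral_congr_ae this]; simp
    · intro a _ b _ hab
      exact Set.disjoint_left.2 fun ω h1 h2 => hab (h1.symm.trans h2)
    · exact fun i _ => hmeas i
  have hm : MeasurableSet {ω | parent (n + 1) ω ∈ Finset.Icc 1 n} := by
    rw [hset]; exact Finset.measurableSet_biUnion _ fun i _ => hmeas i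
  have h1 : P {ω | parent (n + 1) ω ∈ Finset.Icc 1 n} = 1 := by
    rwa [measureReal_def, ENNReal.toReal_eq_one_iff] at htot
  exact (prob_compl_eq_zero_iff hm).2 h1

/-- The probability, given the weights, that vertex `a + 1` connects to `j i`. -/
def stepProb {k : ℕ} (W : ℕ → Ω → ℝ) (j : Fin k → ℕ) (ω : Ω) (a : ℕ) (i : Fin k) : ℝ :=
  if j i ∈ Finset.Icc 1 a then W (j i) ω / ∑ l ∈ Finset.Icc 1 a, W l ω else 0

variable {k : ℕ} {j : Fin k → ℕ}

theorem stepProb_nonneg {ω : Ω} (hω : ∀ i, 1 ≤ i → 0 < W i ω) (a : ℕ) (i : Fin k) :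
    0 ≤ stepProb W j ω a i := by
  unfold stepProb
  split_ifs with h
  · exact div_nonneg (hω _ (Finset.mem_Icc.1 h).1).le
      (Finset.sum_nonneg fun l hl => (hω l (Finset.mem_Icc.1 hl).1).le)
  · exact le_rfl

/-- By injectivity the numerators are distinct summands of the denominator. -/
theorem sum_stepProb_le_one (hj : Function.Injective j) {ω : Ω} (hω : ∀ i, 1 ≤ i → 0 < W i ω)
    (a : ℕ) : ∑ i, stepProb W j ω a i ≤ 1 := by
  classical
  simp only [stepProb]
  rw [← Finset.sum_filter, ← Finset.sum_div]
  refine div_le_one_of_le₀ ?_ (Finset.sum_nonneg fun l hl => (hω l (Finset.mem_Icc.1 hl).1).le)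
  rw [← Finset.sum_image (f := fun l => W l ω) (fun x _ y _ hxy => hj hxy)]
  refine Finset.sum_le_sum_of_subset_of_nonneg ?_ fun l hl _ => (hω l (Finset.mem_Icc.1 hl).1).le
  intro l hl
  obtain ⟨i, hi, rfl⟩ := Finset.mem_image.1 hl
  exact (Finset.mem_filter.1 hi).2

theorem stronglyMeasurable_stepProb (a : ℕ) (i : Fin k) :
    StronglyMeasurable[weightAlg W] fun ω => stepProb W j ω a i := by
  unfold stepProb
  split_ifs with h
  · refine Measurable.stronglyMeasurable ?_
    refine (measurable_weight_weightAlg (Finset.mem_Icc.1 h).1).div ?_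
    exact Finset.measurable_fun_sum _ fun l hl =>
      measurable_weight_weightAlg (Finset.mem_Icc.1 hl).1
  · exact stronglyMeasurable_const

theorem degreeLaw_le_one (q : ℕ → Fin k → ℝ) (hq : ∀ a i, 0 ≤ q a i) (hQ : ∀ a, ∑ i, q a i ≤ 1)
    (a : ℕ) (d : Fin k → ℕ) : degreeLaw q a d ≤ 1 := by
  induction a generalizing d with
  | zero => unfold degreeLaw; split_ifs <;> simp
  | succ a ih =>
    unfold degreeLaw
    have h1 : (1 - ∑ i, q a i) * degreeLaw q a d ≤ 1 - ∑ i, q a i :=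
      mul_le_of_le_one_right (by linarith [hQ a]) (ih d)
    have h2 : (∑ i, if d i = 0 then 0 else q a i * degreeLaw q a (Function.update d i (d i - 1)))
        ≤ ∑ i, q a i := by
      refine Finset.sum_le_sum fun i _ => ?_
      split_ifs
      · exact hq a i
      · exact mul_le_of_le_one_right (hq a i) (ih _)
    linarith

theorem stronglyMeasurable_degreeLaw (a : ℕ) (d : Fin k → ℕ) :
    StronglyMeasurable[weightAlg W] fun ω => degreeLaw (stepProb W j ω) a d := by
  induction a generalizing d with
  | zero => exact stronglyMeasurable_const
  | succ a ih =>
    simp only [degreeLaw]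
    refine StronglyMeasurable.add (StronglyMeasurable.mul (stronglyMeasurable_const.sub
      (Finset.stronglyMeasurable_fun_sum _ fun i _ => stronglyMeasurable_stepProb a i)) (ih d))
      (Finset.stronglyMeasurable_fun_sum _ fun i _ => ?_)
    split_ifs
    · exact stronglyMeasurable_const
    · exact (stronglyMeasurable_stepProb a i).mul (ih _)

theorem inDegree_succ (parent : ℕ → Ω → ℕ) {n : ℕ} (hn : 1 ≤ n) (i : ℕ) (ω : Ω) :
    inDegree parent (n + 1) i ω
      = inDegree parent n i ω + if parent (n + 1) ω = i then 1 else 0 := by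
  unfold inDegree
  rw [← Finset.insert_Icc_right_eq_Icc_add_one (by omega), Finset.filter_insert]
  split_ifs with h
  · rw [Finset.card_insert_of_notMem]; simp
  · simp

/-- The event that the degrees of the vertices `j i` in the tree on `n` vertices are `d i`. -/
def degreeEvent (parent : ℕ → Ω → ℕ) (n : ℕ) (j d : Fin k → ℕ) : Set Ω :=
  {ω | ∀ i, inDegree parent n (j i) ω = d i}

/-- The event that the degrees are `d i`, written according to the choice of the last vertex. -/
theorem indicator_degreeEvent_succ (parent : ℕ → Ω → ℕ) {n : ℕ} (hn : 1 ≤ n)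
    (hj : Function.Injective j) (d : Fin k → ℕ) (ω : Ω) :
    (degreeEvent parent (n + 1) j d).indicator (fun _ => (1 : ℝ)) ω
      = (degreeEvent parent n j d).indicator (fun _ => (1 : ℝ)) ω
      - ∑ i, (degreeEvent parent n j d).indicator (fun _ => (1 : ℝ)) ω *
          Set.indicator {ω | parent (n + 1) ω = j i} (fun _ => (1 : ℝ)) ω
      + ∑ i, if d i = 0 then 0 else
        (degreeEvent parent n j (Function.update d i (d i - 1))).indicator (fun _ => (1 : ℝ)) ω *
          Set.indicator {ω | parent (n + 1) ω = j i} (fun _ => (1 : ℝ)) ω := by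
  classical
  by_cases h : ∃ i, parent (n + 1) ω = j i
  · obtain ⟨i, hi⟩ := h
    have hJ : ∀ l, Set.indicator {ω | parent (n + 1) ω = j l} (fun _ => (1 : ℝ)) ω
        = if l = i then 1 else 0 := by
      intro l
      simp only [Set.indicator_apply, Set.mem_ofPred_eq, hi, hj.eq_iff, eq_comm]
    have hdeg : ∀ l, inDegree parent (n + 1) (j l) ω
        = inDegree parent n (j l) ω + if l = i then 1 else 0 := by
      intro l
      rw [inDegree_succ parent hn, hi]
      simp only [hj.eq_iff, eq_comm]
    have hif : ∀ l, (if d l = 0 then 0 else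
        (degreeEvent parent n j (Function.update d l (d l - 1))).indicator (fun _ => (1 : ℝ)) ω *
          if l = i then 1 else 0) = if l = i then (if d i = 0 then 0 else
        (degreeEvent parent n j (Function.update d i (d i - 1))).indicator (fun _ => (1 : ℝ)) ω)
        else 0 := by
      intro l
      by_cases hl : l = i
      · subst hl; simp
      · simp [hl]
    simp only [hJ]
    rw [Finset.sum_congr rfl fun l _ => hif l]
    simp only [mul_ite, mul_one, mul_zero, Finset.sum_ite_eq', Finset.mem_univ, if_true,
      sub_self, zero_add]
    have hiff : ω ∈ degreeEvent parent (n + 1) j d ↔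
        d i ≠ 0 ∧ ω ∈ degreeEvent parent n j (Function.update d i (d i - 1)) := by
      simp only [degreeEvent, Set.mem_ofPred_eq, hdeg]
      constructor
      · intro hh
        have hdi := hh i
        simp only [if_true] at hdi
        refine ⟨by omega, fun l => ?_⟩
        by_cases hl : l = i
        · subst hl; rw [Function.update_self]; omega
        · have := hh l
          rw [Function.update_of_ne hl]
          simpa [hl] using this
      · rintro ⟨h0, hh⟩ l
        have := hh l
        by_cases hl : l = i
        · subst hl; rw [Function.update_self] at this; simp only [if_true]; omega
        · rw [Function.update_of_ne hl] at this
          simpa [hl] using this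
    by_cases h0 : d i = 0
    · rw [if_pos h0, Set.indicator_of_notMem]
      rw [hiff]; tauto
    · rw [if_neg h0]
      by_cases hm : ω ∈ degreeEvent parent n j (Function.update d i (d i - 1))
      · rw [Set.indicator_of_mem hm, Set.indicator_of_mem (hiff.2 ⟨h0, hm⟩)]
      · rw [Set.indicator_of_notMem hm, Set.indicator_of_notMem fun h' => hm (hiff.1 h').2]
  · push Not at h
    have hJ : ∀ l, Set.indicator {ω | parent (n + 1) ω = j l} (fun _ => (1 : ℝ)) ω = 0 := fun l =>
      Set.indicator_of_notMem (s := {ω | parent (n + 1) ω = j l}) (fun h' => h l h') _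
    have hdeg : ∀ l, inDegree parent (n + 1) (j l) ω = inDegree parent n (j l) ω := by
      intro l
      rw [inDegree_succ parent hn, if_neg (h l), add_zero]
    simp only [hJ, mul_zero, Finset.sum_const_zero, ite_self, sub_zero, add_zero]
    simp only [degreeEvent, Set.indicator_apply, Set.mem_ofPred_eq, hdeg]

/-- The conditional law of the degrees given the weights is `degreeLaw`. -/
theorem IsWRT.integral_mul_degreeEvent (h : IsWRT P ν W parent) (hpos : ∀ᵐ w ∂ν, 0 < w)
    (hj : Function.Injective j) (n : ℕ) (d : Fin k → ℕ) {X : Ω → ℝ}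
    (hX : StronglyMeasurable[weightAlg W] X) {C : ℝ} (hC : ∀ᵐ ω ∂P, |X ω| ≤ C) :
    ∫ ω, X ω * (degreeEvent parent n j d).indicator (fun _ => (1 : ℝ)) ω ∂P
      = ∫ ω, X ω * degreeLaw (stepProb W j ω) n d ∂P := by
  classical
  have hW := h.ae_weight hpos
  have hdeg0 : ∀ n ≤ 1, ∀ (d : Fin k → ℕ) ω,
      (degreeEvent parent n j d).indicator (fun _ => (1 : ℝ)) ω = if d = 0 then 1 else 0 := by
    intro n hn d ω
    have h0 : ∀ l, inDegree parent n l ω = 0 := fun l => by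
      unfold inDegree
      rw [Finset.Icc_eq_empty (by omega)]; simp
    simp only [degreeEvent, Set.indicator_apply, Set.mem_ofPred_eq, h0, funext_iff, Pi.zero_apply,
      eq_comm]
  -- The test function must vary: one step of the recursion multiplies X by a step probability,
  -- itself a function of the weights.
  induction n generalizing d X C with
  | zero => simp only [hdeg0 0 (by omega), degreeLaw]
  | succ n ih =>
    -- Vertex 1 chooses no parent; correspondingly all step probabilities at a = 0 vanish.
    rcases Nat.eq_zero_or_pos n with rfl | hn
    · simp [hdeg0 1 le_rfl, degreeLaw, stepProb]
    have hmeasE : ∀ d, StronglyMeasurable[history W parent n]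
        ((degreeEvent parent n j d).indicator (fun _ => (1 : ℝ))) := fun d =>
      stronglyMeasurable_const.indicator (measurableSet_degrees n j d)
    have hE1 : ∀ d ω, |(degreeEvent parent n j d).indicator (fun _ => (1 : ℝ)) ω| ≤ 1 := by
      intro d ω
      simp only [Set.indicator_apply]; split_ifs <;> simp
    have hXE : ∀ d, ∀ᵐ ω ∂P,
        |X ω * (degreeEvent parent n j d).indicator (fun _ => (1 : ℝ)) ω| ≤ C := by
      intro d
      filter_upwards [hC] with ω hω
      rw [abs_mul]
      exact (mul_le_of_le_one_right (abs_nonneg _) (hE1 d ω)).trans hω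
    have hXq : ∀ i, ∀ᵐ ω ∂P, |X ω * stepProb W j ω n i| ≤ C := by
      intro i
      filter_upwards [hC, hW] with ω hω hω2
      rw [abs_mul, abs_of_nonneg (stepProb_nonneg hω2 n i)]
      refine (mul_le_of_le_one_right (abs_nonneg _) ?_).trans hω
      exact (Finset.single_le_sum (fun i _ => stepProb_nonneg hω2 n i) (Finset.mem_univ i)).trans
        (sum_stepProb_le_one hj hω2 n)
    have hf1 : ∀ᵐ ω ∂P, ∀ d, |degreeLaw (stepProb W j ω) n d| ≤ 1 := by
      filter_upwards [hW] with ω hω d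
      rw [abs_of_nonneg (degreeLaw_nonneg _ (stepProb_nonneg hω) (sum_stepProb_le_one hj hω) n d)]
      exact degreeLaw_le_one _ (stepProb_nonneg hω) (sum_stepProb_le_one hj hω) n d
    -- one step of the recursion for each fixed outcome
    have hone : ∀ d i, ∫ ω, X ω * (degreeEvent parent n j d).indicator (fun _ => (1 : ℝ)) ω *
          Set.indicator {ω | parent (n + 1) ω = j i} (fun _ => (1 : ℝ)) ω ∂P
        = ∫ ω, X ω * stepProb W j ω n i * degreeLaw (stepProb W j ω) n d ∂P := by
      intro d i
      rw [← ih d (X := fun ω => X ω * stepProb W j ω n i)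
        (hX.mul (stronglyMeasurable_stepProb n i)) (hXq i)]
      -- A vertex not yet present is almost surely not chosen, in agreement with its step
      -- probability 0.
      by_cases hi : j i ∈ Finset.Icc 1 n
      · rw [h.integral_mul_parent hn hi
          (X := fun ω => X ω * (degreeEvent parent n j d).indicator (fun _ => (1 : ℝ)) ω) ((hX.mono (weightAlg_le_history n)).mul (hmeasE d)) (hXE d)]
        refine integral_congr_ae (ae_of_all _ fun ω => ?_)
        simp only [stepProb, if_pos hi]; ring
      · refine integral_congr_ae ?_
        filter_upwards [h.ae_parent_mem hpos hn] with ω hω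
        have hne : ω ∉ {ω | parent (n + 1) ω = j i} := fun h' => hi (h' ▸ hω)
        simp [stepProb, hi, Set.indicator_of_notMem hne]
    have hmX : AEStronglyMeasurable X P := (hX.mono h.weightAlg_le).aestronglyMeasurable
    have hmE : ∀ d, AEStronglyMeasurable
        ((degreeEvent parent n j d).indicator (fun _ => (1 : ℝ))) P := fun d =>
      ((hmeasE d).mono (h.history_le n)).aestronglyMeasurable
    have hmJ : ∀ i, AEStronglyMeasurable
        (Set.indicator {ω | parent (n + 1) ω = i} (fun _ => (1 : ℝ))) P := fun i =>
      (stronglyMeasurable_const.indicator (h.measurable_parent (n + 1) (by omega)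
        (MeasurableSet.singleton i))).aestronglyMeasurable
    have hmq : ∀ i, AEStronglyMeasurable (fun ω => stepProb W j ω n i) P := fun i =>
      ((stronglyMeasurable_stepProb n i).mono h.weightAlg_le).aestronglyMeasurable
    have hmf : ∀ d, AEStronglyMeasurable (fun ω => degreeLaw (stepProb W j ω) n d) P := fun d =>
      ((stronglyMeasurable_degreeLaw n d).mono h.weightAlg_le).aestronglyMeasurable
    have hint1 : ∀ d, Integrable
        (fun ω => X ω * (degreeEvent parent n j d).indicator (fun _ => (1 : ℝ)) ω) P := fun d =>
      Integrable.of_bound (hmX.mul (hmE d)) C (by simpa only [Real.norm_eq_abs] using hXE d)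
    have hint2 : ∀ d i, Integrable
        (fun ω => X ω * (degreeEvent parent n j d).indicator (fun _ => (1 : ℝ)) ω *
          Set.indicator {ω | parent (n + 1) ω = j i} (fun _ => (1 : ℝ)) ω) P := by
      intro d i
      refine Integrable.of_bound ((hmX.mul (hmE d)).mul (hmJ (j i))) C ?_
      filter_upwards [hXE d] with ω hω
      rw [Real.norm_eq_abs, abs_mul]
      refine (mul_le_of_le_one_right (abs_nonneg _) ?_).trans hω
      simp only [Set.indicator_apply]; split_ifs <;> simp
    have hint3 : ∀ d, Integrable (fun ω => X ω * degreeLaw (stepProb W j ω) n d) P := by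
      intro d
      refine Integrable.of_bound (hmX.mul (hmf d)) C ?_
      filter_upwards [hC, hf1] with ω h1 h2
      rw [Real.norm_eq_abs, abs_mul]
      exact (mul_le_of_le_one_right (abs_nonneg _) (h2 d)).trans h1
    have hint4 : ∀ d i, Integrable
        (fun ω => X ω * stepProb W j ω n i * degreeLaw (stepProb W j ω) n d) P := by
      intro d i
      refine Integrable.of_bound ((hmX.mul (hmq i)).mul (hmf d)) C ?_
      filter_upwards [hXq i, hf1] with ω h1 h2
      rw [Real.norm_eq_abs, abs_mul]
      exact (mul_le_of_le_one_right (abs_nonneg _) (h2 d)).trans h1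
    have hL : ∀ ω, X ω * (degreeEvent parent (n + 1) j d).indicator (fun _ => (1 : ℝ)) ω
        = X ω * (degreeEvent parent n j d).indicator (fun _ => (1 : ℝ)) ω
          - ∑ i, X ω * (degreeEvent parent n j d).indicator (fun _ => (1 : ℝ)) ω *
            Set.indicator {ω | parent (n + 1) ω = j i} (fun _ => (1 : ℝ)) ω
          + ∑ i, if d i = 0 then 0 else
            X ω * (degreeEvent parent n j (Function.update d i (d i - 1))).indicator
              (fun _ => (1 : ℝ)) ω *
            Set.indicator {ω | parent (n + 1) ω = j i} (fun _ => (1 : ℝ)) ω := by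
      intro ω
      rw [indicator_degreeEvent_succ parent hn hj, mul_add, mul_sub, Finset.mul_sum, Finset.mul_sum]
      simp only [mul_ite, mul_zero, mul_assoc]
    have hR : ∀ ω, X ω * degreeLaw (stepProb W j ω) (n + 1) d
        = X ω * degreeLaw (stepProb W j ω) n d
          - ∑ i, X ω * stepProb W j ω n i * degreeLaw (stepProb W j ω) n d
          + ∑ i, if d i = 0 then 0 else
            X ω * stepProb W j ω n i *
              degreeLaw (stepProb W j ω) n (Function.update d i (d i - 1)) := by
      intro ω
      conv_lhs => rw [degreeLaw]
      have h1 : ∑ i, X ω * stepProb W j ω n i * degreeLaw (stepProb W j ω) n d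
          = X ω * (∑ i, stepProb W j ω n i) * degreeLaw (stepProb W j ω) n d := by
        rw [← Finset.sum_mul, ← Finset.mul_sum]
      rw [h1, mul_add, Finset.mul_sum]
      simp only [mul_ite, mul_zero, mul_assoc]
      ring
    simp only [hL, hR]
    have hite1 : ∀ i, Integrable (fun ω => if d i = 0 then 0 else
            X ω * (degreeEvent parent n j (Function.update d i (d i - 1))).indicator
              (fun _ => (1 : ℝ)) ω *
            Set.indicator {ω | parent (n + 1) ω = j i} (fun _ => (1 : ℝ)) ω) P := by
      intro i; split_ifs
      · exact integrable_zero _ _ _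
      · exact hint2 _ i
    have hite2 : ∀ i, Integrable (fun ω => if d i = 0 then 0 else
            X ω * stepProb W j ω n i *
              degreeLaw (stepProb W j ω) n (Function.update d i (d i - 1))) P := by
      intro i; split_ifs
      · exact integrable_zero _ _ _
      · exact hint4 _ i
    have hsub1 : Integrable (fun ω =>
        X ω * (degreeEvent parent n j d).indicator (fun _ => (1 : ℝ)) ω
          - ∑ i, X ω * (degreeEvent parent n j d).indicator (fun _ => (1 : ℝ)) ω *
            Set.indicator {ω | parent (n + 1) ω = j i} (fun _ => (1 : ℝ)) ω) P :=
      (hint1 d).sub (integrable_finsetSum _ fun i _ => hint2 d i)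
    have hsub2 : Integrable (fun ω => X ω * degreeLaw (stepProb W j ω) n d
          - ∑ i, X ω * stepProb W j ω n i * degreeLaw (stepProb W j ω) n d) P :=
      (hint3 d).sub (integrable_finsetSum _ fun i _ => hint4 d i)
    rw [integral_add hsub1 (integrable_finsetSum _ fun i _ => hite1 i),
      integral_sub (hint1 d) (integrable_finsetSum _ fun i _ => hint2 d i),
      integral_add hsub2 (integrable_finsetSum _ fun i _ => hite2 i),
      integral_sub (hint3 d) (integrable_finsetSum _ fun i _ => hint4 d i),
      integral_finsetSum _ fun i _ => hint2 d i, integral_finsetSum _ fun i _ => hite1 i,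
      integral_finsetSum _ fun i _ => hint4 d i, integral_finsetSum _ fun i _ => hite2 i,
      ih d hX hC]
    congr 1
    · congr 1
      exact Finset.sum_congr rfl fun i _ => hone d i
    · refine Finset.sum_congr rfl fun i _ => ?_
      split_ifs
      · rfl
      · exact hone _ i

theorem IsWRT.measureReal_inter_degreeEvent (h : IsWRT P ν W parent) (hpos : ∀ᵐ w ∂ν, 0 < w)
    (hj : Function.Injective j) (n : ℕ) (d : Fin k → ℕ) {G : Set Ω}
    (hG : MeasurableSet[weightAlg W] G) :
    P.real (G ∩ degreeEvent parent n j d) = ∫ ω in G, degreeLaw (stepProb W j ω) n d ∂P := by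
  classical
  have h1 := h.integral_mul_degreeEvent hpos hj n d
    (X := G.indicator fun _ => (1 : ℝ)) (stronglyMeasurable_const.indicator hG) (C := 1)
    (ae_of_all _ fun ω => by simp only [Set.indicator_apply]; split_ifs <;> simp)
  have hGm : MeasurableSet G := h.weightAlg_le _ hG
  have hEm : MeasurableSet (degreeEvent parent n j d) :=
    h.history_le n _ (measurableSet_degrees n j d)
  rw [← integral_indicator hGm]
  have h2 : ∀ ω, G.indicator (fun ω => degreeLaw (stepProb W j ω) n d) ω
      = G.indicator (fun _ => (1 : ℝ)) ω * degreeLaw (stepProb W j ω) n d := by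
    intro ω; simp only [Set.indicator_apply]; split_ifs <;> simp
  simp only [h2]
  rw [← h1, ← integral_indicator_one (hGm.inter hEm)]
  refine integral_congr_ae (ae_of_all _ fun ω => ?_)
  by_cases h1 : ω ∈ G <;> by_cases h2 : ω ∈ degreeEvent parent n j d <;>
    simp [Set.mem_inter_iff, h1, h2]

end Tree

/-! ### Concentration of total weights and the resulting bounds for fixed labels. -/

section Concentration

set_option linter.unusedSectionVars false

variable {Ω : Type*} [mΩ : MeasurableSpace Ω] {P : Measure Ω} [IsProbabilityMeasure P]
  {ν : Measure ℝ} [IsProbabilityMeasure ν] {W : ℕ → Ω → ℝ} {parent : ℕ → Ω → ℕ}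

/-- The total weight of the vertices `1, …, a`. -/
def totalWeight (W : ℕ → Ω → ℝ) (a : ℕ) (ω : Ω) : ℝ := ∑ l ∈ Finset.Icc 1 a, W l ω

theorem totalWeight_eq_sum_range (a : ℕ) (ω : Ω) :
    totalWeight W a ω = ∑ i ∈ Finset.range a, W (i + 1) ω := by
  unfold totalWeight
  induction a with
  | zero => simp
  | succ a ih => rw [Finset.sum_Icc_succ_top (by omega), ih, Finset.sum_range_succ]

theorem measurable_totalWeight (a : ℕ) : Measurable[weightAlg W] (totalWeight W a) :=
  Finset.measurable_fun_sum _ fun _ hl => measurable_weight_weightAlg (Finset.mem_Icc.1 hl).1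

/-- The total weights of at least `y` and at most `n` vertices are close to their means. -/
def goodEvent (W : ℕ → Ω → ℝ) (m ρ y : ℝ) (n : ℕ) : Set Ω :=
  {ω | ∀ a ∈ Finset.Icc 1 n, y ≤ a → |totalWeight W a ω - a * m| < ρ * a}

theorem measurableSet_goodEvent (m ρ y : ℝ) (n : ℕ) :
    MeasurableSet[weightAlg W] (goodEvent W m ρ y n) := by
  have : goodEvent W m ρ y n = ⋂ a ∈ Finset.Icc 1 n, ⋂ _ : y ≤ a,
      {ω | |totalWeight W a ω - a * m| < ρ * a} := by
    ext ω; simp [goodEvent]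
  rw [this]
  refine Finset.measurableSet_biInter _ fun a _ => MeasurableSet.iInter fun _ => ?_
  have h1 : Measurable[weightAlg W] fun ω => |totalWeight W a ω - a * m| := by
    have := (measurable_totalWeight (W := W) a).sub_const (a * m)
    exact continuous_abs.measurable.comp this
  exact measurableSet_lt h1 measurable_const

theorem IsWRT.integral_comp_weight (h : IsWRT P ν W parent) {i : ℕ} (hi : 1 ≤ i) {g : ℝ → ℝ}
    (hg : AEStronglyMeasurable g ν) : ∫ ω, g (W i ω) ∂P = ∫ w, g w ∂ν := by
  have hl := h.law_weight i hi
  rw [← hl] at hg ⊢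
  exact (integral_map (h.measurable_weight i hi).aemeasurable hg).symm

theorem IsWRT.hoeffding (h : IsWRT P ν W parent) (hpos : ∀ᵐ w ∂ν, 0 < w) (hle : ∀ᵐ w ∂ν, w ≤ 1)
    {ρ : ℝ} (hρ : 0 ≤ ρ) {a : ℕ} (ha : 1 ≤ a) :
    P.real {ω | ρ * a ≤ |totalWeight W a ω - a * (theta ν - 1)|}
      ≤ 2 * Real.exp (-(2 * ρ ^ 2 * a)) := by
  set m := theta ν - 1 with hm
  have ha' : (0 : ℝ) < a := by positivity
  have hmean : ∀ i, P[W (i + 1)] = m := fun i => by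
    rw [h.integral_comp_weight (g := fun w => w) (by omega) aestronglyMeasurable_id, hm, theta]
    ring
  have hsub : ∀ i, HasSubgaussianMGF (fun ω => W (i + 1) ω - m) ((‖(1 : ℝ) - 0‖₊ / 2) ^ 2) P := by
    intro i
    rw [← hmean i]
    refine hasSubgaussianMGF_of_mem_Icc (h.measurable_weight _ (by omega)).aemeasurable ?_
    filter_upwards [h.ae_weight hpos, h.ae_weight hle] with ω h1 h2
    exact ⟨(h1 _ (by omega)).le, h2 _ (by omega)⟩
  have hind : iIndepFun (fun (i : ℕ) ω => W (i + 1) ω - m) P :=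
    h.indep_weight.comp (fun _ x => x - m) fun _ => measurable_id.sub_const m
  have hind' : iIndepFun (fun (i : ℕ) ω => -(W (i + 1) ω - m)) P :=
    h.indep_weight.comp (fun _ x => -(x - m)) fun _ => (measurable_id.sub_const m).neg
  -- A variable in [0, 1] is sub-Gaussian with variance proxy 1/4.
  have hexp : -(ρ * a) ^ 2 / (2 * a * (((‖(1 : ℝ) - 0‖₊ / 2) ^ 2 : NNReal) : ℝ))
      = -(2 * ρ ^ 2 * a) := by
    simp only [sub_zero, nnnorm_one]
    push_cast
    field_simp
  have h1 := HasSubgaussianMGF.measure_sum_range_ge_le_of_iIndepFun hind (n := a)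
    (fun i _ => hsub i) (ε := ρ * a) (by positivity)
  have h2 := HasSubgaussianMGF.measure_sum_range_ge_le_of_iIndepFun hind' (n := a)
    (fun i _ => (hsub i).neg) (ε := ρ * a) (by positivity)
  rw [hexp] at h1 h2
  have hsum : ∀ ω, ∑ i ∈ Finset.range a, (W (i + 1) ω - m) = totalWeight W a ω - a * m := by
    intro ω
    rw [totalWeight_eq_sum_range, Finset.sum_sub_distrib]; simp
  simp only [Finset.sum_neg_distrib, hsum] at h1 h2
  have hsubset : {ω | ρ * a ≤ |totalWeight W a ω - a * m|}
      ⊆ {ω | ρ * a ≤ totalWeight W a ω - a * m} ∪ {ω | ρ * a ≤ -(totalWeight W a ω - a * m)} := by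
    intro ω hω
    have h3 : ρ * a ≤ |totalWeight W a ω - a * m| := hω
    exact le_abs.1 h3
  refine (measureReal_mono hsubset).trans ((measureReal_union_le _ _).trans ?_)
  linarith

/-- Union bound over at most n sums, each with a ≥ y terms. -/
theorem IsWRT.measureReal_compl_goodEvent (h : IsWRT P ν W parent) (hpos : ∀ᵐ w ∂ν, 0 < w)
    (hle : ∀ᵐ w ∂ν, w ≤ 1) {ρ : ℝ} (hρ : 0 ≤ ρ) (y : ℝ) (n : ℕ) :
    P.real (goodEvent W (theta ν - 1) ρ y n)ᶜ ≤ n * (2 * Real.exp (-(2 * ρ ^ 2 * y))) := by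
  classical
  have hsub : (goodEvent W (theta ν - 1) ρ y n)ᶜ ⊆
      ⋃ a ∈ (Finset.Icc 1 n).filter (fun a : ℕ => y ≤ a),
        {ω | ρ * a ≤ |totalWeight W a ω - a * (theta ν - 1)|} := by
    intro ω hω
    simp only [goodEvent, Set.mem_compl_iff, Set.mem_ofPred_eq, not_forall, not_lt] at hω
    obtain ⟨a, ha, hy, hh⟩ := hω
    exact Set.mem_biUnion (Finset.mem_coe.2 (Finset.mem_filter.2 ⟨ha, hy⟩)) hh
  refine (measureReal_mono hsub (measure_ne_top _ _)).trans
    ((measureReal_biUnion_finset_le _ _).trans ?_)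
  have hbd : ∀ a ∈ (Finset.Icc 1 n).filter (fun a : ℕ => y ≤ a),
      P.real {ω | ρ * a ≤ |totalWeight W a ω - a * (theta ν - 1)|}
        ≤ 2 * Real.exp (-(2 * ρ ^ 2 * y)) := by
    intro a ha
    obtain ⟨ha1, ha2⟩ := Finset.mem_filter.1 ha
    refine (h.hoeffding hpos hle hρ (Finset.mem_Icc.1 ha1).1).trans ?_
    gcongr
  refine (Finset.sum_le_card_nsmul _ _ _ hbd).trans ?_
  rw [nsmul_eq_mul]
  gcongr
  refine (Finset.card_filter_le _ _).trans ?_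
  simp

/-- Harmonic sum against logarithm; carrying the extra 1 / N on the left is what makes the induction
close. -/
theorem sum_inv_le {n j : ℕ} (hn : 0 < n) (hj : 0 < j) {N : ℕ} (hN : j ≤ N) :
    ∑ b ∈ Finset.Ico j N, 1 / (b : ℝ) + 1 / N ≤ 1 / j + (logLabel n j - logLabel n N) := by
  induction N, hN using Nat.le_induction with
  | base => simp
  | succ N hN ih =>
    rw [Finset.sum_Ico_succ_top hN]
    have := le_logLabel_sub_succ hn (by omega : 0 < N)
    push_cast
    linarith

theorem le_sum_inv {n j : ℕ} (hn : 0 < n) (hj : 0 < j) {N : ℕ} (hN : j ≤ N) :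
    logLabel n j - logLabel n N ≤ ∑ b ∈ Finset.Ico j N, 1 / (b : ℝ) := by
  induction N, hN using Nat.le_induction with
  | base => simp
  | succ N hN ih =>
    rw [Finset.sum_Ico_succ_top hN]
    have := logLabel_sub_succ_le hn (by omega : 0 < N)
    linarith

variable {m ρ y : ℝ} {n : ℕ} {ω : Ω}

theorem goodEvent_inv_totalWeight_le (hm : 0 < m) (hρm : ρ ≤ m / 2)
    (hω : ω ∈ goodEvent W m ρ y n) {a : ℕ} (ha : a ∈ Finset.Icc 1 n) (hy : y ≤ a) :
    1 / totalWeight W a ω ≤ 1 / m * (1 + 2 * ρ / m) * (1 / a) := by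
  have ha' : (0 : ℝ) < a := by exact_mod_cast (Finset.mem_Icc.1 ha).1
  have h1 := abs_lt.1 (hω a ha hy)
  have hρ : 0 < ρ := by
    have := (abs_nonneg _).trans_lt (hω a ha hy)
    exact pos_of_mul_pos_left this ha'.le
  have h2 : a * (m - ρ) ≤ totalWeight W a ω := by linarith [h1.1]
  have h3 : 0 < a * (m - ρ) := mul_pos ha' (by linarith)
  have h4 : 1 / (m - ρ) ≤ 1 / m * (1 + 2 * ρ / m) := by
    rw [div_le_iff₀ (by linarith)]
    have : 1 / m * (1 + 2 * ρ / m) * (m - ρ) = 1 + ρ * (m - 2 * ρ) / m ^ 2 := by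
      field_simp; ring
    rw [this]
    have : 0 ≤ ρ * (m - 2 * ρ) / m ^ 2 := by
      have : 0 ≤ m - 2 * ρ := by linarith
      positivity
    linarith
  calc 1 / totalWeight W a ω ≤ 1 / (a * (m - ρ)) := one_div_le_one_div_of_le h3 h2
    _ = 1 / (m - ρ) * (1 / a) := by rw [one_div_mul_one_div, mul_comm]
    _ ≤ _ := by gcongr

theorem goodEvent_le_inv_totalWeight (hm : 0 < m) (hρm : ρ ≤ m / 2)
    (hω : ω ∈ goodEvent W m ρ y n) {a : ℕ} (ha : a ∈ Finset.Icc 1 n) (hy : y ≤ a) :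
    1 / m * (1 - ρ / m) * (1 / a) ≤ 1 / totalWeight W a ω := by
  have ha' : (0 : ℝ) < a := by exact_mod_cast (Finset.mem_Icc.1 ha).1
  have h1 := abs_lt.1 (hω a ha hy)
  have hρ : 0 < ρ := by
    have := (abs_nonneg _).trans_lt (hω a ha hy)
    exact pos_of_mul_pos_left this ha'.le
  have h2 : totalWeight W a ω ≤ a * (m + ρ) := by linarith [h1.2]
  have h3 : 0 < totalWeight W a ω := by nlinarith [h1.1]
  have h4 : 1 / m * (1 - ρ / m) ≤ 1 / (m + ρ) := by
    rw [le_div_iff₀ (by linarith)]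
    have : 1 / m * (1 - ρ / m) * (m + ρ) = 1 - ρ ^ 2 / m ^ 2 := by
      field_simp; ring
    rw [this]
    have : 0 ≤ ρ ^ 2 / m ^ 2 := by positivity
    linarith
  calc _ ≤ 1 / (m + ρ) * (1 / a) := by gcongr
    _ = 1 / (a * (m + ρ)) := by rw [one_div_mul_one_div, mul_comm]
    _ ≤ _ := one_div_le_one_div_of_le h3 h2

variable {k : ℕ} {j : Fin k → ℕ}

/-- This is the Poisson parameter of vertex `j i`, which can be chosen only by later vertices. -/
theorem sum_stepProb_eq (hj1 : ∀ i, 1 ≤ j i) (i : Fin k) :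
    ∑ b ∈ Finset.range n, stepProb W j ω b i
      = W (j i) ω * ∑ b ∈ Finset.Ico (j i) n, 1 / totalWeight W b ω := by
  have h1 : ∀ b, stepProb W j ω b i
      = if j i ≤ b then W (j i) ω * (1 / totalWeight W b ω) else 0 := by
    intro b
    simp only [stepProb, Finset.mem_Icc, hj1 i, true_and, totalWeight]
    split_ifs
    · ring
    · rfl
  simp only [h1]
  rw [← Finset.sum_filter, Finset.mul_sum]
  refine Finset.sum_congr ?_ fun _ _ => rfl
  ext b
  simp only [Finset.mem_filter, Finset.mem_range, Finset.mem_Ico]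
  omega

/-- Total weights increase with a, so the worst case is a = `j i`, where the total is at least m * y
/ 2 on the good event. -/
theorem stepProb_le (hm : 0 < m) (hy : 0 < y) (hρm : ρ ≤ m / 2) (hω : ω ∈ goodEvent W m ρ y n)
    (hpos : ∀ i, 1 ≤ i → 0 < W i ω) (hj1 : ∀ i, 1 ≤ j i) (hjn : ∀ i, j i ≤ n)
    (hjy : ∀ i, y ≤ j i) (a : ℕ) (i : Fin k) :
    stepProb W j ω a i ≤ W (j i) ω * (2 / (m * y)) := by
  have hW := hpos _ (hj1 i)
  unfold stepProb
  split_ifs with h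
  · have h1 := abs_lt.1 (hω (j i) (Finset.mem_Icc.2 ⟨hj1 i, hjn i⟩) (hjy i))
    have hji : (0 : ℝ) < j i := by exact_mod_cast hj1 i
    have h2 : m * y / 2 ≤ totalWeight W (j i) ω := by
      nlinarith [mul_le_mul_of_nonneg_right hρm hji.le, mul_le_mul_of_nonneg_left (hjy i) hm.le]
    have h3 : totalWeight W (j i) ω ≤ totalWeight W a ω :=
      Finset.sum_le_sum_of_subset_of_nonneg
        (Finset.Icc_subset_Icc_right (Finset.mem_Icc.1 h).2)
        fun l hl _ => (hpos l (Finset.mem_Icc.1 hl).1).le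
    have h4 : 1 / totalWeight W a ω ≤ 2 / (m * y) := by
      rw [div_le_div_iff₀ (lt_of_lt_of_le (by positivity) (h2.trans h3)) (by positivity)]
      linarith
    calc W (j i) ω / ∑ l ∈ Finset.Icc 1 a, W l ω = W (j i) ω * (1 / totalWeight W a ω) := by
          rw [totalWeight]; ring
      _ ≤ _ := by gcongr
  · positivity

theorem sum_stepProb_le (hm : 0 < m) (hy : 0 < y) (hρm : ρ ≤ m / 2) (hρ : 0 ≤ ρ)
    (hω : ω ∈ goodEvent W m ρ y n)
    (hpos : ∀ i, 1 ≤ i → 0 < W i ω) (hj1 : ∀ i, 1 ≤ j i) (hjn : ∀ i, j i ≤ n)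
    (hjy : ∀ i, y ≤ j i) (i : Fin k) :
    ∑ b ∈ Finset.range n, stepProb W j ω b i
      ≤ W (j i) ω / m * ((1 + 2 * ρ / m) * (logLabel n (j i) + 1 / y)) := by
  have hW := hpos _ (hj1 i)
  have hn : 0 < n := by have := hj1 i; have := hjn i; omega
  have hji : (0 : ℝ) < j i := by exact_mod_cast hj1 i
  rw [sum_stepProb_eq hj1]
  have h1 : ∑ b ∈ Finset.Ico (j i) n, 1 / totalWeight W b ω
      ≤ ∑ b ∈ Finset.Ico (j i) n, 1 / m * (1 + 2 * ρ / m) * (1 / (b : ℝ)) := by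
    refine Finset.sum_le_sum fun b hb => ?_
    have hb' := Finset.mem_Ico.1 hb
    have : (j i : ℝ) ≤ b := by exact_mod_cast hb'.1
    exact goodEvent_inv_totalWeight_le hm hρm hω
      (Finset.mem_Icc.2 ⟨(hj1 i).trans hb'.1, hb'.2.le⟩) ((hjy i).trans this)
  rw [← Finset.mul_sum] at h1
  have h2 := sum_inv_le hn (hj1 i) (hjn i)
  rw [logLabel_self hn] at h2
  have h3 : 1 / (j i : ℝ) ≤ 1 / y := one_div_le_one_div_of_le hy (hjy i)
  have h4 : (0 : ℝ) ≤ 1 / n := by positivity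
  calc W (j i) ω * ∑ b ∈ Finset.Ico (j i) n, 1 / totalWeight W b ω
      ≤ W (j i) ω * (1 / m * (1 + 2 * ρ / m) * (logLabel n (j i) + 1 / y)) := by
        refine mul_le_mul_of_nonneg_left (h1.trans ?_) hW.le
        refine mul_le_mul_of_nonneg_left (by linarith) (by positivity)
    _ = _ := by ring

theorem le_sum_stepProb (hm : 0 < m) (hρm : ρ ≤ m / 2)
    (hω : ω ∈ goodEvent W m ρ y n)
    (hpos : ∀ i, 1 ≤ i → 0 < W i ω) (hj1 : ∀ i, 1 ≤ j i) (hjn : ∀ i, j i ≤ n)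
    (hjy : ∀ i, y ≤ j i) (i : Fin k) :
    W (j i) ω / m * ((1 - ρ / m) * logLabel n (j i))
      ≤ ∑ b ∈ Finset.range n, stepProb W j ω b i := by
  have hW := hpos _ (hj1 i)
  have hn : 0 < n := by have := hj1 i; have := hjn i; omega
  rw [sum_stepProb_eq hj1]
  have h1 : ∑ b ∈ Finset.Ico (j i) n, 1 / m * (1 - ρ / m) * (1 / (b : ℝ))
      ≤ ∑ b ∈ Finset.Ico (j i) n, 1 / totalWeight W b ω := by
    refine Finset.sum_le_sum fun b hb => ?_
    have hb' := Finset.mem_Ico.1 hb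
    have : (j i : ℝ) ≤ b := by exact_mod_cast hb'.1
    exact goodEvent_le_inv_totalWeight hm hρm hω
      (Finset.mem_Icc.2 ⟨(hj1 i).trans hb'.1, hb'.2.le⟩) ((hjy i).trans this)
  rw [← Finset.mul_sum] at h1
  have h2 := le_sum_inv hn (hj1 i) (hjn i)
  rw [logLabel_self hn, sub_zero] at h2
  have h3 : 0 ≤ 1 - ρ / m := by
    have : ρ / m ≤ 1 / 2 := by rw [div_le_div_iff₀ hm (by norm_num)]; linarith
    linarith
  calc W (j i) ω / m * ((1 - ρ / m) * logLabel n (j i))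
      = W (j i) ω * (1 / m * (1 - ρ / m) * logLabel n (j i)) := by ring
    _ ≤ _ := by
        refine mul_le_mul_of_nonneg_left (le_trans ?_ h1) hW.le
        exact mul_le_mul_of_nonneg_left h2 (by positivity)

/-- Upper Poisson weight of a vertex of weight `w` at logarithmic position `s`. -/
def upperWeight (m τ s : ℝ) (d : ℕ) (w : ℝ) : ℝ :=
  Real.exp (-(w / m * (s - τ))) * powFact d (w / m * (s + τ))

/-- Lower Poisson weight of a vertex of weight `w` at logarithmic position `s`. -/
def lowerWeight (m τ s : ℝ) (d : ℕ) (w : ℝ) : ℝ :=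
  Real.exp (-(w / m * (s + τ))) * powFact d (w / m * max (s - τ) 0)

theorem continuous_upperWeight (m τ s : ℝ) (d : ℕ) : Continuous (upperWeight m τ s d) := by
  unfold upperWeight powFact; fun_prop

theorem continuous_lowerWeight (m τ s : ℝ) (d : ℕ) : Continuous (lowerWeight m τ s d) := by
  unfold lowerWeight powFact; fun_prop

theorem upperWeight_nonneg {m τ s w : ℝ} (hm : 0 < m) (hw : 0 ≤ w) (hs : 0 ≤ s) (hτ : 0 ≤ τ)
    (d : ℕ) : 0 ≤ upperWeight m τ s d w :=
  mul_nonneg (Real.exp_pos _).le (powFact_nonneg _ (by positivity))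

theorem lowerWeight_nonneg {m τ s w : ℝ} (hm : 0 < m) (hw : 0 ≤ w)
    (d : ℕ) : 0 ≤ lowerWeight m τ s d w :=
  mul_nonneg (Real.exp_pos _).le (powFact_nonneg _ (by
    have : 0 ≤ max (s - τ) 0 := le_max_right _ _
    positivity))

/-- The truncated parameter in the power is below the one in the exponential. The bound is what
makes the bad event cost no more than its probability. -/
theorem lowerWeight_le_one {m τ s w : ℝ} (hm : 0 < m) (hw : 0 ≤ w) (hs : 0 ≤ s) (hτ : 0 ≤ τ)
    (d : ℕ) : lowerWeight m τ s d w ≤ 1 := by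
  unfold lowerWeight
  rw [Real.exp_neg, inv_mul_le_iff₀ (Real.exp_pos _), mul_one]
  have h0 : 0 ≤ max (s - τ) 0 := le_max_right _ _
  refine (powFact_le_exp d (by positivity)).trans (Real.exp_le_exp.2 ?_)
  refine mul_le_mul_of_nonneg_left (max_le (by linarith) (by linarith)) (by positivity)

/-- On the good event the Poisson parameter lies between (W / m)(s - τ) and (W / m)(s + τ). The
lower end goes into the exponential, the upper end into the power. -/
theorem degreeLaw_le_upperWeight {τ : ℝ} (hm : 0 < m) (hy : 0 < y) (hρm : ρ ≤ m / 2) (hρ : 0 ≤ ρ)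
    (hω : ω ∈ goodEvent W m ρ y n) (hpos : ∀ i, 1 ≤ i → 0 < W i ω) (hle : ∀ i, 1 ≤ i → W i ω ≤ 1)
    (hj1 : ∀ i, 1 ≤ j i) (hjn : ∀ i, j i ≤ n)
    (hjy : ∀ i, y ≤ j i) (hQ : k * (2 / (m * y)) ≤ 1)
    (hτ : 2 * ρ / m * Real.log n + (1 + 2 * ρ / m) / y ≤ τ) (d : Fin k → ℕ) :
    degreeLaw (stepProb W j ω) n d ≤ Real.exp (k * (2 / (m * y)) * ∑ i, (d i : ℝ)) *
      ∏ i, upperWeight m τ (logLabel n (j i)) (d i) (W (j i) ω) := by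
  have hq0 := stepProb_nonneg (j := j) hpos
  have hQs : ∀ a, ∑ i, stepProb W j ω a i ≤ k * (2 / (m * y)) := by
    intro a
    have : ∀ i ∈ Finset.univ, stepProb W j ω a i ≤ 2 / (m * y) := fun i _ => by
      refine (stepProb_le hm hy hρm hω hpos hj1 hjn hjy a i).trans ?_
      exact mul_le_of_le_one_left (by positivity) (hle _ (hj1 i))
    have := Finset.sum_le_card_nsmul _ _ _ this
    simpa using this
  refine (degreeLaw_le _ _ hq0 hQs hQ n d).trans ?_
  refine mul_le_mul_of_nonneg_left ?_ (Real.exp_pos _).le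
  refine Finset.prod_le_prod (fun i _ => ?_) fun i _ => ?_
  · exact mul_nonneg (Real.exp_pos _).le
      (powFact_nonneg _ (Finset.sum_nonneg fun b _ => hq0 b i))
  have hW := hpos _ (hj1 i)
  have hn : 0 < n := by have := hj1 i; have := hjn i; omega
  have hs0 : 0 ≤ logLabel n (j i) := logLabel_nonneg (hj1 i) (hjn i)
  have hji : (1 : ℝ) ≤ j i := by exact_mod_cast hj1 i
  have hsn : logLabel n (j i) ≤ Real.log n := by
    refine Real.log_le_log (by positivity) (div_le_self (by positivity) hji)
  have hup := sum_stepProb_le hm hy hρm hρ hω hpos hj1 hjn hjy i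
  have hlow := le_sum_stepProb hm hρm hω hpos hj1 hjn hjy i
  have hα : 0 ≤ W (j i) ω / m := by positivity
  have hc : 0 ≤ ρ / m := by positivity
  have he : 2 * ρ / m = 2 * (ρ / m) := by ring
  have hcs : ρ / m * logLabel n (j i) ≤ ρ / m * Real.log n := mul_le_mul_of_nonneg_left hsn hc
  have hcs0 : 0 ≤ ρ / m * logLabel n (j i) := by positivity
  have hy1 : 0 ≤ (1 + 2 * ρ / m) / y := by positivity
  refine mul_le_mul (Real.exp_le_exp.2 ?_) (powFact_mono _ (Finset.sum_nonneg fun b _ => hq0 b i) ?_)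
    (powFact_nonneg _ (Finset.sum_nonneg fun b _ => hq0 b i)) (Real.exp_pos _).le
  · refine neg_le_neg (le_trans ?_ hlow)
    refine mul_le_mul_of_nonneg_left ?_ hα
    nlinarith
  · refine hup.trans (mul_le_mul_of_nonneg_left ?_ hα)
    have : (1 + 2 * ρ / m) * (logLabel n (j i) + 1 / y)
      = logLabel n (j i) + 2 * (ρ / m * logLabel n (j i)) + (1 + 2 * ρ / m) / y := by ring
    rw [this]
    nlinarith

/-- The ends of the parameter range swap roles. `hτ1` absorbs the factor 1 + Q in the exponential,
and `hτ2` the shift by the total degree in the power. -/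
theorem lowerWeight_le_degreeLaw {τ : ℝ} (hm : 0 < m) (hy : 0 < y) (hρm : ρ ≤ m / 2) (hρ : 0 ≤ ρ)
    (hω : ω ∈ goodEvent W m ρ y n) (hpos : ∀ i, 1 ≤ i → 0 < W i ω) (hle : ∀ i, 1 ≤ i → W i ω ≤ 1)
    (hj1 : ∀ i, 1 ≤ j i) (hjn : ∀ i, j i ≤ n)
    (hjy : ∀ i, y ≤ j i) (hQ : k * (2 / (m * y)) ≤ 1 / 2) (d : Fin k → ℕ)
    (hτ1 : ((1 + k * (2 / (m * y))) * (1 + 2 * ρ / m) - 1) * Real.log n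
      + (1 + k * (2 / (m * y))) * (1 + 2 * ρ / m) / y ≤ τ)
    (hτ2 : ρ / m * Real.log n + (∑ i, (d i : ℝ)) * (2 / y) ≤ τ) :
    ∏ i, lowerWeight m τ (logLabel n (j i)) (d i) (W (j i) ω)
      ≤ degreeLaw (stepProb W j ω) n d := by
  have hq0 := stepProb_nonneg (j := j) hpos
  have hqm : ∑ i, W (j i) ω * (2 / (m * y)) ≤ k * (2 / (m * y)) := by
    have : ∀ i ∈ Finset.univ, W (j i) ω * (2 / (m * y)) ≤ 2 / (m * y) := fun i _ =>
      mul_le_of_le_one_left (by positivity) (hle _ (hj1 i))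
    have := Finset.sum_le_card_nsmul _ _ _ this
    simpa using this
  refine le_trans ?_ (le_degreeLaw _ (fun i => W (j i) ω * (2 / (m * y))) hq0
    (stepProb_le hm hy hρm hω hpos hj1 hjn hjy) (hqm.trans hQ) n d)
  refine Finset.prod_le_prod (fun i _ => lowerWeight_nonneg hm (hpos _ (hj1 i)).le _) fun i _ => ?_
  set Q := k * (2 / (m * y)) with hQdef
  have hQ0 : 0 ≤ Q := by positivity
  set D := ∑ i, (d i : ℝ) with hD
  have hW := hpos _ (hj1 i)
  have hn : 0 < n := by have := hj1 i; have := hjn i; omega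
  have hs0 : 0 ≤ logLabel n (j i) := logLabel_nonneg (hj1 i) (hjn i)
  have hji : (1 : ℝ) ≤ j i := by exact_mod_cast hj1 i
  have hsn : logLabel n (j i) ≤ Real.log n := by
    refine Real.log_le_log (by positivity) (div_le_self (by positivity) hji)
  have hup := sum_stepProb_le hm hy hρm hρ hω hpos hj1 hjn hjy i
  have hlow := le_sum_stepProb hm hρm hω hpos hj1 hjn hjy i
  have hα : 0 ≤ W (j i) ω / m := by positivity
  have hc : 0 ≤ ρ / m := by positivity
  have h0 : 0 ≤ max (logLabel n (j i) - τ) 0 := le_max_right _ _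
  have hp0 : 0 ≤ ∑ b ∈ Finset.range n, stepProb W j ω b i := Finset.sum_nonneg fun b _ => hq0 b i
  refine mul_le_mul (Real.exp_le_exp.2 ?_) (powFact_mono _ (by positivity) ?_)
    (powFact_nonneg _ (by positivity)) (Real.exp_pos _).le
  · refine neg_le_neg ?_
    calc (1 + ∑ i, W (j i) ω * (2 / (m * y))) * ∑ b ∈ Finset.range n, stepProb W j ω b i
        ≤ (1 + Q) * (W (j i) ω / m * ((1 + 2 * ρ / m) * (logLabel n (j i) + 1 / y))) :=
          mul_le_mul (by linarith) hup hp0 (by positivity)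
      _ = W (j i) ω / m * (logLabel n (j i) +
            (((1 + Q) * (1 + 2 * ρ / m) - 1) * logLabel n (j i)
              + (1 + Q) * (1 + 2 * ρ / m) / y)) := by ring
      _ ≤ _ := by
          refine mul_le_mul_of_nonneg_left ?_ hα
          have h1 : 0 ≤ (1 + Q) * (1 + 2 * ρ / m) - 1 := by
            have : 0 ≤ 2 * ρ / m := by positivity
            nlinarith
          have := mul_le_mul_of_nonneg_left hsn h1
          linarith
  · rw [mul_max_of_nonneg _ _ hα, mul_zero]
    refine max_le_max_right _ ?_
    have h1 : D * (W (j i) ω * (2 / (m * y))) = W (j i) ω / m * (D * (2 / y)) := by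
      field_simp
    rw [h1]
    refine le_trans ?_ (sub_le_sub_right hlow _)
    rw [← mul_sub]
    refine mul_le_mul_of_nonneg_left ?_ hα
    have := mul_le_mul_of_nonneg_left hsn hc
    linarith

theorem exists_bound_of_continuous {g : ℝ → ℝ} (hg : Continuous g) (hpos : ∀ᵐ w ∂ν, 0 < w)
    (hle : ∀ᵐ w ∂ν, w ≤ 1) : ∃ C, 0 ≤ C ∧ ∀ᵐ w ∂ν, |g w| ≤ C := by
  obtain ⟨C, hC⟩ := (isCompact_Icc (a := (0 : ℝ)) (b := 1)).exists_bound_of_continuousOn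
    hg.continuousOn
  refine ⟨C, (norm_nonneg _).trans (hC 0 (by simp)), ?_⟩
  filter_upwards [hpos, hle] with w h1 h2 using hC w ⟨h1.le, h2⟩

theorem integrable_of_continuous {g : ℝ → ℝ} (hg : Continuous g) (hpos : ∀ᵐ w ∂ν, 0 < w)
    (hle : ∀ᵐ w ∂ν, w ≤ 1) : Integrable g ν := by
  obtain ⟨C, _, hC⟩ := exists_bound_of_continuous hg hpos hle
  exact Integrable.of_bound hg.aestronglyMeasurable C (by simpa only [Real.norm_eq_abs] using hC)

/-- Independence of the weights at distinct labels; the index shift matches the family `W (i + 1)`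
in which independence is stated. -/
theorem IsWRT.integral_prod_weight (h : IsWRT P ν W parent) (hj : Function.Injective j)
    (hj1 : ∀ i, 1 ≤ j i) {g : Fin k → ℝ → ℝ} (hg : ∀ i, Continuous (g i)) :
    ∫ ω, ∏ i, g i (W (j i) ω) ∂P = ∏ i, ∫ w, g i w ∂ν := by
  have hinj : Function.Injective fun i => j i - 1 := fun a b hab => hj (by
    have := hj1 a; have := hj1 b; simp only at hab; omega)
  have hind := h.indep_weight.precomp hinj
  have heq : (fun i : Fin k => W (j i - 1 + 1)) = fun i => W (j i) := by
    ext i; rw [Nat.sub_add_cancel (hj1 i)]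
  have hind2 : iIndepFun (fun i => W (j i)) P := by rw [← heq]; exact hind
  rw [hind2.integral_fun_prod_comp (fun i => (h.measurable_weight _ (hj1 i)).aemeasurable)
    fun i => (hg i).aestronglyMeasurable]
  exact Finset.prod_congr rfl fun i _ =>
    h.integral_comp_weight (hj1 i) (hg i).aestronglyMeasurable

theorem IsWRT.integrable_prod_weight (h : IsWRT P ν W parent) (hpos : ∀ᵐ w ∂ν, 0 < w)
    (hle : ∀ᵐ w ∂ν, w ≤ 1) (hj1 : ∀ i, 1 ≤ j i) {g : Fin k → ℝ → ℝ} (hg : ∀ i, Continuous (g i)) :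
    Integrable (fun ω => ∏ i, g i (W (j i) ω)) P := by
  choose C hC0 hC using fun i => exists_bound_of_continuous (hg i) hpos hle
  refine Integrable.of_bound ?_ (∏ i, C i) ?_
  · refine (Finset.measurable_fun_prod _ fun i _ => ?_).aestronglyMeasurable
    exact (hg i).measurable.comp (h.measurable_weight _ (hj1 i))
  · have : ∀ᵐ ω ∂P, ∀ i, |g i (W (j i) ω)| ≤ C i := by
      rw [ae_all_iff]
      intro i
      filter_upwards [h.ae_weight (hC i)] with ω hω using hω _ (hj1 i)
    filter_upwards [this] with ω hω
    rw [Real.norm_eq_abs, Finset.abs_prod]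
    exact Finset.prod_le_prod (fun i _ => abs_nonneg _) fun i _ => hω i

theorem IsWRT.measureReal_degreeEvent_le (h : IsWRT P ν W parent) (hpos : ∀ᵐ w ∂ν, 0 < w)
    (hle : ∀ᵐ w ∂ν, w ≤ 1) {τ : ℝ} (hm : 0 < m) (hy : 0 < y) (hρm : ρ ≤ m / 2) (hρ : 0 ≤ ρ)
    (hτ0 : 0 ≤ τ) (hj : Function.Injective j) (hj1 : ∀ i, 1 ≤ j i) (hjn : ∀ i, j i ≤ n)
    (hjy : ∀ i, y ≤ j i) (hQ : k * (2 / (m * y)) ≤ 1)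
    (hτ : 2 * ρ / m * Real.log n + (1 + 2 * ρ / m) / y ≤ τ) (d : Fin k → ℕ) :
    P.real (goodEvent W m ρ y n ∩ degreeEvent parent n j d)
      ≤ Real.exp (k * (2 / (m * y)) * ∑ i, (d i : ℝ)) *
        ∏ i, ∫ w, upperWeight m τ (logLabel n (j i)) (d i) w ∂ν := by
  have hG := measurableSet_goodEvent (W := W) m ρ y n
  have hGm := h.weightAlg_le _ hG
  rw [h.measureReal_inter_degreeEvent hpos hj n d hG,
    ← h.integral_prod_weight hj hj1 fun i => continuous_upperWeight m τ (logLabel n (j i)) (d i),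
    ← integral_const_mul]
  have hW := h.ae_weight hpos
  have hint := (h.integrable_prod_weight hpos hle hj1 (j := j)
    fun i => continuous_upperWeight m τ (logLabel n (j i)) (d i)).const_mul
      (Real.exp (k * (2 / (m * y)) * ∑ i, (d i : ℝ)))
  have hnn : 0 ≤ᵐ[P] fun ω => Real.exp (k * (2 / (m * y)) * ∑ i, (d i : ℝ)) *
      ∏ i, upperWeight m τ (logLabel n (j i)) (d i) (W (j i) ω) := by
    filter_upwards [hW] with ω hω
    exact mul_nonneg (Real.exp_pos _).le (Finset.prod_nonneg fun i _ =>
      upperWeight_nonneg hm (hω _ (hj1 i)).le (logLabel_nonneg (hj1 i) (hjn i)) hτ0 _)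
  refine le_trans ?_ (setIntegral_le_integral hint hnn (s := goodEvent W m ρ y n))
  refine setIntegral_mono_on_ae ?_ hint.integrableOn hGm ?_
  · refine Integrable.integrableOn (Integrable.of_bound
      ((stronglyMeasurable_degreeLaw n d).mono h.weightAlg_le).aestronglyMeasurable 1 ?_)
    filter_upwards [hW] with ω hω
    rw [Real.norm_eq_abs,
      abs_of_nonneg (degreeLaw_nonneg _ (stepProb_nonneg hω) (sum_stepProb_le_one hj hω) n d)]
    exact degreeLaw_le_one _ (stepProb_nonneg hω) (sum_stepProb_le_one hj hω) n d
  · filter_upwards [hW, h.ae_weight hle] with ω h1 h2 h3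
    exact degreeLaw_le_upperWeight hm hy hρm hρ h3 h1 h2 hj1 hjn hjy hQ hτ d

/-- The product formula needs the integral over the whole space, while the Poisson bound holds on
the good event only. The difference is at most the probability of the complement, as the integrand
is at most 1. -/
theorem IsWRT.le_measureReal_degreeEvent (h : IsWRT P ν W parent) (hpos : ∀ᵐ w ∂ν, 0 < w)
    (hle : ∀ᵐ w ∂ν, w ≤ 1) {τ : ℝ} (hm : 0 < m) (hy : 0 < y) (hρm : ρ ≤ m / 2) (hρ : 0 ≤ ρ)
    (hτ0 : 0 ≤ τ) (hj : Function.Injective j) (hj1 : ∀ i, 1 ≤ j i) (hjn : ∀ i, j i ≤ n)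
    (hjy : ∀ i, y ≤ j i) (hQ : k * (2 / (m * y)) ≤ 1 / 2) (d : Fin k → ℕ)
    (hτ1 : ((1 + k * (2 / (m * y))) * (1 + 2 * ρ / m) - 1) * Real.log n
      + (1 + k * (2 / (m * y))) * (1 + 2 * ρ / m) / y ≤ τ)
    (hτ2 : ρ / m * Real.log n + (∑ i, (d i : ℝ)) * (2 / y) ≤ τ) :
    ∏ i, ∫ w, lowerWeight m τ (logLabel n (j i)) (d i) w ∂ν - P.real (goodEvent W m ρ y n)ᶜ
      ≤ P.real (degreeEvent parent n j d) := by
  have hG := measurableSet_goodEvent (W := W) m ρ y n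
  have hGm := h.weightAlg_le _ hG
  have hW := h.ae_weight hpos
  refine le_trans ?_ (measureReal_mono
    (Set.inter_subset_right : goodEvent W m ρ y n ∩ degreeEvent parent n j d ⊆ _))
  rw [h.measureReal_inter_degreeEvent hpos hj n d hG,
    ← h.integral_prod_weight hj hj1 fun i => continuous_lowerWeight m τ (logLabel n (j i)) (d i)]
  have hint := h.integrable_prod_weight hpos hle hj1 (j := j)
    fun i => continuous_lowerWeight m τ (logLabel n (j i)) (d i)
  have h1 : ∫ ω in (goodEvent W m ρ y n)ᶜ,
        ∏ i, lowerWeight m τ (logLabel n (j i)) (d i) (W (j i) ω) ∂P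
      ≤ P.real (goodEvent W m ρ y n)ᶜ := by
    have : ∫ ω in (goodEvent W m ρ y n)ᶜ,
        ∏ i, lowerWeight m τ (logLabel n (j i)) (d i) (W (j i) ω) ∂P
        ≤ ∫ ω in (goodEvent W m ρ y n)ᶜ, (1 : ℝ) ∂P := by
      refine setIntegral_mono_on_ae hint.integrableOn (integrable_const _).integrableOn hGm.compl ?_
      filter_upwards [hW] with ω hω _
      exact Finset.prod_le_one (fun i _ => lowerWeight_nonneg hm (hω _ (hj1 i)).le _)
        fun i _ => lowerWeight_le_one hm (hω _ (hj1 i)).le (logLabel_nonneg (hj1 i) (hjn i)) hτ0 _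
    simpa using this
  rw [← integral_add_compl hGm hint]
  have h2 : ∫ ω in goodEvent W m ρ y n,
        ∏ i, lowerWeight m τ (logLabel n (j i)) (d i) (W (j i) ω) ∂P
      ≤ ∫ ω in goodEvent W m ρ y n, degreeLaw (stepProb W j ω) n d ∂P := by
    refine setIntegral_mono_on_ae hint.integrableOn ?_ hGm ?_
    · refine Integrable.integrableOn (Integrable.of_bound
        ((stronglyMeasurable_degreeLaw n d).mono h.weightAlg_le).aestronglyMeasurable 1 ?_)
      filter_upwards [hW] with ω hω
      rw [Real.norm_eq_abs,
        abs_of_nonneg (degreeLaw_nonneg _ (stepProb_nonneg hω) (sum_stepProb_le_one hj hω) n d)]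
      exact degreeLaw_le_one _ (stepProb_nonneg hω) (sum_stepProb_le_one hj hω) n d
    · filter_upwards [hW, h.ae_weight hle] with ω h1 h2 h3
      exact lowerWeight_le_degreeLaw hm hy hρm hρ h3 h1 h2 hj1 hjn hjy hQ d hτ1 hτ2
  linarith

end Concentration

/-! ### Sums over injective tuples. -/

section Sums

theorem sum_piFinset_succ {k : ℕ} (S : Fin (k + 1) → Finset ℕ) (F : (Fin (k + 1) → ℕ) → ℝ) :
    ∑ x ∈ Fintype.piFinset S, F x
      = ∑ x ∈ Fintype.piFinset (fun i : Fin k => S i.succ), ∑ a ∈ S 0,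
          F (Fin.cons (α := fun _ => ℕ) a x) := by
  rw [← Finset.sum_product']
  symm
  refine Finset.sum_bij' (fun p _ => Fin.cons (α := fun _ => ℕ) p.2 p.1)
    (fun x _ => (Fin.tail x, x 0)) ?_ ?_ ?_ ?_ ?_
  · rintro ⟨x, a⟩ hp
    simp only [Finset.mem_product, Fintype.mem_piFinset] at hp ⊢
    refine Fin.cases ?_ fun i => ?_
    · simpa using hp.2
    · simpa using hp.1 i
  · intro x hx
    simp only [Finset.mem_product, Fintype.mem_piFinset] at hx ⊢
    exact ⟨fun i => hx i.succ, hx 0⟩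
  · rintro ⟨x, a⟩ _
    simp
  · intro x _
    simp
  · intro p _
    rfl

/-- Summing a product over injective tuples loses little if no single term dominates. -/
theorem le_sum_injective {K : ℕ} {μ : ℝ} (hμ : 0 ≤ μ) (hK : K * μ ≤ 1) {k : ℕ} (hkK : k ≤ K)
    (S : Fin k → Finset ℕ) (f : Fin k → ℕ → ℝ) (hf0 : ∀ i, ∀ a ∈ S i, 0 ≤ f i a)
    (hf : ∀ i, ∀ a ∈ S i, f i a ≤ μ * ∑ b ∈ S i, f i b) :
    (1 - K * μ) ^ k * ∏ i, ∑ a ∈ S i, f i a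
      ≤ ∑ x ∈ (Fintype.piFinset S).filter Function.Injective, ∏ i, f i (x i) := by
  classical
  -- K stays fixed while k varies, so every coordinate loses the same factor.
  induction k with
  | zero =>
    have : (Fintype.piFinset S).filter Function.Injective = Finset.univ := by
      ext x; simp [Function.injective_of_subsingleton]
    rw [this]; simp
  | succ k ih =>
    have ih' := ih (by omega) (fun i => S i.succ) (fun i => f i.succ)
      (fun i => hf0 i.succ) (fun i => hf i.succ)
    set B := ∑ a ∈ S 0, f 0 a with hB
    have hB0 : 0 ≤ B := Finset.sum_nonneg (hf0 0)
    rw [Finset.sum_filter, sum_piFinset_succ, Fin.prod_univ_succ, ← hB]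
    rw [Finset.sum_filter] at ih'
    have hkey : ∀ x ∈ Fintype.piFinset (fun i : Fin k => S i.succ),
        (1 - K * μ) * B * (if Function.Injective x then ∏ i, f i.succ (x i) else 0)
          ≤ ∑ a ∈ S 0, if Function.Injective (Fin.cons (α := fun _ => ℕ) a x)
            then ∏ i, f i ((Fin.cons (α := fun _ => ℕ) a x : Fin (k + 1) → ℕ) i) else 0 := by
      intro x hx
      rw [Fintype.mem_piFinset] at hx
      simp only [Fin.prod_univ_succ, Fin.cons_zero, Fin.cons_succ, Fin.cons_injective_iff]
      by_cases hinj : Function.Injective x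
      · simp only [hinj, and_true, if_true]
        have hprod : 0 ≤ ∏ i, f i.succ (x i) :=
          Finset.prod_nonneg fun i _ => hf0 i.succ _ (hx i)
        rw [← Finset.sum_filter, ← Finset.sum_mul]
        refine mul_le_mul_of_nonneg_right ?_ hprod
        have hsplit := Finset.sum_filter_add_sum_filter_not (S 0) (fun a => a ∉ Set.range x) (f 0)
        -- At most k values collide with the other coordinates, each carrying at most a fraction μ
        -- of the total B.
        have hbad : ∑ a ∈ (S 0).filter (fun a => ¬ a ∉ Set.range x), f 0 a ≤ K * (μ * B) := by
          have h1 : ∀ a ∈ (S 0).filter (fun a => ¬ a ∉ Set.range x), f 0 a ≤ μ * B := fun a ha =>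
            hf 0 a (Finset.mem_filter.1 ha).1
          refine (Finset.sum_le_card_nsmul _ _ _ h1).trans ?_
          rw [nsmul_eq_mul]
          refine mul_le_mul_of_nonneg_right ?_ (mul_nonneg hμ hB0)
          have h2 : (S 0).filter (fun a => ¬ a ∉ Set.range x) ⊆ Finset.univ.image x := by
            intro a ha
            have := (Finset.mem_filter.1 ha).2
            rw [not_not] at this
            obtain ⟨i, rfl⟩ := this
            exact Finset.mem_image_of_mem x (Finset.mem_univ i)
          have h3 := (Finset.card_le_card h2).trans Finset.card_image_le
          rw [Finset.card_univ, Fintype.card_fin] at h3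
          exact_mod_cast h3.trans (by omega)
        rw [← hB] at hsplit
        nlinarith
      · simp [hinj]
    refine le_trans ?_ (Finset.sum_le_sum hkey)
    rw [← Finset.mul_sum]
    refine le_trans (le_of_eq ?_) (mul_le_mul_of_nonneg_left ih' (mul_nonneg (by linarith) hB0))
    ring

end Sums

/-! ### From label sums to the factor for exact degrees. -/

section Factors

variable {ν : Measure ℝ} [IsProbabilityMeasure ν] {m τ κ ℓ : ℝ} {n d : ℕ}

theorem continuous_incGamma (d : ℕ) (L : ℝ) : Continuous fun u => incGamma u d L := by
  unfold incGamma
  apply intervalIntegral.continuous_parametric_intervalIntegral_of_continuous'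
  fun_prop

/-- The contribution of weight `w` to `exactFactor`. -/
def exactDensity (m : ℝ) (d : ℕ) (L w : ℝ) : ℝ :=
  powFact d (w / m) * incGamma (1 + w / m) d L

theorem continuous_exactDensity (m : ℝ) (d : ℕ) (L : ℝ) : Continuous (exactDensity m d L) := by
  unfold exactDensity powFact
  have := continuous_incGamma d L
  fun_prop

theorem exactFactor_eq (hpos : ∀ᵐ w ∂ν, 0 < w) (hle : ∀ᵐ w ∂ν, w ≤ 1) (n d : ℕ) {ℓ : ℝ}
    (hL : 0 ≤ Real.log (n / ℓ)) :
    exactFactor ν n d ℓ = ∫ w, exactDensity (theta ν - 1) d (Real.log (n / ℓ)) w ∂ν := by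
  refine integral_congr_ae ?_
  filter_upwards [hpos] with w hw
  exact exact_integrand_eq ν (theta_sub_one_pos hpos hle) n d hw.le hL

theorem exactFactor_nonneg (hpos : ∀ᵐ w ∂ν, 0 < w) (hle : ∀ᵐ w ∂ν, w ≤ 1) (n d : ℕ) {ℓ : ℝ}
    (hL : 0 ≤ Real.log (n / ℓ)) : 0 ≤ exactFactor ν n d ℓ := by
  rw [exactFactor_eq hpos hle n d hL]
  have hm := theta_sub_one_pos hpos hle
  refine integral_nonneg_of_ae ?_
  filter_upwards [hpos] with w hw
  exact mul_nonneg (powFact_nonneg _ (by positivity)) (incGamma_nonneg _ _ hL)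

/-- Integrate `sum_label_le` with α = w / m over the weight; w ≤ 1 allows A = 1 / m for all weights.
-/
theorem sum_upperWeight_le (hpos : ∀ᵐ w ∂ν, 0 < w) (hle : ∀ᵐ w ∂ν, w ≤ 1) (hn : 0 < n) (hℓ : 2 ≤ ℓ)
    (hτ : 2 / ℓ ≤ τ) (hκ : 0 < κ) (hL : κ ≤ Real.log (n / ℓ)) :
    ∑ a ∈ Finset.Ioc ⌊ℓ⌋₊ n, 1 / (n : ℝ) * ∫ w, upperWeight (theta ν - 1) τ (logLabel n a) d w ∂ν
      ≤ Real.exp ((2 + 3 * (1 / (theta ν - 1)) + 4 / κ) * τ * (d + 1)) * exactFactor ν n d ℓ := by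
  rw [exactFactor_eq hpos hle n d (hκ.le.trans hL)]
  have hm := theta_sub_one_pos hpos hle
  set m := theta ν - 1
  simp only [← integral_const_mul]
  have hint : ∀ a, Integrable (fun w => 1 / (n : ℝ) * upperWeight m τ (logLabel n a) d w) ν :=
    fun a => (integrable_of_continuous (continuous_upperWeight _ _ _ _) hpos hle).const_mul _
  rw [← integral_finsetSum _ fun a _ => hint a]
  refine integral_mono_ae (integrable_finsetSum _ fun a _ => hint a)
    ((integrable_of_continuous (continuous_exactDensity _ _ _) hpos hle).const_mul _) ?_
  filter_upwards [hpos, hle] with w h0 h1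
  have hα : 0 ≤ w / m := by positivity
  have hαA : w / m ≤ 1 / m := by gcongr
  have h := sum_label_le d hn hℓ hτ hα hαA hκ hL
  have h2 := mul_le_mul_of_nonneg_left h (powFact_nonneg d hα)
  rw [Finset.mul_sum] at h2
  refine le_trans (le_of_eq (Finset.sum_congr rfl fun a _ => ?_)) (h2.trans (le_of_eq ?_))
  · simp only [upperWeight, powFact, mul_pow]; ring
  · simp only [exactDensity]; ring

theorem le_sum_lowerWeight (hpos : ∀ᵐ w ∂ν, 0 < w) (hle : ∀ᵐ w ∂ν, w ≤ 1) (hn : 0 < n) (hℓ : 2 ≤ ℓ)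
    (hτ : 2 / ℓ ≤ τ) (hκ : 0 < κ) (hL : κ ≤ Real.log (n / ℓ)) (hτκ : 4 * τ ≤ κ) :
    Real.exp (-((2 + 3 * (1 / (theta ν - 1)) + 4 / κ) * τ * (d + 1))) * exactFactor ν n d ℓ ≤
    ∑ a ∈ Finset.Ioc ⌊ℓ⌋₊ n,
      1 / (n : ℝ) * ∫ w, lowerWeight (theta ν - 1) τ (logLabel n a) d w ∂ν := by
  rw [exactFactor_eq hpos hle n d (hκ.le.trans hL)]
  have hm := theta_sub_one_pos hpos hle
  set m := theta ν - 1
  simp only [← integral_const_mul]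
  have hint : ∀ a, Integrable (fun w => 1 / (n : ℝ) * lowerWeight m τ (logLabel n a) d w) ν :=
    fun a => (integrable_of_continuous (continuous_lowerWeight _ _ _ _) hpos hle).const_mul _
  rw [← integral_finsetSum _ fun a _ => hint a]
  refine integral_mono_ae
    ((integrable_of_continuous (continuous_exactDensity _ _ _) hpos hle).const_mul _)
    (integrable_finsetSum _ fun a _ => hint a) ?_
  filter_upwards [hpos, hle] with w h0 h1
  have hα : 0 ≤ w / m := by positivity
  have hαA : w / m ≤ 1 / m := by gcongr
  have h := le_sum_label d hn hℓ hτ hα hαA hκ hL hτκ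
  have h2 := mul_le_mul_of_nonneg_left h (powFact_nonneg d hα)
  rw [Finset.mul_sum] at h2
  refine le_trans (le_of_eq ?_) (h2.trans (le_of_eq (Finset.sum_congr rfl fun a _ => ?_)))
  · simp only [exactDensity]; ring
  · simp only [lowerWeight, powFact, mul_pow]; ring

theorem lowerWeight_term_le (hpos : ∀ᵐ w ∂ν, 0 < w) (hle : ∀ᵐ w ∂ν, w ≤ 1) (hℓ : 2 ≤ ℓ)
    (hτ : 0 ≤ τ) (hκ : 0 < κ) (hL : κ ≤ Real.log (n / ℓ)) {a : ℕ} (ha : a ∈ Finset.Ioc ⌊ℓ⌋₊ n) :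
    1 / (n : ℝ) * ∫ w, lowerWeight (theta ν - 1) τ (logLabel n a) d w ∂ν
      ≤ Real.exp ((1 + 1 / (theta ν - 1)) * κ) * (d + 1) / (κ * ℓ) * exactFactor ν n d ℓ := by
  rw [exactFactor_eq hpos hle n d (hκ.le.trans hL)]
  have hm := theta_sub_one_pos hpos hle
  set m := theta ν - 1
  have hℓ0 : 0 < ℓ := by linarith
  obtain ⟨ha1, ha2⟩ := Finset.mem_Ioc.1 ha
  have hla : ℓ < a := (Nat.floor_lt hℓ0.le).1 ha1
  rw [← integral_const_mul, ← integral_const_mul]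
  refine integral_mono_ae
    ((integrable_of_continuous (continuous_lowerWeight _ _ _ _) hpos hle).const_mul _)
    ((integrable_of_continuous (continuous_exactDensity _ _ _) hpos hle).const_mul _) ?_
  filter_upwards [hpos, hle] with w h0 h1
  have hα : 0 ≤ w / m := by positivity
  have hαA : w / m ≤ 1 / m := by gcongr
  have h := label_term_le (A := 1 / m) d (by omega : 0 < a) ha2 hℓ0 hla hα hαA hτ hκ hL
  have hF := incGamma_nonneg (1 + w / m) d (hκ.le.trans hL)
  have h3 : Real.exp ((1 + 1 / m) * κ) * (d + 1) / (κ * a)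
      ≤ Real.exp ((1 + 1 / m) * κ) * (d + 1) / (κ * ℓ) := by gcongr
  have h2 := mul_le_mul_of_nonneg_left (h.trans (mul_le_mul_of_nonneg_right h3 hF))
    (powFact_nonneg d hα)
  refine le_trans (le_of_eq ?_) (h2.trans (le_of_eq ?_))
  · simp only [lowerWeight, powFact, mul_pow]; ring
  · simp only [exactDensity]; ring

end Factors

/-! ### Uniform sampling without replacement as an average over injective tuples. -/

section Sampling

set_option linter.unusedSectionVars false

variable {Ω : Type*} [mΩ : MeasurableSpace Ω] {P : Measure Ω} [IsProbabilityMeasure P]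
  {ν : Measure ℝ} [IsProbabilityMeasure ν] {W : ℕ → Ω → ℝ} {parent : ℕ → Ω → ℕ}
  {k n : ℕ} {v : Ω → Fin k → ℕ}

/-- The `k`-tuples of distinct vertices of `[n]`. -/
def vertexTuples (k n : ℕ) : Finset (Fin k → ℕ) :=
  (Fintype.piFinset fun _ : Fin k => Finset.Icc 1 n).filter Function.Injective

theorem mem_vertexTuples {j : Fin k → ℕ} :
    j ∈ vertexTuples k n ↔ (∀ i, j i ∈ Finset.Icc 1 n) ∧ Function.Injective j := by
  simp [vertexTuples, Fintype.mem_piFinset]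

theorem card_vertexTuples (k n : ℕ) : (vertexTuples k n).card = n.descFactorial k := by
  have h : (Finset.univ : Finset (Fin k ↪ Finset.Icc 1 n)).card = n.descFactorial k := by
    rw [Finset.card_univ, Fintype.card_embedding_eq]; simp
  rw [← h]
  symm
  refine Finset.card_bij (fun e _ => fun i => (e i : ℕ)) ?_ ?_ ?_
  · intro e _
    exact mem_vertexTuples.2 ⟨fun i => (e i).2, Subtype.val_injective.comp e.injective⟩
  · intro e _ e' _ hee
    ext i
    exact congrFun hee i
  · intro j hj
    obtain ⟨h1, h2⟩ := mem_vertexTuples.1 hj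
    exact ⟨⟨fun i => ⟨j i, h1 i⟩, fun a b hab => h2 (congrArg Subtype.val hab)⟩, Finset.mem_univ _,
      rfl⟩

theorem IsUniformSample.ae_mem (h : IsUniformSample P W parent n v) (hkn : k ≤ n) :
    ∀ᵐ ω ∂P, v ω ∈ vertexTuples k n := by
  have hmeas : ∀ j, MeasurableSet {ω | v ω = j} := fun j => h.measurable (MeasurableSet.singleton j)
  have hset : {ω | v ω ∈ vertexTuples k n} = ⋃ j ∈ vertexTuples k n, {ω | v ω = j} := by
    ext ω; simp
  have hm : MeasurableSet {ω | v ω ∈ vertexTuples k n} := by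
    rw [hset]; exact Finset.measurableSet_biUnion _ fun j _ => hmeas j
  have htot : P.real {ω | v ω ∈ vertexTuples k n} = 1 := by
    rw [hset, measureReal_biUnion_finset]
    · have : ∀ j ∈ vertexTuples k n, P.real {ω | v ω = j} = 1 / (n.descFactorial k : ℝ) :=
        fun j hj => h.law j (mem_vertexTuples.1 hj).2 (mem_vertexTuples.1 hj).1
      rw [Finset.sum_congr rfl this, Finset.sum_const, card_vertexTuples, nsmul_eq_mul,
        mul_one_div_cancel]
      have := Nat.descFactorial_pos.2 hkn
      positivity
    · intro a _ b _ hab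
      exact Set.disjoint_left.2 fun ω h1 h2 => hab (h1.symm.trans h2)
    · exact fun i _ => hmeas i
  rw [measureReal_def, ENNReal.toReal_eq_one_iff] at htot
  exact (prob_compl_eq_zero_iff hm).2 htot

/-- The probability that the sampled tuple `v` lies in the event attached to it. -/
theorem IsUniformSample.measureReal_eq (h : IsUniformSample P W parent n v)
    (hw : IsWRT P ν W parent) (hkn : k ≤ n) (E : (Fin k → ℕ) → Set Ω)
    (hE : ∀ j, MeasurableSet[history W parent n] (E j)) :
    P.real {ω | ω ∈ E (v ω)}
      = 1 / (n.descFactorial k : ℝ) * ∑ j ∈ vertexTuples k n, P.real (E j) := by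
  have hmeas : ∀ j, MeasurableSet {ω | v ω = j} := fun j => h.measurable (MeasurableSet.singleton j)
  have hset : {ω | ω ∈ E (v ω)} =ᵐ[P] ⋃ j ∈ vertexTuples k n, ({ω | v ω = j} ∩ E j : Set Ω) := by
    filter_upwards [h.ae_mem hkn] with ω hω
    refine propext ?_
    change ω ∈ E (v ω) ↔ ω ∈ ⋃ j ∈ vertexTuples k n, ({ω | v ω = j} ∩ E j : Set Ω)
    constructor
    · intro h1
      exact Set.mem_biUnion (Finset.mem_coe.2 hω) ⟨rfl, h1⟩
    · intro h1
      obtain ⟨j, _, h2, h3⟩ := Set.mem_iUnion₂.1 h1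
      have h4 : v ω = j := h2
      rwa [h4]
  rw [measureReal_congr hset, measureReal_biUnion_finset, Finset.mul_sum]
  · refine Finset.sum_congr rfl fun j hj => ?_
    have hind : P ({ω | v ω = j} ∩ E j) = P {ω | v ω = j} * P (E j) :=
      (Indep_iff _ _ _).1 h.indep _ _ ⟨{j}, MeasurableSet.singleton j, rfl⟩ (hE j)
    rw [measureReal_def, hind, ENNReal.toReal_mul, ← measureReal_def, ← measureReal_def,
      h.law j (mem_vertexTuples.1 hj).2 (mem_vertexTuples.1 hj).1]
  · intro a _ b _ hab
    exact Set.disjoint_left.2 fun ω h1 h2 => hab (h1.1.symm.trans h2.1)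
  · exact fun j _ => (hmeas j).inter (hw.history_le n _ (hE j))

/-- For ℓ ≥ 0 an integer label exceeds ℓ exactly when it exceeds its floor, and it is then
automatically at least 1. -/
theorem filter_vertexTuples {ℓ : Fin k → ℝ} (hℓ : ∀ i, 0 ≤ ℓ i) [DecidablePred fun j : Fin k → ℕ =>
      ∀ i, ℓ i < (j i : ℝ)] :
    (vertexTuples k n).filter (fun j => ∀ i, ℓ i < (j i : ℝ))
      = (Fintype.piFinset fun i => Finset.Ioc ⌊ℓ i⌋₊ n).filter Function.Injective := by
  ext j
  simp only [Finset.mem_filter, mem_vertexTuples, Fintype.mem_piFinset, Finset.mem_Icc,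
    Finset.mem_Ioc, ← Nat.floor_lt (hℓ _)]
  constructor
  · rintro ⟨⟨h1, h2⟩, h3⟩
    exact ⟨fun i => ⟨h3 i, (h1 i).2⟩, h2⟩
  · rintro ⟨h1, h2⟩
    exact ⟨⟨fun i => ⟨by have := (h1 i).1; omega, (h1 i).2⟩, h2⟩, fun i => (h1 i).1⟩

theorem IsUniformSample.measureReal_label_eq (h : IsUniformSample P W parent n v)
    (hw : IsWRT P ν W parent) (hkn : k ≤ n) {ℓ : Fin k → ℝ} (hℓ : ∀ i, 0 ≤ ℓ i)
    (E : (Fin k → ℕ) → Set Ω) (hE : ∀ j, MeasurableSet[history W parent n] (E j)) :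
    P.real {ω | ω ∈ E (v ω) ∧ ∀ i, ℓ i < (v ω i : ℝ)}
      = 1 / (n.descFactorial k : ℝ) *
        ∑ j ∈ (Fintype.piFinset fun i => Finset.Ioc ⌊ℓ i⌋₊ n).filter Function.Injective,
          P.real (E j) := by
  classical
  have h1 := h.measureReal_eq hw hkn (fun j => if ∀ i, ℓ i < (j i : ℝ) then E j else ∅) (by
    intro j
    split_ifs
    · exact hE j
    · exact @MeasurableSet.empty _ (history W parent n))
  have h2 : {ω | ω ∈ E (v ω) ∧ ∀ i, ℓ i < (v ω i : ℝ)}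
      = {ω | ω ∈ (fun j => if ∀ i, ℓ i < (j i : ℝ) then E j else ∅) (v ω)} := by
    ext ω
    simp only [Set.mem_ofPred_eq]
    split_ifs with h3 <;> simp [h3]
  rw [h2, h1, ← filter_vertexTuples hℓ, Finset.sum_filter]
  congr 1
  refine Finset.sum_congr rfl fun j _ => ?_
  split_ifs <;> simp

end Sampling

/-! ### Bounds for the sampled degrees at a fixed n. -/

section FiniteBounds

set_option linter.unusedSectionVars false

/-- The relations between the error scales that the estimates at a fixed `n` need. -/
structure ScaleBounds (m κ ρ y τ : ℝ) (k n : ℕ) : Prop where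
  n_pos : 0 < n
  k_le : k ≤ n
  two_le : 2 ≤ y
  rho_nonneg : 0 ≤ ρ
  rho_le : ρ ≤ m / 2
  two_div_le : 2 / y ≤ τ
  tau_le : 4 * τ ≤ κ
  step_le : k * (2 / (m * y)) ≤ 1 / 2
  drift_le : ((1 + k * (2 / (m * y))) * (1 + 2 * ρ / m) - 1) * Real.log n
      + (1 + k * (2 / (m * y))) * (1 + 2 * ρ / m) / y ≤ τ

/-- The rate at which the multiplicative errors grow with the degree. -/
def errorRate (m κ : ℝ) : ℝ := 2 + 3 * (1 / m) + 4 / κ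

theorem errorRate_pos {m κ : ℝ} (hm : 0 < m) (hκ : 0 < κ) : 0 < errorRate m κ := by
  unfold errorRate; positivity

variable {Ω : Type*} [mΩ : MeasurableSpace Ω] {P : Measure Ω} [IsProbabilityMeasure P]
  {ν : Measure ℝ} [IsProbabilityMeasure ν] {W : ℕ → Ω → ℝ} {parent : ℕ → Ω → ℕ}
  {k n : ℕ} {v : Ω → Fin k → ℕ} {κ ρ y τ : ℝ}

/-- Dropping injectivity turns the sum over tuples into a product of label sums. No bound on the
degrees is assumed and the error stays exponential in each degree, so that the estimate can be
summed over whole tails. -/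
theorem measureReal_good_degrees_le (hpos : ∀ᵐ w ∂ν, 0 < w) (hle : ∀ᵐ w ∂ν, w ≤ 1)
    (hw : IsWRT P ν W parent) (hv : IsUniformSample P W parent n v) (hκ : 0 < κ)
    (hs : ScaleBounds (theta ν - 1) κ ρ y τ k n) (d : Fin k → ℕ) (ℓ : Fin k → ℝ)
    (hℓ : ∀ i, y ≤ ℓ i) (hL : ∀ i, κ ≤ Real.log (n / ℓ i)) :
    P.real {ω | ω ∈ goodEvent W (theta ν - 1) ρ y n ∩ degreeEvent parent n (v ω) d ∧
        ∀ i, ℓ i < (v ω i : ℝ)}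
      ≤ (n : ℝ) ^ k / n.descFactorial k *
        ∏ i, (Real.exp ((k * (2 / ((theta ν - 1) * y)) + errorRate (theta ν - 1) κ * τ) *
          (d i + 1)) * exactFactor ν n (d i) (ℓ i)) := by
  have hm := theta_sub_one_pos hpos hle
  set m := theta ν - 1 with hmdef
  have hy := hs.two_le
  have hy0 : 0 < y := by linarith
  have hn := hs.n_pos
  have hn' : (0 : ℝ) < n := by positivity
  have hτ0 : 0 ≤ τ := le_trans (by positivity) hs.two_div_le
  set Q := k * (2 / (m * y)) with hQ
  have hQ0 : 0 ≤ Q := by positivity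
  rw [hv.measureReal_label_eq hw hs.k_le (fun i => hy0.le.trans (hℓ i))
    (fun j => goodEvent W m ρ y n ∩ degreeEvent parent n j d)
    (fun j => (weightAlg_le_history n _ (measurableSet_goodEvent m ρ y n)).inter
      (measurableSet_degrees n j d))]
  have hdrift : 2 * ρ / m * Real.log n + (1 + 2 * ρ / m) / y ≤ τ := by
    refine le_trans ?_ hs.drift_le
    have h1 : 0 ≤ 2 * ρ / m := by have := hs.rho_nonneg; positivity
    have h2 : 1 + 2 * ρ / m ≤ (1 + Q) * (1 + 2 * ρ / m) := by nlinarith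
    have h3 : 0 ≤ Real.log n := Real.log_natCast_nonneg n
    have h4 : (1 + 2 * ρ / m) / y ≤ (1 + Q) * (1 + 2 * ρ / m) / y := by gcongr
    have h5 := mul_le_mul_of_nonneg_right (by linarith : 2 * ρ / m ≤ (1 + Q) * (1 + 2 * ρ / m) - 1) h3
    linarith
  have hterm : ∀ j ∈ (Fintype.piFinset fun i => Finset.Ioc ⌊ℓ i⌋₊ n).filter Function.Injective,
      P.real (goodEvent W m ρ y n ∩ degreeEvent parent n j d)
        ≤ Real.exp (Q * ∑ i, (d i : ℝ)) *
          ∏ i, ∫ w, upperWeight m τ (logLabel n (j i)) (d i) w ∂ν := by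
    intro j hj
    obtain ⟨hj1, hj2⟩ := Finset.mem_filter.1 hj
    rw [Fintype.mem_piFinset] at hj1
    have hj3 : ∀ i, ℓ i < j i := fun i =>
      (Nat.floor_lt (hy0.le.trans (hℓ i))).1 (Finset.mem_Ioc.1 (hj1 i)).1
    refine hw.measureReal_degreeEvent_le hpos hle hm hy0 hs.rho_le hs.rho_nonneg hτ0 hj2
      (fun i => ?_) (fun i => (Finset.mem_Ioc.1 (hj1 i)).2) (fun i => (hℓ i).trans (hj3 i).le)
      (hs.step_le.trans (by norm_num)) hdrift d
    have := (Finset.mem_Ioc.1 (hj1 i)).1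
    omega
  have hU0 : ∀ i, ∀ a ∈ Finset.Ioc ⌊ℓ i⌋₊ n,
      0 ≤ ∫ w, upperWeight m τ (logLabel n a) (d i) w ∂ν := by
    intro i a ha
    refine integral_nonneg_of_ae ?_
    filter_upwards [hpos] with w hw0
    refine upperWeight_nonneg hm hw0.le (logLabel_nonneg ?_ (Finset.mem_Ioc.1 ha).2) hτ0 _
    have := (Finset.mem_Ioc.1 ha).1
    omega
  have hsum : ∑ j ∈ (Fintype.piFinset fun i => Finset.Ioc ⌊ℓ i⌋₊ n).filter Function.Injective,
      P.real (goodEvent W m ρ y n ∩ degreeEvent parent n j d)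
      ≤ Real.exp (Q * ∑ i, (d i : ℝ)) * ∏ i, ∑ a ∈ Finset.Ioc ⌊ℓ i⌋₊ n,
          ∫ w, upperWeight m τ (logLabel n a) (d i) w ∂ν := by
    refine (Finset.sum_le_sum hterm).trans ?_
    rw [← Finset.mul_sum, Finset.prod_univ_sum]
    refine mul_le_mul_of_nonneg_left ?_ (Real.exp_pos _).le
    refine Finset.sum_le_sum_of_subset_of_nonneg (Finset.filter_subset _ _) fun j hj _ => ?_
    exact Finset.prod_nonneg fun i _ => hU0 i _ (Fintype.mem_piFinset.1 hj i)
  have hone : ∀ i, ∑ a ∈ Finset.Ioc ⌊ℓ i⌋₊ n, ∫ w, upperWeight m τ (logLabel n a) (d i) w ∂ν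
      ≤ n * (Real.exp (errorRate m κ * τ * (d i + 1)) * exactFactor ν n (d i) (ℓ i)) := by
    intro i
    have h1 := sum_upperWeight_le (ν := ν) (d := d i) hpos hle hn (hy.trans (hℓ i))
      (le_trans (by gcongr; exact hℓ i) hs.two_div_le) hκ (hL i)
    rw [← Finset.mul_sum] at h1
    rw [one_div, inv_mul_le_iff₀ hn'] at h1
    exact h1
  have hexp : Real.exp (Q * ∑ i, (d i : ℝ)) ≤ ∏ i, Real.exp (Q * (d i + 1)) := by
    rw [← Real.exp_sum, ← Finset.mul_sum]
    refine Real.exp_le_exp.2 (mul_le_mul_of_nonneg_left ?_ hQ0)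
    exact Finset.sum_le_sum fun i _ => by linarith
  have hdf : (0 : ℝ) < n.descFactorial k := by
    exact_mod_cast Nat.descFactorial_pos.2 hs.k_le
  have hX0 : ∀ i, 0 ≤ exactFactor ν n (d i) (ℓ i) := fun i =>
    exactFactor_nonneg hpos hle n (d i) (hκ.le.trans (hL i))
  calc _ ≤ 1 / (n.descFactorial k : ℝ) * ((∏ i, Real.exp (Q * (d i + 1))) *
        ∏ i, (n * (Real.exp (errorRate m κ * τ * (d i + 1)) * exactFactor ν n (d i) (ℓ i)))) := by
        refine mul_le_mul_of_nonneg_left (hsum.trans ?_) (by positivity)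
        refine mul_le_mul hexp (Finset.prod_le_prod (fun i _ => Finset.sum_nonneg (hU0 i))
          fun i _ => hone i) (Finset.prod_nonneg fun i _ => Finset.sum_nonneg (hU0 i))
          (Finset.prod_nonneg fun i _ => (Real.exp_pos _).le)
    _ = (n : ℝ) ^ k / n.descFactorial k * ((∏ i, Real.exp (Q * (d i + 1))) *
        ∏ i, ((Real.exp (errorRate m κ * τ * (d i + 1)) * exactFactor ν n (d i) (ℓ i)))) := by
        rw [Finset.prod_mul_distrib (f := fun _ : Fin k => (n : ℝ))]
        simp only [Finset.prod_const, Finset.card_univ, Fintype.card_fin]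
        ring
    _ = _ := by
        rw [← Finset.prod_mul_distrib]
        congr 1
        refine Finset.prod_congr rfl fun i _ => ?_
        rw [← mul_assoc, ← Real.exp_add]
        congr 2
        ring

/-- Here injectivity must be kept, and μ bounds the share of the mass of a single label. The bad
event is subtracted once per tuple, hence at most once after averaging. -/
theorem le_measureReal_degrees (hpos : ∀ᵐ w ∂ν, 0 < w) (hle : ∀ᵐ w ∂ν, w ≤ 1)
    (hw : IsWRT P ν W parent) (hv : IsUniformSample P W parent n v) (hκ : 0 < κ)
    (hs : ScaleBounds (theta ν - 1) κ ρ y τ k n) (d : Fin k → ℕ) (ℓ : Fin k → ℝ)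
    (hℓ : ∀ i, y ≤ ℓ i) (hL : ∀ i, κ ≤ Real.log (n / ℓ i))
    (hτ2 : ρ / (theta ν - 1) * Real.log n + (∑ i, (d i : ℝ)) * (2 / y) ≤ τ)
    {μ : ℝ} (hμ0 : 0 ≤ μ) (hμ1 : k * μ ≤ 1)
    (hμ : ∀ i, Real.exp ((1 + 1 / (theta ν - 1)) * κ) * (d i + 1) / (κ * y) *
      Real.exp (errorRate (theta ν - 1) κ * τ * (d i + 1)) ≤ μ) :
    (1 - k * μ) ^ k * ∏ i, (Real.exp (-(errorRate (theta ν - 1) κ * τ * (d i + 1))) *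
        exactFactor ν n (d i) (ℓ i)) - P.real (goodEvent W (theta ν - 1) ρ y n)ᶜ
      ≤ P.real {ω | ω ∈ degreeEvent parent n (v ω) d ∧ ∀ i, ℓ i < (v ω i : ℝ)} := by
  have hm := theta_sub_one_pos hpos hle
  set m := theta ν - 1 with hmdef
  have hy := hs.two_le
  have hy0 : 0 < y := by linarith
  have hn := hs.n_pos
  have hn' : (0 : ℝ) < n := by positivity
  have hτ0 : 0 ≤ τ := le_trans (by positivity) hs.two_div_le
  rw [hv.measureReal_label_eq hw hs.k_le (fun i => hy0.le.trans (hℓ i))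
    (fun j => degreeEvent parent n j d) (fun j => measurableSet_degrees n j d)]
  set T := (Fintype.piFinset fun i => Finset.Ioc ⌊ℓ i⌋₊ n).filter Function.Injective with hT
  set g : Fin k → ℕ → ℝ := fun i a => ∫ w, lowerWeight m τ (logLabel n a) (d i) w ∂ν with hg
  set p := P.real (goodEvent W m ρ y n)ᶜ with hp
  have hterm : ∀ j ∈ T, ∏ i, g i (j i) - p ≤ P.real (degreeEvent parent n j d) := by
    intro j hj
    obtain ⟨hj1, hj2⟩ := Finset.mem_filter.1 hj
    rw [Fintype.mem_piFinset] at hj1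
    have hj3 : ∀ i, ℓ i < j i := fun i =>
      (Nat.floor_lt (hy0.le.trans (hℓ i))).1 (Finset.mem_Ioc.1 (hj1 i)).1
    refine hw.le_measureReal_degreeEvent hpos hle hm hy0 hs.rho_le hs.rho_nonneg hτ0 hj2
      (fun i => ?_) (fun i => (Finset.mem_Ioc.1 (hj1 i)).2) (fun i => (hℓ i).trans (hj3 i).le)
      hs.step_le d hs.drift_le hτ2
    have := (Finset.mem_Ioc.1 (hj1 i)).1
    omega
  have hg0 : ∀ i a, 0 ≤ g i a := by
    intro i a
    refine integral_nonneg_of_ae ?_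
    filter_upwards [hpos] with w hw0 using lowerWeight_nonneg hm hw0.le _
  have hX0 : ∀ i, 0 ≤ exactFactor ν n (d i) (ℓ i) := fun i =>
    exactFactor_nonneg hpos hle n (d i) (hκ.le.trans (hL i))
  have hB : ∀ i, Real.exp (-(errorRate m κ * τ * (d i + 1))) * exactFactor ν n (d i) (ℓ i)
      ≤ ∑ a ∈ Finset.Ioc ⌊ℓ i⌋₊ n, 1 / (n : ℝ) * g i a := fun i =>
    le_sum_lowerWeight hpos hle hn (hy.trans (hℓ i))
      (le_trans (by gcongr; exact hℓ i) hs.two_div_le) hκ (hL i) hs.tau_le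
  have hmax : ∀ i, ∀ a ∈ Finset.Ioc ⌊ℓ i⌋₊ n, 1 / (n : ℝ) * g i a
      ≤ μ * ∑ b ∈ Finset.Ioc ⌊ℓ i⌋₊ n, 1 / (n : ℝ) * g i b := by
    intro i a ha
    have h1 := lowerWeight_term_le (ν := ν) (d := d i) hpos hle (hy.trans (hℓ i)) hτ0 hκ (hL i) ha
    rw [← hmdef] at h1
    have h2 : Real.exp ((1 + 1 / m) * κ) * (d i + 1) / (κ * ℓ i)
        ≤ Real.exp ((1 + 1 / m) * κ) * (d i + 1) / (κ * y) := by
      gcongr; exact hℓ i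
    calc 1 / (n : ℝ) * g i a
        ≤ Real.exp ((1 + 1 / m) * κ) * (d i + 1) / (κ * y) * exactFactor ν n (d i) (ℓ i) :=
          h1.trans (mul_le_mul_of_nonneg_right h2 (hX0 i))
      _ = Real.exp ((1 + 1 / m) * κ) * (d i + 1) / (κ * y) *
          Real.exp (errorRate m κ * τ * (d i + 1)) *
          (Real.exp (-(errorRate m κ * τ * (d i + 1))) * exactFactor ν n (d i) (ℓ i)) := by
          have : Real.exp (errorRate m κ * τ * (d i + 1)) *
            Real.exp (-(errorRate m κ * τ * (d i + 1))) = 1 := by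
            rw [← Real.exp_add]; simp
          linear_combination (-(Real.exp ((1 + 1 / m) * κ) * (d i + 1) / (κ * y) *
            exactFactor ν n (d i) (ℓ i))) * this
      _ ≤ _ := mul_le_mul (hμ i) (hB i) (mul_nonneg (Real.exp_pos _).le (hX0 i)) hμ0
  have hinj := le_sum_injective hμ0 hμ1 le_rfl (fun i => Finset.Ioc ⌊ℓ i⌋₊ n)
    (fun i a => 1 / (n : ℝ) * g i a) (fun i a _ => mul_nonneg (by positivity) (hg0 i a)) hmax
  have hdf : (0 : ℝ) < n.descFactorial k := by
    exact_mod_cast Nat.descFactorial_pos.2 hs.k_le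
  have hdfn : (n.descFactorial k : ℝ) ≤ (n : ℝ) ^ k := by
    exact_mod_cast Nat.descFactorial_le_pow n k
  have hcard : (T.card : ℝ) ≤ n.descFactorial k := by
    rw [← card_vertexTuples]
    refine Nat.cast_le.2 (Finset.card_le_card fun j hj => ?_)
    obtain ⟨hj1, hj2⟩ := Finset.mem_filter.1 hj
    rw [Fintype.mem_piFinset] at hj1
    refine mem_vertexTuples.2 ⟨fun i => ?_, hj2⟩
    have := Finset.mem_Ioc.1 (hj1 i)
    exact Finset.mem_Icc.2 ⟨by omega, this.2⟩
  have hS0 : 0 ≤ ∑ j ∈ T, ∏ i, g i (j i) :=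
    Finset.sum_nonneg fun j _ => Finset.prod_nonneg fun i _ => hg0 i _
  have hsc : ∑ j ∈ T, ∏ i, (1 / (n : ℝ) * g i (j i))
      ≤ 1 / (n.descFactorial k : ℝ) * ∑ j ∈ T, ∏ i, g i (j i) := by
    have : ∑ j ∈ T, ∏ i, (1 / (n : ℝ) * g i (j i))
        = 1 / (n : ℝ) ^ k * ∑ j ∈ T, ∏ i, g i (j i) := by
      rw [Finset.mul_sum]
      refine Finset.sum_congr rfl fun j _ => ?_
      rw [Finset.prod_mul_distrib]
      simp
    rw [this]
    exact mul_le_mul_of_nonneg_right (one_div_le_one_div_of_le hdf hdfn) hS0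
  have hlow : 1 / (n.descFactorial k : ℝ) * ∑ j ∈ T, (∏ i, g i (j i) - p)
      ≤ 1 / (n.descFactorial k : ℝ) * ∑ j ∈ T, P.real (degreeEvent parent n j d) :=
    mul_le_mul_of_nonneg_left (Finset.sum_le_sum hterm) (by positivity)
  refine le_trans ?_ hlow
  rw [Finset.sum_sub_distrib, Finset.sum_const, nsmul_eq_mul, mul_sub]
  refine sub_le_sub ?_ ?_
  · refine le_trans ?_ (hinj.trans hsc)
    refine mul_le_mul_of_nonneg_left (Finset.prod_le_prod (fun i _ =>
      mul_nonneg (Real.exp_pos _).le (hX0 i)) fun i _ => hB i) ?_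
    exact pow_nonneg (by linarith) _
  · rw [← mul_assoc]
    refine mul_le_of_le_one_left measureReal_nonneg ?_
    rw [one_div, inv_mul_le_iff₀ hdf, mul_one]
    exact hcard

/-- A crude bound from weights above 1/2 and the integral up to κ. Losing exp(-O(d²)) is harmless
against a bad event of stretched exponential probability. -/
theorem le_exactFactor (hpos : ∀ᵐ w ∂ν, 0 < w) (hle : ∀ᵐ w ∂ν, w ≤ 1) (hκ : 0 < κ) (hκ1 : κ ≤ 1)
    (d : ℕ) {ℓ : ℝ} (hL : κ ≤ Real.log (n / ℓ)) :
    ν.real (Set.Ioi (1 / 2)) * Real.exp (-(1 + 1 / (theta ν - 1))) *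
        Real.exp (-(2 / κ * (d + 1) + (d + 1) ^ 2)) ≤ exactFactor ν n d ℓ := by
  rw [exactFactor_eq hpos hle n d (hκ.le.trans hL)]
  have hm := theta_sub_one_pos hpos hle
  have hm1 := theta_sub_one_le hpos hle
  set m := theta ν - 1
  set b := Real.exp (-(1 + 1 / m)) * Real.exp (-(2 / κ * (d + 1) + (d + 1) ^ 2)) with hb
  have h1 : ν.real (Set.Ioi (1 / 2)) * b
      = ∫ w, (Set.Ioi (1 / 2 : ℝ)).indicator (fun _ => b) w ∂ν := by
    rw [integral_indicator_const _ measurableSet_Ioi, smul_eq_mul]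
  rw [mul_assoc, ← hb, h1]
  refine integral_mono_ae ((integrable_const _).indicator measurableSet_Ioi)
    (integrable_of_continuous (continuous_exactDensity _ _ _) hpos hle) ?_
  filter_upwards [hpos, hle] with w h0 hw1
  have hα : 0 ≤ w / m := by positivity
  have hnn : 0 ≤ exactDensity m d (Real.log (n / ℓ)) w :=
    mul_nonneg (powFact_nonneg _ hα) (incGamma_nonneg _ _ (hκ.le.trans hL))
  by_cases hmem : w ∈ Set.Ioi (1 / 2 : ℝ)
  · rw [Set.indicator_of_mem hmem]
    have hw2 : 1 / 2 < w := hmem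
    -- The mean weight m is at most 1.
    have hα2 : 1 / 2 ≤ w / m := by rw [le_div_iff₀ hm]; linarith
    have hαA : w / m ≤ 1 / m := by gcongr
    have h2 := le_incGamma (u := 1 + w / m) (by linarith) d hκ.le hL
    have h3 : powFact d (1 / 2) ≤ powFact d (w / m) := powFact_mono d (by norm_num) hα2
    have h4 : Real.exp (-(1 + 1 / m)) ≤ Real.exp (-((1 + w / m) * κ)) := by
      refine Real.exp_le_exp.2 (neg_le_neg ?_)
      calc (1 + w / m) * κ ≤ (1 + w / m) * 1 := by gcongr
        _ ≤ _ := by linarith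
    have hfac : ((d + 1).factorial : ℝ) ≤ Real.exp ((d + 1) ^ 2) := by
      have h5 : ((d + 1).factorial : ℝ) ≤ ((d : ℝ) + 1) ^ (d + 1) := by
        exact_mod_cast Nat.factorial_le_pow (d + 1)
      refine h5.trans ?_
      have h6 : (d : ℝ) + 1 ≤ Real.exp (d + 1) := by linarith [Real.add_one_le_exp ((d : ℝ) + 1)]
      refine (pow_le_pow_left₀ (by positivity) h6 _).trans (le_of_eq ?_)
      rw [← Real.exp_nat_mul]; push_cast; congr 1; ring
    have hpow : Real.exp (-(2 / κ * (d + 1))) ≤ (κ / 2) ^ (d + 1) := by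
      have h7 : Real.exp (-(2 / κ)) ≤ κ / 2 := by
        rw [Real.exp_neg, inv_le_comm₀ (Real.exp_pos _) (by positivity), inv_div]
        linarith [Real.add_one_le_exp (2 / κ)]
      refine le_trans (le_of_eq ?_) (pow_le_pow_left₀ (Real.exp_pos _).le h7 (d + 1))
      rw [← Real.exp_nat_mul]; push_cast; congr 1; ring
    calc b = Real.exp (-(1 + 1 / m)) *
          (Real.exp (-(2 / κ * (d + 1))) * (Real.exp ((d + 1) ^ 2))⁻¹) := by
          rw [hb, ← Real.exp_neg, ← Real.exp_add (-(2 / κ * (d + 1)))]; congr 2; ring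
      _ ≤ Real.exp (-((1 + w / m) * κ)) * ((κ / 2) ^ (d + 1) * (((d + 1).factorial : ℝ))⁻¹) := by
          gcongr
      _ ≤ Real.exp (-((1 + w / m) * κ)) * (κ ^ (d + 1) * (1 / 2) ^ d *
            (((d + 1).factorial : ℝ))⁻¹) := by
          gcongr
          rw [div_pow, div_eq_mul_one_div, ← one_div_pow]
          gcongr ?_ * ?_
          exact pow_le_pow_of_le_one (by norm_num) (by norm_num) (Nat.le_succ d)
      _ = powFact d (1 / 2) * (Real.exp (-((1 + w / m) * κ)) * (κ ^ (d + 1) / (d + 1))) := by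
          rw [powFact, Nat.factorial_succ]; push_cast; field_simp
      _ ≤ powFact d (w / m) * incGamma (1 + w / m) d (Real.log (n / ℓ)) :=
          mul_le_mul h3 h2 (by positivity) (powFact_nonneg _ hα)
  · rw [Set.indicator_of_notMem hmem]; exact hnn

theorem measureReal_Ioi_half_pos
    (hsup : sSup {x : ℝ | 0 < x ∧ ν (Set.Iic x) < 1} = 1) : 0 < ν.real (Set.Ioi (1 / 2)) := by
  have hne : {x : ℝ | 0 < x ∧ ν (Set.Iic x) < 1}.Nonempty := by
    by_contra h
    rw [Set.not_nonempty_iff_eq_empty] at h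
    rw [h, Real.sSup_empty] at hsup
    norm_num at hsup
  obtain ⟨x, ⟨_, hx⟩, hx2⟩ := exists_lt_of_lt_csSup hne (show (1 / 2 : ℝ) < _ by rw [hsup]; norm_num)
  have h1 : ν (Set.Iic (1 / 2)) < 1 :=
    (measure_mono (Set.Iic_subset_Iic.2 hx2.le)).trans_lt hx
  rw [measureReal_def, ENNReal.toReal_pos_iff]
  refine ⟨?_, measure_lt_top _ _⟩
  rw [← Set.compl_Iic, prob_compl_eq_one_sub measurableSet_Iic]
  exact tsub_pos_of_lt h1

end FiniteBounds

/-! ### Geometric summation over the degree. -/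

section TailFactor

set_option linter.unusedSectionVars false

variable {ν : Measure ℝ} [IsProbabilityMeasure ν] {n : ℕ} {ℓ : ℝ}

theorem gammaProb_nonneg (ν : Measure ℝ) (n : ℕ) (ℓ r w : ℝ) : 0 ≤ gammaProb ν n ℓ r w :=
  measureReal_nonneg

theorem gammaProb_antitone (hm : 0 < theta ν - 1) (hL : 0 ≤ Real.log (n / ℓ)) {w : ℝ} (hw : 0 ≤ w)
    {d d' : ℕ} (hd : d ≤ d') : gammaProb ν n ℓ (d' + 1) w ≤ gammaProb ν n ℓ (d + 1) w := by
  have hx : 0 ≤ (1 + w / (theta ν - 1)) * Real.log (n / ℓ) := by positivity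
  exact gammaMeasure_real_Iio_antitone hx hd

/-- The integrand of `exactFactor`. -/
def exactIntegrand (ν : Measure ℝ) (n d : ℕ) (ℓ w : ℝ) : ℝ :=
  (theta ν - 1) / (theta ν - 1 + w) * (w / (theta ν - 1 + w)) ^ d * gammaProb ν n ℓ (d + 1) w

theorem integrable_exactIntegrand (hpos : ∀ᵐ w ∂ν, 0 < w) (hle : ∀ᵐ w ∂ν, w ≤ 1) (d : ℕ)
    (hL : 0 ≤ Real.log (n / ℓ)) : Integrable (exactIntegrand ν n d ℓ) ν := by
  refine (integrable_of_continuous (continuous_exactDensity (theta ν - 1) d (Real.log (n / ℓ)))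
    hpos hle).congr ?_
  filter_upwards [hpos] with w hw
  exact (exact_integrand_eq ν (theta_sub_one_pos hpos hle) n d hw.le hL).symm

/-- The tail integrand is (m + w) / m times the exact one, hence agrees for w > 0 with a continuous
function. -/
theorem integrable_tail_integrand (hpos : ∀ᵐ w ∂ν, 0 < w) (hle : ∀ᵐ w ∂ν, w ≤ 1) (d : ℕ)
    (hL : 0 ≤ Real.log (n / ℓ)) :
    Integrable (fun w => (w / (theta ν - 1 + w)) ^ d * gammaProb ν n ℓ (d + 1) w) ν := by
  have hm := theta_sub_one_pos hpos hle
  have hc : Continuous fun w =>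
      (1 + w / (theta ν - 1)) * exactDensity (theta ν - 1) d (Real.log (n / ℓ)) w := by
    have := continuous_exactDensity (theta ν - 1) d (Real.log (n / ℓ))
    fun_prop
  refine (integrable_of_continuous hc hpos hle).congr ?_
  filter_upwards [hpos] with w hw
  have h := exact_integrand_eq ν hm n d hw.le hL
  rw [exactDensity, ← h]
  set m := theta ν - 1
  have : 0 < m + w := by linarith
  field_simp

theorem tailFactor_nonneg (hpos : ∀ᵐ w ∂ν, 0 < w) (hle : ∀ᵐ w ∂ν, w ≤ 1) (n d : ℕ) (ℓ r : ℝ) :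
    0 ≤ tailFactor ν n d ℓ r := by
  have hm := theta_sub_one_pos hpos hle
  refine integral_nonneg_of_ae ?_
  filter_upwards [hpos] with w hw
  exact mul_nonneg (pow_nonneg (div_nonneg hw.le (by linarith)) _) (gammaProb_nonneg _ _ _ _ _)

theorem exactFactor_le_tailFactor (hpos : ∀ᵐ w ∂ν, 0 < w) (hle : ∀ᵐ w ∂ν, w ≤ 1) (d : ℕ)
    (hL : 0 ≤ Real.log (n / ℓ)) : exactFactor ν n d ℓ ≤ tailFactor ν n d ℓ (d + 1) := by
  have hm := theta_sub_one_pos hpos hle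
  refine integral_mono_ae (integrable_exactIntegrand hpos hle d hL)
    (integrable_tail_integrand hpos hle d hL) ?_
  filter_upwards [hpos] with w hw
  have hmw : 0 < theta ν - 1 + w := by linarith
  refine mul_le_mul_of_nonneg_right ?_ (gammaProb_nonneg _ _ _ _ _)
  refine mul_le_of_le_one_left (by positivity) ?_
  rw [div_le_one hmw]; linarith

/-- The success probability `w / (θ - 1 + w)` is at most `θ⁻¹`. -/
theorem ratio_le_inv_theta (hm : 0 < theta ν - 1) {w : ℝ} (hw : 0 < w) (hw1 : w ≤ 1) :
    w / (theta ν - 1 + w) ≤ (theta ν)⁻¹ := by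
  have hθ : 0 < theta ν := by linarith
  rw [← one_div, div_le_div_iff₀ (by linarith) hθ]
  nlinarith

/-- The Gamma probability is largest at the smallest degree. What remains is a geometric series of
ratio r e^β, where e^β is the relative error gained per unit of degree. -/
theorem sum_exactFactor_le (hpos : ∀ᵐ w ∂ν, 0 < w) (hle : ∀ᵐ w ∂ν, w ≤ 1) (d N : ℕ)
    (hL : 0 ≤ Real.log (n / ℓ)) {β : ℝ} (hβ : 0 ≤ β) (hβθ : (theta ν)⁻¹ * Real.exp β < 1) :
    ∑ e ∈ Finset.Ico d N, Real.exp (β * (e + 1)) * exactFactor ν n e ℓ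
      ≤ Real.exp (β * (d + 1)) * ((1 - (theta ν)⁻¹) / (1 - (theta ν)⁻¹ * Real.exp β)) *
        tailFactor ν n d ℓ (d + 1) := by
  have hm := theta_sub_one_pos hpos hle
  have h1 : ∀ e : ℕ, Real.exp (β * (e + 1)) * exactFactor ν n e ℓ
      = ∫ w, Real.exp (β * (e + 1)) * exactIntegrand ν n e ℓ w ∂ν := fun e => by
    rw [integral_const_mul]; rfl
  have hint : ∀ e : ℕ, Integrable (fun w => Real.exp (β * (e + 1)) * exactIntegrand ν n e ℓ w) ν :=
    fun e => (integrable_exactIntegrand hpos hle e hL).const_mul _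
  rw [Finset.sum_congr rfl fun e _ => h1 e, ← integral_finsetSum _ fun e _ => hint e, tailFactor,
    ← integral_const_mul]
  refine integral_mono_ae (integrable_finsetSum _ fun e _ => hint e)
    ((integrable_tail_integrand hpos hle d hL).const_mul _) ?_
  filter_upwards [hpos, hle] with w hw hw1
  have hr0 := ratio_le_inv_theta hm hw hw1
  set r := w / (theta ν - 1 + w) with hr
  set q := (theta ν)⁻¹ with hq
  have hmw : 0 < theta ν - 1 + w := by linarith
  have hr1 : (theta ν - 1) / (theta ν - 1 + w) = 1 - r := by rw [hr]; field_simp; ring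
  have hrn : 0 ≤ r := by positivity
  have hE : 1 ≤ Real.exp β := Real.one_le_exp hβ
  have hrE : r * Real.exp β < 1 := lt_of_le_of_lt (by gcongr) hβθ
  have hrE0 : 0 ≤ r * Real.exp β := by positivity
  have hr2 : 0 ≤ 1 - r := by nlinarith
  have hgeo := geom_sum_Ico_le_of_lt_one hrE0 hrE (m := d) (n := N)
  have hG := gammaProb_nonneg ν n ℓ (d + 1) w
  calc ∑ e ∈ Finset.Ico d N, Real.exp (β * (e + 1)) * exactIntegrand ν n e ℓ w
      ≤ ∑ e ∈ Finset.Ico d N, (1 - r) * Real.exp β * gammaProb ν n ℓ (d + 1) w *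
          (r * Real.exp β) ^ e := by
        refine Finset.sum_le_sum fun e he => ?_
        have hG2 := gammaProb_antitone hm hL hw.le (Finset.mem_Ico.1 he).1
        have h3 : Real.exp (β * (e + 1)) = Real.exp β * Real.exp β ^ e := by
          rw [← Real.exp_nat_mul, ← Real.exp_add]; congr 1; ring
        rw [exactIntegrand, hr1, ← hr, h3, mul_pow]
        calc _ = (1 - r) * Real.exp β * (r ^ e * Real.exp β ^ e) * gammaProb ν n ℓ (e + 1) w := by
              ring
          _ ≤ (1 - r) * Real.exp β * (r ^ e * Real.exp β ^ e) * gammaProb ν n ℓ (d + 1) w := by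
              gcongr
          _ = _ := by ring
    _ ≤ (1 - r) * Real.exp β * gammaProb ν n ℓ (d + 1) w *
          ((r * Real.exp β) ^ d / (1 - r * Real.exp β)) := by
        rw [← Finset.mul_sum]
        gcongr
    _ = Real.exp (β * (d + 1)) * ((1 - r) / (1 - r * Real.exp β)) *
          (r ^ d * gammaProb ν n ℓ (d + 1) w) := by
        have h3 : Real.exp (β * (d + 1)) = Real.exp β * Real.exp β ^ d := by
          rw [← Real.exp_nat_mul, ← Real.exp_add]; congr 1; ring
        rw [h3, mul_pow]; ring
    _ ≤ _ := by
        gcongr ?_ * ?_ * ?_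
        -- (1 - r) / (1 - r e^β) increases with r, so r may be replaced by its bound θ⁻¹.
        rw [div_le_div_iff₀ (by linarith) (by linarith)]
        nlinarith

/-- The Gamma probability is smallest at the last degree d + f, which is the origin of the shifted
shape in the lower tail bound. The geometric sum over the window is r^d (1 - r^(f+1)). -/
theorem le_sum_exactFactor (hpos : ∀ᵐ w ∂ν, 0 < w) (hle : ∀ᵐ w ∂ν, w ≤ 1) (d f : ℕ)
    (hL : 0 ≤ Real.log (n / ℓ)) :
    (1 - (theta ν)⁻¹ ^ (f + 1)) * tailFactor ν n d ℓ ((d + f : ℕ) + 1)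
      ≤ ∑ e ∈ Finset.Ico d (d + f + 1), exactFactor ν n e ℓ := by
  have hm := theta_sub_one_pos hpos hle
  have hint : ∀ e : ℕ, Integrable (exactIntegrand ν n e ℓ) ν :=
    fun e => integrable_exactIntegrand hpos hle e hL
  have h1 : ∑ e ∈ Finset.Ico d (d + f + 1), exactFactor ν n e ℓ
      = ∫ w, ∑ e ∈ Finset.Ico d (d + f + 1), exactIntegrand ν n e ℓ w ∂ν := by
    rw [integral_finsetSum _ fun e _ => hint e]; rfl
  have hq1 : (theta ν)⁻¹ ≤ 1 := inv_le_one_of_one_le₀ (by linarith)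
  have hq0 : 0 ≤ (theta ν)⁻¹ := inv_nonneg.2 (by linarith)
  rw [h1, tailFactor, ← integral_const_mul]
  refine integral_mono_of_nonneg ?_ (integrable_finsetSum _ fun e _ => hint e) ?_
  · filter_upwards [hpos] with w hw
    refine mul_nonneg (sub_nonneg.2 (pow_le_one₀ hq0 hq1)) ?_
    exact mul_nonneg (pow_nonneg (div_nonneg hw.le (by linarith)) _) (gammaProb_nonneg _ _ _ _ _)
  filter_upwards [hpos, hle] with w hw hw1
  have hr0 := ratio_le_inv_theta hm hw hw1
  set r := w / (theta ν - 1 + w) with hr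
  have hmw : 0 < theta ν - 1 + w := by linarith
  have hr1 : (theta ν - 1) / (theta ν - 1 + w) = 1 - r := by rw [hr]; field_simp; ring
  have hrn : 0 ≤ r := by positivity
  have hr2 : 0 ≤ 1 - r := by linarith
  have hG := gammaProb_nonneg ν n ℓ ((d + f : ℕ) + 1) w
  have hgeo : (1 - r) * ∑ e ∈ Finset.Ico d (d + f + 1), r ^ e = r ^ d * (1 - r ^ (f + 1)) := by
    rw [Finset.sum_Ico_eq_sum_range, show d + f + 1 - d = f + 1 by omega]
    simp only [pow_add]
    rw [← Finset.mul_sum]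
    have := mul_neg_geom_sum r (f + 1)
    simp only [pow_add] at this
    linear_combination (r ^ d) * this
  calc (1 - (theta ν)⁻¹ ^ (f + 1)) * (r ^ d * gammaProb ν n ℓ ((d + f : ℕ) + 1) w)
      ≤ (1 - r ^ (f + 1)) * (r ^ d * gammaProb ν n ℓ ((d + f : ℕ) + 1) w) := by
        gcongr
    _ = ∑ e ∈ Finset.Ico d (d + f + 1),
          (1 - r) * r ^ e * gammaProb ν n ℓ ((d + f : ℕ) + 1) w := by
        rw [← Finset.sum_mul, ← Finset.mul_sum, hgeo]; ring
    _ ≤ _ := by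
        refine Finset.sum_le_sum fun e he => ?_
        have hG2 := gammaProb_antitone hm hL hw.le
          (show e ≤ d + f from by have := (Finset.mem_Ico.1 he).2; omega)
        rw [exactIntegrand, hr1]
        gcongr

end TailFactor

/-! ### Tail events decomposed into exact-degree events. -/

section SampleEvents

set_option linter.unusedSectionVars false

variable {Ω : Type*} [mΩ : MeasurableSpace Ω] {P : Measure Ω} [IsProbabilityMeasure P]
  {ν : Measure ℝ} [IsProbabilityMeasure ν] {W : ℕ → Ω → ℝ} {parent : ℕ → Ω → ℕ}
  {k n : ℕ} {v : Ω → Fin k → ℕ}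

/-- The sampled vertices have degrees `d` and labels above `ℓ`. -/
def sampleEvent (parent : ℕ → Ω → ℕ) (n : ℕ) (v : Ω → Fin k → ℕ) (d : Fin k → ℕ) (ℓ : Fin k → ℝ) :
    Set Ω :=
  {ω | ω ∈ degreeEvent parent n (v ω) d ∧ ∀ i, ℓ i < (v ω i : ℝ)}

/-- The sampled vertices have degrees at least `d` and labels above `ℓ`. -/
def sampleTailEvent (parent : ℕ → Ω → ℕ) (n : ℕ) (v : Ω → Fin k → ℕ) (d : Fin k → ℕ)
    (ℓ : Fin k → ℝ) : Set Ω :=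
  {ω | ∀ i, d i ≤ inDegree parent n (v ω i) ω ∧ ℓ i < (v ω i : ℝ)}

theorem measurableSet_sampleEvent (h : IsUniformSample P W parent n v)
    (hw : IsWRT P ν W parent) (d : Fin k → ℕ) (ℓ : Fin k → ℝ) :
    MeasurableSet (sampleEvent parent n v d ℓ) := by
  have : sampleEvent parent n v d ℓ = ⋃ j : Fin k → ℕ,
      ({ω | v ω = j} ∩ degreeEvent parent n j d ∩ {_ω | ∀ i, ℓ i < (j i : ℝ)} : Set Ω) := by
    ext ω
    simp [sampleEvent]
  rw [this]
  refine MeasurableSet.iUnion fun j => ((h.measurable (MeasurableSet.singleton j)).inter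
    (hw.history_le n _ (measurableSet_degrees n j d))).inter (MeasurableSet.const _)

theorem inDegree_le (n i : ℕ) (ω : Ω) : inDegree parent n i ω < n + 1 := by
  unfold inDegree
  refine Nat.lt_succ_of_le ((Finset.card_filter_le _ _).trans ?_)
  simp

/-- The complement of G is split off before decomposing by degree, so its probability enters once
and not once for each degree vector. -/
theorem measureReal_sampleTailEvent_le (d : Fin k → ℕ) (ℓ : Fin k → ℝ) (G : Set Ω) :
    P.real (sampleTailEvent parent n v d ℓ) ≤ P.real Gᶜ +
      ∑ e ∈ Fintype.piFinset fun i => Finset.Ico (d i) (n + 1),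
        P.real {ω | ω ∈ G ∩ degreeEvent parent n (v ω) e ∧ ∀ i, ℓ i < (v ω i : ℝ)} := by
  have hsub : sampleTailEvent parent n v d ℓ ⊆ Gᶜ ∪
      ⋃ e ∈ Fintype.piFinset fun i => Finset.Ico (d i) (n + 1),
        {ω | ω ∈ G ∩ degreeEvent parent n (v ω) e ∧ ∀ i, ℓ i < (v ω i : ℝ)} := by
    intro ω hω
    have hω' : ∀ i, d i ≤ inDegree parent n (v ω i) ω ∧ ℓ i < (v ω i : ℝ) := hω
    by_cases hG : ω ∈ G
    · refine Or.inr (Set.mem_biUnion (x := fun i => inDegree parent n (v ω i) ω) ?_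
        ⟨⟨hG, fun i => rfl⟩, fun i => (hω' i).2⟩)
      exact Finset.mem_coe.2 (Fintype.mem_piFinset.2 fun i =>
        Finset.mem_Ico.2 ⟨(hω' i).1, inDegree_le n _ ω⟩)
    · exact Or.inl hG
  refine (measureReal_mono hsub (measure_ne_top _ _)).trans ((measureReal_union_le _ _).trans ?_)
  gcongr
  exact measureReal_biUnion_finset_le _ _

theorem sum_sampleEvent_le (h : IsUniformSample P W parent n v)
    (hw : IsWRT P ν W parent) (d : Fin k → ℕ) (ℓ : Fin k → ℝ) (b : Fin k → ℕ) :
    ∑ e ∈ Fintype.piFinset fun i => Finset.Ico (d i) (b i), P.real (sampleEvent parent n v e ℓ)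
      ≤ P.real (sampleTailEvent parent n v d ℓ) := by
  rw [← measureReal_biUnion_finset]
  · refine measureReal_mono ?_ (measure_ne_top _ _)
    intro ω hω
    obtain ⟨e, he, hωe⟩ := Set.mem_iUnion₂.1 hω
    obtain ⟨h1, h2⟩ : ω ∈ degreeEvent parent n (v ω) e ∧ ∀ i, ℓ i < (v ω i : ℝ) := hωe
    have h3 : ∀ i, inDegree parent n (v ω i) ω = e i := h1
    rw [Fintype.mem_piFinset] at he
    exact fun i => ⟨by rw [h3 i]; exact (Finset.mem_Ico.1 (he i)).1, h2 i⟩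
  · intro a _ b _ hab
    refine Set.disjoint_left.2 fun ω h1 h2 => hab ?_
    have h3 : ∀ i, inDegree parent n (v ω i) ω = a i := h1.1
    have h4 : ∀ i, inDegree parent n (v ω i) ω = b i := h2.1
    exact funext fun i => (h3 i).symm.trans (h4 i)
  · exact fun e _ => measurableSet_sampleEvent h hw e ℓ

theorem measureReal_sampleEvent_le (d : Fin k → ℕ) (ℓ : Fin k → ℝ) (G : Set Ω) :
    P.real (sampleEvent parent n v d ℓ) ≤ P.real Gᶜ +
        P.real {ω | ω ∈ G ∩ degreeEvent parent n (v ω) d ∧ ∀ i, ℓ i < (v ω i : ℝ)} := by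
  refine (measureReal_mono (fun ω hω => ?_) (measure_ne_top _ _)).trans (measureReal_union_le _ _)
  by_cases hG : ω ∈ G
  · exact Or.inr ⟨⟨hG, hω.1⟩, hω.2⟩
  · exact Or.inl hG

end SampleEvents

/-! ### Choice of scales and limits of the error terms. -/

section Asymptotics

open Filter Topology

theorem tendsto_log_pow_mul_rpow_neg (b : ℕ) {a : ℝ} (ha : 0 < a) :
    Tendsto (fun n : ℕ => Real.log n ^ b * (n : ℝ) ^ (-a)) atTop (𝓝 0) := by
  have h := (isLittleO_log_rpow_rpow_atTop (b : ℝ) ha).tendsto_div_nhds_zero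
  refine (h.comp tendsto_natCast_atTop_atTop).congr fun n => ?_
  simp only [Function.comp_apply, Real.rpow_natCast]
  rw [Real.rpow_neg (Nat.cast_nonneg n), div_eq_mul_inv]

theorem tendsto_rpow_neg_nat {a : ℝ} (ha : 0 < a) :
    Tendsto (fun n : ℕ => (n : ℝ) ^ (-a)) atTop (𝓝 0) := by
  simpa using tendsto_log_pow_mul_rpow_neg 0 ha

theorem tendsto_log_mul_rpow_neg {a : ℝ} (ha : 0 < a) :
    Tendsto (fun n : ℕ => Real.log n * (n : ℝ) ^ (-a)) atTop (𝓝 0) := by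
  simpa using tendsto_log_pow_mul_rpow_neg 1 ha

variable {m κ η : ℝ}

/-- The scales are y = n^η, ρ = n^(-η/4), τ = n^(-η/8). Then ρ² y = n^(η/2) drives the Hoeffding
bound, while ρ = τ² makes the drift ρ log n of the Poisson parameters o(τ), and τ log n still tends
to 0. -/
theorem eventually_scaleBounds (hm : 0 < m) (hκ : 0 < κ) (hη : 0 < η) (k : ℕ) :
    ∀ᶠ n : ℕ in atTop,
      ScaleBounds m κ ((n : ℝ) ^ (-(η / 4))) ((n : ℝ) ^ η) ((n : ℝ) ^ (-(η / 8))) k n := by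
  have h8 : 0 < η / 8 := by positivity
  have hy : ∀ᶠ n : ℕ in atTop, 2 ≤ (n : ℝ) ^ η :=
    ((tendsto_rpow_atTop hη).comp tendsto_natCast_atTop_atTop).eventually_ge_atTop 2
  have hρ : ∀ᶠ n : ℕ in atTop, (n : ℝ) ^ (-(η / 4)) < m / 2 :=
    (tendsto_rpow_neg_nat (by positivity)).eventually_lt_const (by positivity)
  have hτ1 : ∀ᶠ n : ℕ in atTop, (n : ℝ) ^ (-(η / 8)) < κ / 4 :=
    (tendsto_rpow_neg_nat (by positivity)).eventually_lt_const (by positivity)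
  have hτ2 : ∀ᶠ n : ℕ in atTop, (n : ℝ) ^ (-(η / 8)) < 1 / 2 :=
    (tendsto_rpow_neg_nat (by positivity)).eventually_lt_const (by positivity)
  have hQ : ∀ᶠ n : ℕ in atTop, (k * (2 / m)) * (n : ℝ) ^ (-η) < 1 / 2 := by
    have := (tendsto_rpow_neg_nat hη).const_mul (k * (2 / m))
    rw [mul_zero] at this
    exact this.eventually_lt_const (by norm_num)
  have hd : ∀ᶠ n : ℕ in atTop, (k * (2 / m) + 4 / m) * (Real.log n * (n : ℝ) ^ (-(η / 8)))
      + 3 * (n : ℝ) ^ (-(η / 8)) < 1 := by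
    have := ((tendsto_log_mul_rpow_neg h8).const_mul (k * (2 / m) + 4 / m)).add
      ((tendsto_rpow_neg_nat h8).const_mul 3)
    simp only [mul_zero, add_zero] at this
    exact this.eventually_lt_const (by norm_num)
  filter_upwards [eventually_ge_atTop (max k 1), hy, hρ, hτ1, hτ2, hQ, hd]
    with n hn hy hρ hτ1 hτ2 hQ hd
  have hn1 : 1 ≤ n := (le_max_right _ _).trans hn
  have hn1' : (1 : ℝ) ≤ n := by exact_mod_cast hn1
  have hn0 : (0 : ℝ) < n := by positivity
  set τ := (n : ℝ) ^ (-(η / 8)) with hτ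
  set ρ := (n : ℝ) ^ (-(η / 4)) with hρd
  have hτ0 : 0 < τ := Real.rpow_pos_of_pos hn0 _
  have hρτ : ρ = τ * τ := by
    rw [hτ, hρd, ← Real.rpow_add hn0]; congr 1; ring
  have hyinv : ((n : ℝ) ^ η)⁻¹ = (n : ℝ) ^ (-η) := (Real.rpow_neg hn0.le η).symm
  have hyρ : (n : ℝ) ^ (-η) ≤ ρ :=
    Real.rpow_le_rpow_of_exponent_le hn1' (by linarith)
  have hQe : (k : ℝ) * (2 / (m * (n : ℝ) ^ η)) = k * (2 / m) * (n : ℝ) ^ (-η) := by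
    rw [← hyinv]; field_simp
  have hρ0 : 0 < ρ := Real.rpow_pos_of_pos hn0 _
  have hk0 : 0 ≤ (k : ℝ) * (2 / m) := by positivity
  refine ⟨hn1, (le_max_left _ _).trans hn, hy, hρ0.le, hρ.le, ?_, by linarith, ?_, ?_⟩
  · rw [div_eq_mul_inv, hyinv]
    nlinarith
  · rw [hQe]; exact hQ.le
  · rw [hQe]
    set Q := (k : ℝ) * (2 / m) * (n : ℝ) ^ (-η) with hQd
    have hQ0 : 0 ≤ Q := by positivity
    have hQρ : Q ≤ k * (2 / m) * ρ := mul_le_mul_of_nonneg_left hyρ hk0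
    have h1 : 2 * ρ / m ≤ 1 := by rw [div_le_one hm]; linarith
    have h10 : 0 ≤ 2 * ρ / m := by positivity
    have hlog : 0 ≤ Real.log n := Real.log_natCast_nonneg n
    have h2 : (1 + Q) * (1 + 2 * ρ / m) - 1 ≤ (k * (2 / m) + 4 / m) * ρ := by
      have : 4 / m * ρ = 2 * (2 * ρ / m) := by ring
      nlinarith
    have h3 : (1 + Q) * (1 + 2 * ρ / m) / (n : ℝ) ^ η ≤ 3 * ρ := by
      rw [div_eq_mul_inv, hyinv]
      refine mul_le_mul ?_ hyρ (by positivity) (by norm_num)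
      nlinarith
    calc _ ≤ (k * (2 / m) + 4 / m) * ρ * Real.log n + 3 * ρ :=
          add_le_add (mul_le_mul_of_nonneg_right h2 hlog) h3
      _ = ((k * (2 / m) + 4 / m) * (Real.log n * τ) + 3 * τ) * τ := by rw [hρτ]; ring
      _ ≤ 1 * τ := mul_le_mul_of_nonneg_right hd.le hτ0.le
      _ = τ := one_mul _

/-- This yields the hypothesis `hτ2` of the lower bound when the total degree is at most K log n. -/
theorem eventually_degree_shift (hη : 0 < η) (m K : ℝ) :
    ∀ᶠ n : ℕ in atTop, (n : ℝ) ^ (-(η / 4)) / m * Real.log n + K * Real.log n * (2 / (n : ℝ) ^ η)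
      ≤ (n : ℝ) ^ (-(η / 8)) := by
  have h8 : 0 < η / 8 := by positivity
  have hd : ∀ᶠ n : ℕ in atTop, 1 / m * (Real.log n * (n : ℝ) ^ (-(η / 8)))
      + K * 2 * (Real.log n * (n : ℝ) ^ (-(7 * η / 8))) < 1 := by
    have := ((tendsto_log_mul_rpow_neg h8).const_mul (1 / m)).add
      ((tendsto_log_mul_rpow_neg (by positivity : 0 < 7 * η / 8)).const_mul (K * 2))
    simp only [mul_zero, add_zero] at this
    exact this.eventually_lt_const (by norm_num)
  filter_upwards [hd, eventually_ge_atTop 1] with n hd hn1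
  have hn0 : (0 : ℝ) < n := by exact_mod_cast hn1
  have h1 : (n : ℝ) ^ (-(η / 4)) = (n : ℝ) ^ (-(η / 8)) * (n : ℝ) ^ (-(η / 8)) := by
    rw [← Real.rpow_add hn0]; congr 1; ring
  have h2 : 2 / (n : ℝ) ^ η = 2 * ((n : ℝ) ^ (-(7 * η / 8)) * (n : ℝ) ^ (-(η / 8))) := by
    rw [← Real.rpow_add hn0, show -(7 * η / 8) + -(η / 8) = -η by ring, Real.rpow_neg hn0.le,
      div_eq_mul_inv]
  rw [h1, h2]
  have hτ0 : 0 < (n : ℝ) ^ (-(η / 8)) := Real.rpow_pos_of_pos hn0 _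
  calc _ = (1 / m * (Real.log n * (n : ℝ) ^ (-(η / 8)))
      + K * 2 * (Real.log n * (n : ℝ) ^ (-(7 * η / 8)))) * (n : ℝ) ^ (-(η / 8)) := by ring
    _ ≤ 1 * (n : ℝ) ^ (-(η / 8)) := mul_le_mul_of_nonneg_right hd.le hτ0.le
    _ = _ := one_mul _

theorem tendsto_pow_div_descFactorial (k : ℕ) :
    Tendsto (fun n : ℕ => (n : ℝ) ^ k / n.descFactorial k) atTop (𝓝 1) := by
  have h := (isEquivalent_descFactorial k).symm
  refine (Asymptotics.isEquivalent_iff_tendsto_one ?_).1 h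
  filter_upwards [eventually_ge_atTop k] with n hn
  have := Nat.descFactorial_pos.2 hn
  positivity

/-- The exponential rate of the relative error of the upper bound. -/
def upperRate (m κ η : ℝ) (k n : ℕ) : ℝ :=
  k * (2 / (m * (n : ℝ) ^ η)) + errorRate m κ * (n : ℝ) ^ (-(η / 8))

theorem upperRate_nonneg (hm : 0 < m) (hκ : 0 < κ) (k n : ℕ) : 0 ≤ upperRate m κ η k n := by
  have := errorRate_pos hm hκ
  unfold upperRate
  positivity

theorem upperRate_eq (m κ η : ℝ) (k n : ℕ) : upperRate m κ η k n
    = k * (2 / m) * (n : ℝ) ^ (-η) + errorRate m κ * (n : ℝ) ^ (-(η / 8)) := by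
  unfold upperRate
  rw [Real.rpow_neg (Nat.cast_nonneg n) η, ← div_div]
  ring

theorem tendsto_upperRate (hη : 0 < η) (m κ : ℝ) (k : ℕ) :
    Tendsto (upperRate m κ η k) atTop (𝓝 0) := by
  have h := ((tendsto_rpow_neg_nat hη).const_mul (k * (2 / m))).add
    ((tendsto_rpow_neg_nat (by positivity : 0 < η / 8)).const_mul (errorRate m κ))
  simp only [mul_zero, add_zero] at h
  exact h.congr fun n => (upperRate_eq m κ η k n).symm

theorem tendsto_upperRate_mul_log (hη : 0 < η) (m κ C : ℝ) (k : ℕ) :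
    Tendsto (fun n => upperRate m κ η k n * (C * Real.log n)) atTop (𝓝 0) := by
  have h := ((tendsto_log_mul_rpow_neg hη).const_mul (k * (2 / m) * C)).add
    ((tendsto_log_mul_rpow_neg (by positivity : 0 < η / 8)).const_mul (errorRate m κ * C))
  simp only [mul_zero, add_zero] at h
  refine h.congr fun n => ?_
  rw [upperRate_eq]; ring

/-- One constant for both upper bounds: q = 0 removes the geometric quotient and serves exact
degrees, q = θ⁻¹ serves tails. -/
theorem tendsto_upperConst (hη : 0 < η) (m κ C : ℝ) (k : ℕ) {q : ℝ} (hq : q < 1) :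
    Tendsto (fun n : ℕ => (n : ℝ) ^ k / n.descFactorial k *
      (Real.exp (upperRate m κ η k n * (C * Real.log n)) *
        ((1 - q) / (1 - q * Real.exp (upperRate m κ η k n)))) ^ k) atTop (𝓝 1) := by
  have h1 := (Real.continuous_exp.tendsto 0).comp (tendsto_upperRate_mul_log hη m κ C k)
  have h2 := (Real.continuous_exp.tendsto 0).comp (tendsto_upperRate hη m κ k)
  have h3 := (tendsto_const_nhds (x := 1 - q)).div
    ((tendsto_const_nhds (x := (1 : ℝ))).sub (h2.const_mul q))
    (by rw [Real.exp_zero]; linarith)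
  have h4 := (tendsto_pow_div_descFactorial k).mul ((h1.mul h3).pow k)
  rw [Real.exp_zero, mul_one, div_self (by linarith), one_mul, one_mul, one_pow] at h4
  exact h4

/-- The bound for the relative mass of a single label. -/
def labelMass (m κ η C : ℝ) (n : ℕ) : ℝ :=
  Real.exp ((1 + 1 / m) * κ) * (C * Real.log n) / (κ * (n : ℝ) ^ η) *
    Real.exp (errorRate m κ * (n : ℝ) ^ (-(η / 8)) * (C * Real.log n))

theorem tendsto_errorRate_mul_log (hη : 0 < η) (m κ C : ℝ) :
    Tendsto (fun n : ℕ => errorRate m κ * (n : ℝ) ^ (-(η / 8)) * (C * Real.log n)) atTop (𝓝 0) := by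
  have h := (tendsto_log_mul_rpow_neg (by positivity : 0 < η / 8)).const_mul (errorRate m κ * C)
  rw [mul_zero] at h
  exact h.congr fun n => by ring

theorem tendsto_labelMass (hη : 0 < η) (m κ C : ℝ) :
    Tendsto (labelMass m κ η C) atTop (𝓝 0) := by
  have h1 := (tendsto_log_mul_rpow_neg hη).const_mul (Real.exp ((1 + 1 / m) * κ) * C / κ)
  have h2 := (Real.continuous_exp.tendsto 0).comp (tendsto_errorRate_mul_log hη m κ C)
  have h3 := h1.mul h2
  rw [mul_zero, zero_mul] at h3
  refine h3.congr fun n => ?_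
  simp only [labelMass, Function.comp_apply]
  rw [Real.rpow_neg (Nat.cast_nonneg n) η, ← div_div]
  ring

theorem tendsto_lowerConst (hη : 0 < η) (m κ C : ℝ) (k : ℕ) :
    Tendsto (fun n : ℕ => (1 - k * labelMass m κ η C n) ^ k *
      Real.exp (-(errorRate m κ * (n : ℝ) ^ (-(η / 8)) * (C * Real.log n))) ^ k) atTop (𝓝 1) := by
  have h1 := (tendsto_const_nhds (x := (1 : ℝ))).sub
    ((tendsto_labelMass hη m κ C).const_mul (k : ℝ))
  have h2 := (Real.continuous_exp.tendsto _).comp (tendsto_errorRate_mul_log hη m κ C).neg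
  have h3 := (h1.pow k).mul (h2.pow k)
  simp only [mul_zero, sub_zero, one_pow, neg_zero, Real.exp_zero, mul_one] at h3
  exact h3

/-- The probability of the bad event is negligible compared with every product of factors. -/
theorem tendsto_badEvent (hη : 0 < η) (κ C : ℝ) (k : ℕ) (b : ℝ) :
    Tendsto (fun n : ℕ => n * (2 * Real.exp (-(2 * ((n : ℝ) ^ (-(η / 4))) ^ 2 * (n : ℝ) ^ η))) /
      (b * Real.exp (-(2 / κ * (C * Real.log n) + (C * Real.log n) ^ 2))) ^ k) atTop (𝓝 0) := by
  have h2 : 0 < η / 2 := by positivity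
  have hy : Tendsto (fun n : ℕ => (n : ℝ) ^ (η / 2)) atTop atTop :=
    (tendsto_rpow_atTop h2).comp tendsto_natCast_atTop_atTop
  -- The whole exponent, divided by n^(η/2): the Hoeffding term contributes -2 and dominates the
  -- powers of log n.
  have hb : Tendsto (fun n : ℕ => (1 + k * (2 / κ * C)) * (Real.log n * (n : ℝ) ^ (-(η / 2)))
      + k * C ^ 2 * (Real.log n ^ 2 * (n : ℝ) ^ (-(η / 2))) - 2) atTop (𝓝 (-2)) := by
    have := (((tendsto_log_mul_rpow_neg h2).const_mul (1 + k * (2 / κ * C))).add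
      ((tendsto_log_pow_mul_rpow_neg 2 h2).const_mul (k * C ^ 2))).sub_const 2
    simpa using this
  have hE := (Real.tendsto_exp_atBot.comp (hy.atTop_mul_neg (by norm_num) hb)).const_mul (2 / b ^ k)
  rw [mul_zero] at hE
  refine hE.congr' ?_
  filter_upwards [eventually_ge_atTop 1] with n hn1
  have hn0 : (0 : ℝ) < n := by exact_mod_cast hn1
  have h3 : ((n : ℝ) ^ (-(η / 4))) ^ 2 * (n : ℝ) ^ η = (n : ℝ) ^ (η / 2) := by
    rw [← Real.rpow_natCast, ← Real.rpow_mul hn0.le, ← Real.rpow_add hn0]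
    congr 1; push_cast; ring
  have h4 : (n : ℝ) ^ (η / 2) * (n : ℝ) ^ (-(η / 2)) = 1 := by
    rw [← Real.rpow_add hn0]; simp
  have h5 : (n : ℝ) = Real.exp (Real.log n) := (Real.exp_log hn0).symm
  simp only [Function.comp_apply]
  rw [mul_pow, ← Real.exp_nat_mul, mul_assoc 2 (((n : ℝ) ^ (-(η / 4))) ^ 2), h3]
  have h6 : (n : ℝ) ^ (η / 2) * ((1 + k * (2 / κ * C)) * (Real.log n * (n : ℝ) ^ (-(η / 2)))
      + k * C ^ 2 * (Real.log n ^ 2 * (n : ℝ) ^ (-(η / 2))) - 2)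
      = Real.log n + -(2 * (n : ℝ) ^ (η / 2)) +
        -(k * -(2 / κ * (C * Real.log n) + (C * Real.log n) ^ 2)) := by
    linear_combination ((1 + k * (2 / κ * C)) * Real.log n + k * C ^ 2 * Real.log n ^ 2) * h4
  rw [h6, Real.exp_add, Real.exp_add, ← h5, Real.exp_neg (k * _)]
  field_simp

end Asymptotics

/-! ### Uniform asymptotics for logarithmic degrees. -/

section Limits

set_option linter.unusedSectionVars false

open Filter Topology

variable {Ω : Type*} [mΩ : MeasurableSpace Ω] {P : Measure Ω} [IsProbabilityMeasure P]
  {ν : Measure ℝ} [IsProbabilityMeasure ν] {W : ℕ → Ω → ℝ} {parent : ℕ → Ω → ℕ}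
  {k : ℕ} {v : ℕ → Ω → Fin k → ℕ} {κ η : ℝ}

/-- Degrees of at most logarithmic size and labels in the range where the estimates apply. -/
structure InRange (κ η C : ℝ) (n : ℕ) (d : Fin k → ℕ) (ℓ : Fin k → ℝ) : Prop where
  degree_le : ∀ i, (d i : ℝ) + 1 ≤ C * Real.log n
  le_label : ∀ i, (n : ℝ) ^ η ≤ ℓ i
  le_log : ∀ i, κ ≤ Real.log (n / ℓ i)

theorem eventually_compl_goodEvent_le (hpos : ∀ᵐ w ∂ν, 0 < w)
    (hsup : sSup {x : ℝ | 0 < x ∧ ν (Set.Iic x) < 1} = 1) (hw : IsWRT P ν W parent) (hκ : 0 < κ)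
    (hκ1 : κ ≤ 1) (hη : 0 < η) (C : ℝ) {ε : ℝ} (hε : 0 < ε) :
    ∀ᶠ n : ℕ in atTop, ∀ (d : Fin k → ℕ) (ℓ : Fin k → ℝ), InRange κ η C n d ℓ →
      P.real (goodEvent W (theta ν - 1) ((n : ℝ) ^ (-(η / 4))) ((n : ℝ) ^ η) n)ᶜ
        ≤ ε * ∏ i, exactFactor ν n (d i) (ℓ i) := by
  have hle := ae_le_one_of_sSup hsup
  have hm := theta_sub_one_pos hpos hle
  set b := ν.real (Set.Ioi (1 / 2)) * Real.exp (-(1 + 1 / (theta ν - 1))) with hb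
  have hb0 : 0 < b := mul_pos (measureReal_Ioi_half_pos hsup) (Real.exp_pos _)
  filter_upwards [(tendsto_badEvent hη κ C k b).eventually_lt_const hε] with n hn d ℓ hr
  refine (hw.measureReal_compl_goodEvent hpos hle (by positivity) _ n).trans ?_
  rw [div_lt_iff₀ (by positivity)] at hn
  refine hn.le.trans (mul_le_mul_of_nonneg_left ?_ hε.le)
  have h1 : ∀ i : Fin k, b * Real.exp (-(2 / κ * (C * Real.log n) + (C * Real.log n) ^ 2))
      ≤ exactFactor ν n (d i) (ℓ i) := by
    intro i
    refine le_trans ?_ (le_exactFactor hpos hle hκ hκ1 (d i) (hr.le_log i))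
    have hd := hr.degree_le i
    have hd0 : (0 : ℝ) ≤ d i + 1 := by positivity
    rw [← hb]
    gcongr
  calc (b * Real.exp (-(2 / κ * (C * Real.log n) + (C * Real.log n) ^ 2))) ^ k
      = ∏ _i : Fin k, b * Real.exp (-(2 / κ * (C * Real.log n) + (C * Real.log n) ^ 2)) := by simp
    _ ≤ _ := Finset.prod_le_prod (fun i _ => by positivity) fun i _ => h1 i

theorem exact_asymptotics (hpos : ∀ᵐ w ∂ν, 0 < w)
    (hsup : sSup {x : ℝ | 0 < x ∧ ν (Set.Iic x) < 1} = 1) (hw : IsWRT P ν W parent)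
    (hv : ∀ n, k ≤ n → IsUniformSample P W parent n (v n)) (hκ : 0 < κ)
    (hκ1 : κ ≤ 1) (hη : 0 < η) (C : ℝ) {ε : ℝ} (hε : 0 < ε) :
    ∀ᶠ n : ℕ in atTop, ∀ (d : Fin k → ℕ) (ℓ : Fin k → ℝ), InRange κ η C n d ℓ →
      |P.real (sampleEvent parent n (v n) d ℓ) - ∏ i, exactFactor ν n (d i) (ℓ i)|
        ≤ ε * ∏ i, exactFactor ν n (d i) (ℓ i) := by
  have hle := ae_le_one_of_sSup hsup
  have hm := theta_sub_one_pos hpos hle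
  set m := theta ν - 1 with hmdef
  have hε2 : 0 < ε / 2 := by positivity
  -- Here q = 0. Half of ε goes to the multiplicative errors, the other half to the bad event.
  have hU := (tendsto_upperConst hη m κ C k (zero_lt_one' ℝ)).eventually_lt_const
    (show (1 : ℝ) < 1 + ε / 2 by linarith)
  have hV := (tendsto_lowerConst hη m κ C k).eventually_const_lt
    (show 1 - ε / 2 < (1 : ℝ) by linarith)
  have hμ : ∀ᶠ n : ℕ in atTop, k * labelMass m κ η C n < 1 := by
    have := (tendsto_labelMass hη m κ C).const_mul (k : ℝ)
    rw [mul_zero] at this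
    exact this.eventually_lt_const one_pos
  filter_upwards [eventually_compl_goodEvent_le (k := k) hpos hsup hw hκ hκ1 hη C hε2, hU, hV, hμ,
    eventually_scaleBounds hm hκ hη k, eventually_degree_shift hη m (k * C)]
    with n hbad hU hV hμ hs hshift d ℓ hr
  have hbad := hbad d ℓ hr
  have hX0 : ∀ i, 0 ≤ exactFactor ν n (d i) (ℓ i) := fun i =>
    exactFactor_nonneg hpos hle n (d i) (hκ.le.trans (hr.le_log i))
  set X := ∏ i, exactFactor ν n (d i) (ℓ i) with hX
  have hXn : 0 ≤ X := Finset.prod_nonneg fun i _ => hX0 i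
  have hB := errorRate_pos hm hκ
  rw [abs_le]
  constructor
  · have hτ2 : (n : ℝ) ^ (-(η / 4)) / m * Real.log n + (∑ i, (d i : ℝ)) * (2 / (n : ℝ) ^ η)
        ≤ (n : ℝ) ^ (-(η / 8)) := by
      refine le_trans ?_ hshift
      have h1 : ∑ i, (d i : ℝ) ≤ k * C * Real.log n := by
        have : ∀ i ∈ Finset.univ, (d i : ℝ) ≤ C * Real.log n := fun i _ => by
          linarith [hr.degree_le i]
        have := Finset.sum_le_card_nsmul _ _ _ this
        simpa [mul_assoc] using this
      gcongr
    -- The sign of C log n is read off from some degree, so the empty sample is treated apart.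
    rcases isEmpty_or_nonempty (Fin k) with _ | ⟨⟨i₀⟩⟩
    · have hX1 : X = 1 := by simp [hX]
      have h1 := le_measureReal_degrees hpos hle hw (hv n hs.k_le) hκ hs d ℓ hr.le_label hr.le_log
        hτ2 (μ := 0) le_rfl (by simp) (fun i => isEmptyElim i)
      have h2 : (1 - (k : ℝ) * 0) ^ k * ∏ i, (Real.exp (-(errorRate (theta ν - 1) κ *
          (n : ℝ) ^ (-(η / 8)) * (d i + 1))) * exactFactor ν n (d i) (ℓ i)) = 1 := by simp
      rw [h2] at h1
      have h3 : P.real {ω | ω ∈ degreeEvent parent n (v n ω) d ∧ ∀ i, ℓ i < (v n ω i : ℝ)}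
        = P.real (sampleEvent parent n (v n) d ℓ) := rfl
      rw [hX1] at hbad ⊢
      linarith
    have hM0 : 0 ≤ C * Real.log n := le_trans (by positivity) (hr.degree_le i₀)
    have hμ0 : 0 ≤ labelMass m κ η C n := by unfold labelMass; positivity
    have h1 := le_measureReal_degrees hpos hle hw (hv n hs.k_le) hκ hs d ℓ hr.le_label hr.le_log
      hτ2 (μ := labelMass m κ η C n) hμ0 hμ.le (fun i => by
        have := hr.degree_le i
        unfold labelMass
        gcongr)
    have h2 : (1 - ε / 2) * X ≤ (1 - k * labelMass m κ η C n) ^ k *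
        ∏ i, (Real.exp (-(errorRate m κ * (n : ℝ) ^ (-(η / 8)) * (d i + 1))) *
          exactFactor ν n (d i) (ℓ i)) := by
      have h3 : Real.exp (-(errorRate m κ * (n : ℝ) ^ (-(η / 8)) * (C * Real.log n))) ^ k * X
          ≤ ∏ i, (Real.exp (-(errorRate m κ * (n : ℝ) ^ (-(η / 8)) * (d i + 1))) *
          exactFactor ν n (d i) (ℓ i)) := by
        have : Real.exp (-(errorRate m κ * (n : ℝ) ^ (-(η / 8)) * (C * Real.log n))) ^ k * X
            = ∏ i, (Real.exp (-(errorRate m κ * (n : ℝ) ^ (-(η / 8)) * (C * Real.log n))) *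
              exactFactor ν n (d i) (ℓ i)) := by
          rw [Finset.prod_mul_distrib]; simp [hX]
        rw [this]
        refine Finset.prod_le_prod (fun i _ => mul_nonneg (Real.exp_pos _).le (hX0 i)) fun i _ => ?_
        refine mul_le_mul_of_nonneg_right (Real.exp_le_exp.2 ?_) (hX0 i)
        have := hr.degree_le i
        gcongr
      calc (1 - ε / 2) * X ≤ ((1 - k * labelMass m κ η C n) ^ k *
            Real.exp (-(errorRate m κ * (n : ℝ) ^ (-(η / 8)) * (C * Real.log n))) ^ k) * X :=
            mul_le_mul_of_nonneg_right hV.le hXn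
        _ = (1 - k * labelMass m κ η C n) ^ k *
            (Real.exp (-(errorRate m κ * (n : ℝ) ^ (-(η / 8)) * (C * Real.log n))) ^ k * X) := by
            ring
        _ ≤ _ := mul_le_mul_of_nonneg_left h3 (pow_nonneg (by linarith) _)
    have h4 : (1 - ε / 2) * X - ε / 2 * X ≤ P.real (sampleEvent parent n (v n) d ℓ) :=
      le_trans (sub_le_sub h2 hbad) h1
    linarith
  · have h1 := measureReal_sampleEvent_le (P := P) (parent := parent) (n := n) (v := v n) d ℓ
      (goodEvent W m ((n : ℝ) ^ (-(η / 4))) ((n : ℝ) ^ η) n)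
    have h2 := measureReal_good_degrees_le hpos hle hw (hv n hs.k_le) hκ hs d ℓ hr.le_label
      hr.le_log
    rw [← hmdef] at h2
    simp only [zero_mul, sub_zero, div_one, mul_one] at hU
    have hdf : (0 : ℝ) ≤ (n : ℝ) ^ k / n.descFactorial k := by positivity
    have h3 : ∏ i, (Real.exp ((k * (2 / (m * (n : ℝ) ^ η)) + errorRate m κ *
          (n : ℝ) ^ (-(η / 8))) * (d i + 1)) * exactFactor ν n (d i) (ℓ i))
        ≤ Real.exp (upperRate m κ η k n * (C * Real.log n)) ^ k * X := by
      have : Real.exp (upperRate m κ η k n * (C * Real.log n)) ^ k * X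
          = ∏ i, (Real.exp (upperRate m κ η k n * (C * Real.log n)) *
              exactFactor ν n (d i) (ℓ i)) := by
        rw [Finset.prod_mul_distrib]; simp [hX]
      rw [this]
      refine Finset.prod_le_prod (fun i _ => mul_nonneg (Real.exp_pos _).le (hX0 i)) fun i _ => ?_
      refine mul_le_mul_of_nonneg_right (Real.exp_le_exp.2 ?_) (hX0 i)
      exact mul_le_mul_of_nonneg_left (hr.degree_le i) (upperRate_nonneg hm hκ k n)
    have h4 : (n : ℝ) ^ k / n.descFactorial k *
        ∏ i, (Real.exp ((k * (2 / (m * (n : ℝ) ^ η)) + errorRate m κ *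
          (n : ℝ) ^ (-(η / 8))) * (d i + 1)) * exactFactor ν n (d i) (ℓ i)) ≤ (1 + ε / 2) * X := by
      refine (mul_le_mul_of_nonneg_left h3 hdf).trans ?_
      rw [← mul_assoc]
      exact mul_le_mul_of_nonneg_right hU.le hXn
    linarith

/-- The sum runs over degrees up to n, far beyond the range of `exact_asymptotics`. It therefore
uses the bound on the good event, valid for all degrees, and compares the bad event only with the
factor at the starting degrees. -/
theorem tail_upper_asymptotics (hpos : ∀ᵐ w ∂ν, 0 < w)
    (hsup : sSup {x : ℝ | 0 < x ∧ ν (Set.Iic x) < 1} = 1) (hw : IsWRT P ν W parent)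
    (hv : ∀ n, k ≤ n → IsUniformSample P W parent n (v n)) (hκ : 0 < κ)
    (hκ1 : κ ≤ 1) (hη : 0 < η) (C : ℝ) {ε : ℝ} (hε : 0 < ε) :
    ∀ᶠ n : ℕ in atTop, ∀ (d : Fin k → ℕ) (ℓ : Fin k → ℝ), InRange κ η C n d ℓ →
      P.real (sampleTailEvent parent n (v n) d ℓ)
        ≤ (1 + ε) * ∏ i, tailFactor ν n (d i) (ℓ i) (d i + 1) := by
  have hle := ae_le_one_of_sSup hsup
  have hm := theta_sub_one_pos hpos hle
  set m := theta ν - 1 with hmdef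
  set q := (theta ν)⁻¹ with hq
  have hq0 : 0 < q := inv_pos.2 (by linarith)
  have hq1 : q < 1 := inv_lt_one_of_one_lt₀ (by linarith)
  have hε2 : 0 < ε / 2 := by positivity
  have hU := (tendsto_upperConst hη m κ C k hq1).eventually_lt_const
    (show (1 : ℝ) < 1 + ε / 2 by linarith)
  have hβ : ∀ᶠ n : ℕ in atTop, q * Real.exp (upperRate m κ η k n) < 1 := by
    have := ((Real.continuous_exp.tendsto 0).comp (tendsto_upperRate hη m κ k)).const_mul q
    rw [Real.exp_zero, mul_one] at this
    exact this.eventually_lt_const hq1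
  filter_upwards [eventually_compl_goodEvent_le (k := k) hpos hsup hw hκ hκ1 hη C hε2, hU, hβ,
    eventually_scaleBounds hm hκ hη k] with n hbad hU hβ hs d ℓ hr
  have hbad := hbad d ℓ hr
  have hL0 : ∀ i, 0 ≤ Real.log (n / ℓ i) := fun i => hκ.le.trans (hr.le_log i)
  set β := upperRate m κ η k n with hβdef
  have hβ0 : 0 ≤ β := upperRate_nonneg hm hκ k n
  have hT0 : ∀ i, 0 ≤ tailFactor ν n (d i) (ℓ i) (d i + 1) := fun i =>
    tailFactor_nonneg hpos hle _ _ _ _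
  set T := ∏ i, tailFactor ν n (d i) (ℓ i) (d i + 1) with hT
  have hTn : 0 ≤ T := Finset.prod_nonneg fun i _ => hT0 i
  have hXT : ∏ i, exactFactor ν n (d i) (ℓ i) ≤ T :=
    Finset.prod_le_prod (fun i _ => exactFactor_nonneg hpos hle n (d i) (hL0 i))
      fun i _ => exactFactor_le_tailFactor hpos hle (d i) (hL0 i)
  have hdf : (0 : ℝ) ≤ (n : ℝ) ^ k / n.descFactorial k := by positivity
  have h1 := measureReal_sampleTailEvent_le (P := P) (parent := parent) (n := n) (v := v n) d ℓ
    (goodEvent W m ((n : ℝ) ^ (-(η / 4))) ((n : ℝ) ^ η) n)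
  have h2 : ∑ e ∈ Fintype.piFinset fun i => Finset.Ico (d i) (n + 1),
      P.real {ω | ω ∈ goodEvent W m ((n : ℝ) ^ (-(η / 4))) ((n : ℝ) ^ η) n ∩
        degreeEvent parent n (v n ω) e ∧ ∀ i, ℓ i < (v n ω i : ℝ)}
      ≤ (n : ℝ) ^ k / n.descFactorial k *
        ∏ i, ∑ e ∈ Finset.Ico (d i) (n + 1), Real.exp (β * (e + 1)) * exactFactor ν n e (ℓ i) := by
    rw [Finset.prod_univ_sum, Finset.mul_sum]
    refine Finset.sum_le_sum fun e _ => ?_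
    exact measureReal_good_degrees_le hpos hle hw (hv n hs.k_le) hκ hs e ℓ hr.le_label hr.le_log
  have hR0 : 0 ≤ (1 - q) / (1 - q * Real.exp β) := div_nonneg (by linarith) (by linarith)
  have h3 : ∏ i, ∑ e ∈ Finset.Ico (d i) (n + 1), Real.exp (β * (e + 1)) * exactFactor ν n e (ℓ i)
      ≤ (Real.exp (β * (C * Real.log n)) * ((1 - q) / (1 - q * Real.exp β))) ^ k * T := by
    have : (Real.exp (β * (C * Real.log n)) * ((1 - q) / (1 - q * Real.exp β))) ^ k * T
        = ∏ i, (Real.exp (β * (C * Real.log n)) * ((1 - q) / (1 - q * Real.exp β)) *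
          tailFactor ν n (d i) (ℓ i) (d i + 1)) := by
      rw [Finset.prod_mul_distrib (g := fun i => tailFactor ν n (d i) (ℓ i) (d i + 1))]
      simp [hT]
    rw [this]
    refine Finset.prod_le_prod (fun i _ => Finset.sum_nonneg fun e _ =>
      mul_nonneg (Real.exp_pos _).le (exactFactor_nonneg hpos hle n e (hL0 i))) fun i _ => ?_
    refine (sum_exactFactor_le hpos hle (d i) (n + 1) (hL0 i) hβ0 hβ).trans ?_
    refine mul_le_mul_of_nonneg_right (mul_le_mul_of_nonneg_right (Real.exp_le_exp.2 ?_) hR0) (hT0 i)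
    exact mul_le_mul_of_nonneg_left (hr.degree_le i) hβ0
  have h4 : (n : ℝ) ^ k / n.descFactorial k *
      ∏ i, ∑ e ∈ Finset.Ico (d i) (n + 1), Real.exp (β * (e + 1)) * exactFactor ν n e (ℓ i)
      ≤ (1 + ε / 2) * T := by
    refine (mul_le_mul_of_nonneg_left h3 hdf).trans ?_
    rw [← mul_assoc]
    exact mul_le_mul_of_nonneg_right hU.le hTn
  have h5 := mul_le_mul_of_nonneg_left hXT hε2.le
  linarith

/-- Sums of exact probabilities over `f i + 1` consecutive degrees bound the tail from below. -/
theorem tail_lower_of_exact (hpos : ∀ᵐ w ∂ν, 0 < w) (hle : ∀ᵐ w ∂ν, w ≤ 1)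
    (hw : IsWRT P ν W parent) {n : ℕ} {u : Ω → Fin k → ℕ} (hv : IsUniformSample P W parent n u)
    (d f : Fin k → ℕ) (ℓ : Fin k → ℝ) (hL : ∀ i, 0 ≤ Real.log (n / ℓ i)) {ε δ : ℝ} (hε1 : ε ≤ 1)
    (hδ1 : δ ≤ 1) (hf : ∀ i, (theta ν)⁻¹ ^ (f i + 1) ≤ δ)
    (hex : ∀ e : Fin k → ℕ, (∀ i, e i ∈ Finset.Ico (d i) (d i + f i + 1)) →
      (1 - ε) * ∏ i, exactFactor ν n (e i) (ℓ i) ≤ P.real (sampleEvent parent n u e ℓ)) :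
    (1 - ε) * (1 - δ) ^ k * ∏ i, tailFactor ν n (d i) (ℓ i) ((d i + f i : ℕ) + 1)
      ≤ P.real (sampleTailEvent parent n u d ℓ) := by
  refine le_trans ?_ (sum_sampleEvent_le hv hw d ℓ fun i => d i + f i + 1)
  refine le_trans ?_ (Finset.sum_le_sum fun e he => hex e (Fintype.mem_piFinset.1 he))
  rw [← Finset.mul_sum, ← Finset.prod_univ_sum (fun i => Finset.Ico (d i) (d i + f i + 1))
    fun i e => exactFactor ν n e (ℓ i), mul_assoc]
  refine mul_le_mul_of_nonneg_left ?_ (by linarith)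
  have : (1 - δ) ^ k * ∏ i, tailFactor ν n (d i) (ℓ i) ((d i + f i : ℕ) + 1)
      = ∏ i, ((1 - δ) * tailFactor ν n (d i) (ℓ i) ((d i + f i : ℕ) + 1)) := by
    rw [Finset.prod_mul_distrib]; simp
  rw [this]
  refine Finset.prod_le_prod (fun i _ => mul_nonneg (by linarith)
    (tailFactor_nonneg hpos hle _ _ _ _)) fun i _ => ?_
  refine le_trans ?_ (le_sum_exactFactor hpos hle (d i) (f i) (hL i))
  exact mul_le_mul_of_nonneg_right (by linarith [hf i]) (tailFactor_nonneg hpos hle _ _ _ _)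

/-- Since d ≥ 1 and ξ ≤ 1/2, the factor (1 - ξ)(d + 1) is at least 1. -/
theorem Admissible.le_log {c ξ : ℝ} {n d : ℕ} {ℓ : ℝ} (hθ : 1 < theta ν) (hξ : ξ ≤ 1 / 2)
    (hn : 0 < n) (h : Admissible ν c η ξ n d ℓ) : 1 - (theta ν)⁻¹ ≤ Real.log (n / ℓ) := by
  obtain ⟨hd, _, hℓ1, hℓ2⟩ := h
  have hn' : (0 : ℝ) < n := by positivity
  have hℓ0 : 0 < ℓ := lt_of_lt_of_le (Real.rpow_pos_of_pos hn' _) hℓ1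
  have hκ : 0 < 1 - (theta ν)⁻¹ := by
    have := inv_lt_one_of_one_lt₀ hθ
    linarith
  have hd' : (1 : ℝ) ≤ d := by exact_mod_cast hd
  have h1 : (1 - ξ) * (1 - (theta ν)⁻¹) * (d + 1) ≤ Real.log (n / ℓ) := by
    rw [Real.le_log_iff_exp_le (by positivity), le_div_iff₀ hℓ0]
    calc Real.exp ((1 - ξ) * (1 - (theta ν)⁻¹) * (d + 1)) * ℓ
        ≤ Real.exp ((1 - ξ) * (1 - (theta ν)⁻¹) * (d + 1)) *
          (n * Real.exp (-(1 - ξ) * (1 - (theta ν)⁻¹) * (d + 1))) := by gcongr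
      _ = n * (Real.exp ((1 - ξ) * (1 - (theta ν)⁻¹) * (d + 1)) *
          Real.exp (-(1 - ξ) * (1 - (theta ν)⁻¹) * (d + 1))) := by ring
      _ = n := by
        rw [← Real.exp_add, show (1 - ξ) * (1 - (theta ν)⁻¹) * ((d : ℝ) + 1) +
          -(1 - ξ) * (1 - (theta ν)⁻¹) * (d + 1) = 0 by ring, Real.exp_zero, mul_one]
  refine le_trans ?_ h1
  calc 1 - (theta ν)⁻¹ = (1 - 1 / 2) * (1 - (theta ν)⁻¹) * (1 + 1) := by ring
    _ ≤ (1 - ξ) * (1 - (theta ν)⁻¹) * (d + 1) := by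
      have : (0 : ℝ) ≤ 1 - ξ := by linarith
      gcongr

theorem exists_pow_le_floor_rpow {q δ : ℝ} (hq0 : 0 ≤ q) (hq1 : q < 1) (hδ : 0 < δ) :
    ∃ D : ℕ, ∀ d : ℕ, D ≤ d → q ^ (⌊(d : ℝ) ^ (1 / 4 : ℝ)⌋₊ + 1) ≤ δ := by
  obtain ⟨F, hF⟩ := exists_pow_lt_of_lt_one hδ hq1
  -- Fourth power, so that the floor of d^(1/4) is at least F.
  refine ⟨F ^ 4, fun d hd => le_trans (pow_le_pow_of_le_one hq0 hq1.le ?_) hF.le⟩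
  refine le_trans ?_ (Nat.le_succ _)
  refine Nat.le_floor ?_
  have h1 : ((F : ℝ) ^ 4) ≤ d := by exact_mod_cast hd
  calc (F : ℝ) = ((F : ℝ) ^ (4 : ℕ)) ^ (1 / 4 : ℝ) := by
        rw [← Real.rpow_natCast, ← Real.rpow_mul (by positivity)]; norm_num
    _ ≤ _ := Real.rpow_le_rpow (by positivity) h1 (by norm_num)

theorem floor_rpow_quarter_le {d : ℕ} (hd : 1 ≤ d) : ⌊(d : ℝ) ^ (1 / 4 : ℝ)⌋₊ ≤ d := by
  refine Nat.floor_le_of_le ?_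
  have hd' : (1 : ℝ) ≤ d := by exact_mod_cast hd
  calc (d : ℝ) ^ (1 / 4 : ℝ) ≤ (d : ℝ) ^ (1 : ℝ) :=
        Real.rpow_le_rpow_of_exponent_le hd' (by norm_num)
    _ = d := Real.rpow_one _

end Limits

end WRT

open Filter in
/-- The `o(1)` terms are uniform over all admissible `(d, ℓ)`: each tolerance `ε` comes with a
single `ξ > 0` for which the bound on `ℓ` is needed (and, for the tail events, a level `D` above
which the degrees have to be). In particular the three asymptotic relations hold along all sequences
`d = d(n)`, `ℓ = ℓ(n)` that, for every `ξ > 0`, are admissible for all large `n` (with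
`d(n) → ∞` for the tail events). -/
theorem mainTheorem5 {Ω : Type*} [MeasurableSpace Ω] (P : Measure Ω) [IsProbabilityMeasure P]
    (ν : Measure ℝ) [IsProbabilityMeasure ν]
    (hpos : ∀ᵐ w ∂ν, 0 < w)
    (hsup : sSup {x : ℝ | 0 < x ∧ ν (Set.Iic x) < 1} = 1)
    (W : ℕ → Ω → ℝ) (parent : ℕ → Ω → ℕ) (hwrt : WRT.IsWRT P ν W parent)
    (k : ℕ) (hk : 1 ≤ k)
    (v : ℕ → Ω → Fin k → ℕ)
    (hv : ∀ n, k ≤ n → WRT.IsUniformSample P W parent n (v n))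
    (c : ℝ) (hc0 : 0 < c) (hc : c < WRT.theta ν / (WRT.theta ν - 1))
    (η : ℝ) (hη0 : 0 < η) (hη1 : η < 1) :
    (∀ ε : ℝ, 0 < ε → ∃ ξ : ℝ, 0 < ξ ∧ ∃ N : ℕ, ∀ n, N ≤ n →
      ∀ (d : Fin k → ℕ) (ℓ : Fin k → ℝ), (∀ i, WRT.Admissible ν c η ξ n (d i) (ℓ i)) →
        |P.real {ω | ∀ i, WRT.inDegree parent n (v n ω i) ω = d i ∧ ℓ i < (v n ω i : ℝ)}
            - ∏ i, WRT.exactFactor ν n (d i) (ℓ i)|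
          ≤ ε * ∏ i, WRT.exactFactor ν n (d i) (ℓ i)) ∧
    (∀ ε : ℝ, 0 < ε → ∃ ξ : ℝ, 0 < ξ ∧ ∃ N D : ℕ, ∀ n, N ≤ n →
      ∀ (d : Fin k → ℕ) (ℓ : Fin k → ℝ), (∀ i, WRT.Admissible ν c η ξ n (d i) (ℓ i)) →
        (∀ i, D ≤ d i) →
        P.real {ω | ∀ i, d i ≤ WRT.inDegree parent n (v n ω i) ω ∧ ℓ i < (v n ω i : ℝ)}
            ≤ (1 + ε) * ∏ i, WRT.tailFactor ν n (d i) (ℓ i) (d i + 1) ∧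
        (1 - ε) * ∏ i, WRT.tailFactor ν n (d i) (ℓ i)
              (d i + (⌊(d i : ℝ) ^ (1 / 4 : ℝ)⌋₊ : ℝ) + 1)
            ≤ P.real {ω | ∀ i, d i ≤ WRT.inDegree parent n (v n ω i) ω ∧
                ℓ i < (v n ω i : ℝ)}) := by
  have hle := WRT.ae_le_one_of_sSup hsup
  have hm := WRT.theta_sub_one_pos hpos hle
  have hθ : 1 < WRT.theta ν := by linarith
  have hq0 : 0 < (WRT.theta ν)⁻¹ := inv_pos.2 (by linarith)
  have hq1 : (WRT.theta ν)⁻¹ < 1 := inv_lt_one_of_one_lt₀ hθ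
  have hκ : 0 < 1 - (WRT.theta ν)⁻¹ := by linarith
  have hκ1 : 1 - (WRT.theta ν)⁻¹ ≤ 1 := by linarith
  have hlog : ∀ᶠ n : ℕ in atTop, 1 ≤ Real.log n :=
    (Real.tendsto_log_atTop.comp tendsto_natCast_atTop_atTop).eventually_ge_atTop 1
  -- Degrees up to 2d cover the window d, …, d + ⌊d^(1/4)⌋ of the lower tail bound. The constant 2c
  -- + 1 absorbs the extra 1 once log n ≥ 1.
  have hrange : ∀ᶠ n : ℕ in atTop, ∀ (d e : Fin k → ℕ) (ℓ : Fin k → ℝ),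
      (∀ i, WRT.Admissible ν c η (1 / 2) n (d i) (ℓ i)) → (∀ i, e i ≤ 2 * d i) →
      WRT.InRange (1 - (WRT.theta ν)⁻¹) η (2 * c + 1) n e ℓ := by
    filter_upwards [hlog, eventually_gt_atTop 0] with n hn hn0 d e ℓ hadm he
    refine ⟨fun i => ?_, fun i => (hadm i).2.2.1, fun i => (hadm i).le_log hθ le_rfl hn0⟩
    have h1 := (hadm i).2.1
    have h2 : (e i : ℝ) ≤ 2 * d i := by exact_mod_cast he i
    linarith
  have hset : ∀ n d (ℓ : Fin k → ℝ), {ω | ∀ i, WRT.inDegree parent n (v n ω i) ω = d i ∧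
      ℓ i < (v n ω i : ℝ)} = WRT.sampleEvent parent n (v n) d ℓ := by
    intro n d ℓ
    ext ω
    exact forall_and
  -- ξ = 1/2 works for every ε, because the upper bound on the labels is used only to keep log(n /
  -- ℓ) above 1 - θ⁻¹.
  refine ⟨fun ε hε => ⟨1 / 2, by norm_num, ?_⟩, fun ε hε => ⟨1 / 2, by norm_num, ?_⟩⟩
  · obtain ⟨N, hN⟩ := eventually_atTop.1 (hrange.and
      (WRT.exact_asymptotics hpos hsup hwrt hv hκ hκ1 hη0 (2 * c + 1) hε))
    refine ⟨N, fun n hn d ℓ hadm => ?_⟩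
    rw [hset]
    exact (hN n hn).2 d ℓ ((hN n hn).1 d d ℓ hadm fun i => by omega)
  · have hk' : (1 : ℝ) ≤ k := by exact_mod_cast hk
    -- Capping ε at 1 keeps the factors nonnegative.
    set ε' := min ε 1 with hε'
    have hε'0 : 0 < ε' := lt_min hε one_pos
    have hε'1 : ε' ≤ 1 := min_le_right _ _
    -- By Bernoulli (1 - δ)^k ≥ 1 - ε'/2, and (1 - ε'/2)² ≥ 1 - ε'.
    set δ := ε' / (2 * k) with hδ
    have hδ0 : 0 < δ := by positivity
    have hδ1 : δ ≤ 1 := by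
      rw [hδ, div_le_one (by positivity)]; linarith
    obtain ⟨D, hD⟩ := WRT.exists_pow_le_floor_rpow hq0.le hq1 hδ0
    obtain ⟨N, hN⟩ := eventually_atTop.1 ((hrange.and
      (WRT.exact_asymptotics hpos hsup hwrt hv hκ hκ1 hη0 (2 * c + 1) (half_pos hε'0))).and
      ((WRT.tail_upper_asymptotics hpos hsup hwrt hv hκ hκ1 hη0 (2 * c + 1) hε).and
        (eventually_ge_atTop k)))
    refine ⟨N, D, fun n hn d ℓ hadm hDd => ?_⟩
    obtain ⟨⟨hr, hex⟩, htail, hkn⟩ := hN n hn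
    refine ⟨htail d ℓ (hr d d ℓ hadm fun i => by omega), ?_⟩
    set f : Fin k → ℕ := fun i => ⌊(d i : ℝ) ^ (1 / 4 : ℝ)⌋₊ with hf
    have hlow := WRT.tail_lower_of_exact hpos hle hwrt (hv n hkn) d f ℓ
      (fun i => hκ.le.trans ((hr d d ℓ hadm fun i => by omega).le_log i))
      (ε := ε' / 2) (by linarith) hδ1 (fun i => hD _ (hDd i)) (fun e he => by
        have h1 := hex e ℓ (hr d e ℓ hadm fun i => by
          have h2 := WRT.floor_rpow_quarter_le (hadm i).1
          have h3 := (Finset.mem_Ico.1 (he i)).2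
          have h4 : f i ≤ d i := h2
          omega)
        have h2 := (abs_le.1 h1).1
        linarith)
    have hT : ∏ i, WRT.tailFactor ν n (d i) (ℓ i) ((d i + f i : ℕ) + 1)
        = ∏ i, WRT.tailFactor ν n (d i) (ℓ i)
              (d i + (⌊(d i : ℝ) ^ (1 / 4 : ℝ)⌋₊ : ℝ) + 1) := by
      simp only [hf]; push_cast; rfl
    rw [hT] at hlow
    refine le_trans (mul_le_mul_of_nonneg_right ?_ (Finset.prod_nonneg fun i _ =>
      WRT.tailFactor_nonneg hpos hle _ _ _ _)) hlow
    have hB : 1 - ε' / 2 ≤ (1 - δ) ^ k := by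
      have h1 := one_add_mul_le_pow (a := -δ) (by linarith) k
      have h2 : 1 + (k : ℝ) * -δ = 1 - ε' / 2 := by rw [hδ]; field_simp; ring
      rw [h2] at h1
      simpa [sub_eq_add_neg] using h1
    have h1 : ε' ≤ ε := min_le_left _ _
    nlinarith [mul_le_mul_of_nonneg_left hB (by linarith : 0 ≤ 1 - ε' / 2)]

end
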